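/- **Theorem (Split of Time Bounds for Sparse Graphs).** Assume that the Strong Exponential Time Hypothesis (SETH) or the $k$-Dominating Set Hypothesis ($k$-DSH) holds. Let $Q$ be one of the following triangle finding problems on connected simple undirected graphs with integer edge weights, with $n\ge 2$ vertices and $m$ edges: (a) *Minimum Weight Triangle*: find a triangle of minimum weight or report that there is no triangle; (b) *Negative Triangle*: find a triangle of negative total weight or report that there is none; (c) *Negative Triangle Listing*: given also a number $L$, list $L$ distinct triangles of negative weight, or all of them if there are fewer than $L$. Then there is a time bound $T(m,n)$ such that $Q$ has an algorithm running in $O(T(m,n))$ time (uniformly in $L$ in case (c)), and such that for every time bound $T'(m,n)$ for which Eccentricities has an algorithm running in $O(T'(m,n))$ time, $T$ is a *smaller time bound than $T'$ for sparse graphs*. This holds for each of the four versions of Eccentricities (graphs directed or undirected, unweighted or weighted). Here the following definitions are used. * *Eccentricities*: given a connected simple graph with $n\ge2$ vertices and $m$ edges (a directed graph is connected if its underlying undirected graph is), with positive integer edge weights, all equal to $1$ in the unweighted case, compute $\max_{y\in V} d(x,y)\in\mathbb N\cup\{\infty\}$ for each vertex $x$, where $d(x,y)$ is the shortest path distance from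 $x$ to $y$. * A *time bound* is a function $T(m,n)>0$, defined for $m\ge n-1$ and $n\ge2$, that has a growth exponent on sparse graphs: there is $c\in[-\infty,\infty]$ such that $\frac{\log T(m,n)}{\log n}\to c$ as $n\to\infty$ and $\frac{\log m}{\log n}\to 1$ (with $m\ge n-1$). For example, $m^{\alpha}n^{\beta}$ is a time bound, with $c=\alpha+\beta$, also after multiplication by polylogarithmic factors. * $T$ is a *smaller time bound than $T'$ for sparse graphs* if there are constants $\gamma,\epsilon>0$ such that $T(m,n)=O\left(\frac{1}{m^{\epsilon}}\cdot T'(m,n)\right)$ for all values of $m=O(n^{1+\gamma})$; that is, for every $K>0$ there is $C>0$ such that $T(m,n)\le C\,m^{-\epsilon}\,T'(m,n)$ for all $n\ge 2$ and $m\ge n-1$ with $m\le K n^{1+\gamma}$. * SETH: for every $\delta<1$ there is a $k$ such that satisfiability of CNF formulas on $n$ variables, with at most $k$ literals per clause and no repeated clause, cannot be decided in $O(2^{\delta n})$ time. * $k$-DSH: there is a $k_0$ such that for all $k\ge k_0$ and all $\epsilon>0$, a dominating set of size $k$ in a simple undirected graph on $n\ge1$ vertices cannot be found (or reported not to exist)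 in $O(n^{k-\epsilon})$ time. * Algorithms are deterministic programs of a word RAM (unit-cost arithmetic, comparison and bitwise operations, direct and indirect addressing). Graphs are given as edge lists. An algorithm with time bound $O(T)$ works with words of $O(\log(N+T))$ bits, where $N$ is the number of input words plus the largest input word. -/

import Mathlib

open Filter Topology

noncomputable section

namespace SparseSplit

/-! ### The word RAM

Memory is an array of natural numbers indexed by natural numbers. Programs are structured (while)
programs whose elementary steps are the usual unit-cost word operations with direct and indirect
addressing. A value exceeding the largest word must never be written. -/

/-- Memory contents. -/
abbrev Mem := ℕ → ℕ

/-- A memory location: the cell `a`, or the cell whose address is stored in the cell `a`. -/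
inductive Loc where
  | dir (a : ℕ)
  | ind (a : ℕ)

def Loc.addr (s : Mem) : Loc → ℕ
  | .dir a => a
  | .ind a => s a

/-- An operand: a constant or the contents of a memory location. -/
inductive Operand where
  | const (c : ℕ)
  | cell (l : Loc)

def Operand.val (s : Mem) : Operand → ℕ
  | .const c => c
  | .cell l => s (l.addr s)

/-- The unit-cost word operations. -/
inductive WordOp where
  | add | sub | mul | div | mod | lt | eq | and | or | xor | shl | shr

def WordOp.eval : WordOp → ℕ → ℕ → ℕ
  | .add, a, b => a + b
  | .sub, a, b => a - b
  | .mul, a, b => a * b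
  | .div, a, b => a / b
  | .mod, a, b => a % b
  | .lt, a, b => if a < b then 1 else 0
  | .eq, a, b => if a = b then 1 else 0
  | .and, a, b => a &&& b
  | .or, a, b => a ||| b
  | .xor, a, b => a ^^^ b
  | .shl, a, b => a <<< b
  | .shr, a, b => a >>> b

/-- Programs. `branch a P Q` runs `P` if `a` is nonzero and `Q` otherwise; `loop a P` repeats `P`
as long as `a` is nonzero. -/
inductive Prog where
  | skip
  | assign (dst : Loc) (f : WordOp) (a b : Operand)
  | seq (P Q : Prog)
  | branch (a : Operand) (P Q : Prog)
  | loop (a : Operand) (P : Prog)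

/-- `Exec W P s t s'`: on a machine whose largest word is `W`, the program `P` started in memory
`s` halts after exactly `t` steps in memory `s'`. There is no such run if some step would write a
value larger than `W`. -/
inductive Exec (W : ℕ) : Prog → Mem → ℕ → Mem → Prop where
  | skip (s : Mem) : Exec W .skip s 1 s
  | assign (s : Mem) (dst : Loc) (f : WordOp) (a b : Operand)
      (h : f.eval (a.val s) (b.val s) ≤ W) :
      Exec W (.assign dst f a b) s 1
        (Function.update s (dst.addr s) (f.eval (a.val s) (b.val s)))
  | seq {P Q : Prog} {s₁ s₂ s₃ : Mem} {t₁ t₂ : ℕ} (hP : Exec W P s₁ t₁ s₂)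
      (hQ : Exec W Q s₂ t₂ s₃) : Exec W (.seq P Q) s₁ (t₁ + t₂) s₃
  | branch_true {a : Operand} {P Q : Prog} {s s' : Mem} {t : ℕ} (h : a.val s ≠ 0)
      (hP : Exec W P s t s') : Exec W (.branch a P Q) s (t + 1) s'
  | branch_false {a : Operand} {P Q : Prog} {s s' : Mem} {t : ℕ} (h : a.val s = 0)
      (hQ : Exec W Q s t s') : Exec W (.branch a P Q) s (t + 1) s'
  | loop_done {a : Operand} {P : Prog} {s : Mem} (h : a.val s = 0) :
      Exec W (.loop a P) s 1 s
  | loop_step {a : Operand} {P : Prog} {s₁ s₂ s₃ : Mem} {t₁ t₂ : ℕ} (h : a.val s₁ ≠ 0)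
      (hP : Exec W P s₁ t₁ s₂) (hL : Exec W (.loop a P) s₂ t₂ s₃) :
      Exec W (.loop a P) s₁ (t₁ + t₂ + 1) s₃

/-- The initial memory on input `x`: the length of `x`, then the entries of `x`, then zeros. -/
def loadInput (x : List ℕ) : Mem
  | 0 => x.length
  | i + 1 => x.getD i 0

/-- The output left in memory, in the same format as the input. -/
def readOutput (s : Mem) : List ℕ := (List.range (s 0)).map fun i => s (i + 1)

/-! ### Problems and running times -/

/-- A computational problem: its instances, their encoding as sequences of words, and the correct
outputs for each instance. -/
structure Problem where
  Inst : Type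
  encode : Inst → List ℕ
  Sol : Inst → List ℕ → Prop

/-- The size of an input: its number of words plus its largest word (plus 2). -/
def inputSize (x : List ℕ) : ℕ := x.length + x.foldr max 0 + 2

/-- The program `P` solves `Q` in time `O(T)` on the word RAM whose words have
`O(log (input size + T))` bits. -/
def RunsInTime (Q : Problem) (P : Prog) (T : Q.Inst → ℝ) : Prop :=
  ∃ C : ℕ, ∀ x : Q.Inst, ∃ (t : ℕ) (s : Mem),
    Exec ((inputSize (Q.encode x) + ⌈T x⌉₊) ^ C) P (loadInput (Q.encode x)) t s ∧
    (t : ℝ) ≤ C * T x ∧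
    Q.Sol x (readOutput s)

/-- `Q` can be solved in time `O(T)`. -/
def SolvableInTime (Q : Problem) (T : Q.Inst → ℝ) : Prop :=
  ∃ P : Prog, RunsInTime Q P T

/-- A problem about graphs: each instance has a number of vertices and a number of edges. -/
structure GraphProblem extends Problem where
  numVerts : Inst → ℕ
  numEdges : Inst → ℕ

/-- The graph problem `Q` has an algorithm that runs in time `O(T(m,n))` on graphs with `m` edges
and `n` vertices. -/
def HasAlgorithm (Q : GraphProblem) (T : ℕ → ℕ → ℝ) : Prop :=
  SolvableInTime Q.toProblem fun x => T (Q.numEdges x) (Q.numVerts x)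

/-! ### Graphs given by edge lists -/

/-- A graph on `n` vertices given by a list of edges labelled by elements of `α`. -/
structure EdgeList (α : Type) where
  n : ℕ
  edges : List (Fin n × Fin n × α)

namespace EdgeList

variable {α : Type}

/-- The graph is simple: there are no loops, and no edge is listed twice. In a directed graph
`(x, y)` and `(y, x)` are different edges, in an undirected graph they are the same edge. -/
def IsSimple (directed : Bool) (G : EdgeList α) : Prop :=
  (∀ e ∈ G.edges, e.1 ≠ e.2.1) ∧
    if directed then (G.edges.map fun e => (e.1, e.2.1)).Nodup
    else (G.edges.map fun e => s(e.1, e.2.1)).Nodup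

/-- One can move along an edge with label `w` from `x` to `y`. -/
def Arc (directed : Bool) (G : EdgeList α) (x y : Fin G.n) (w : α) : Prop :=
  (x, y, w) ∈ G.edges ∨ (directed = false ∧ (y, x, w) ∈ G.edges)

/-- The underlying undirected graph. -/
def toSimpleGraph (G : EdgeList α) : SimpleGraph (Fin G.n) :=
  SimpleGraph.fromRel fun x y => ∃ w, (x, y, w) ∈ G.edges

/-- The input word sequence for a graph: `n`, `m`, and then the edges one after another. -/
def encode (encLabel : α → List ℕ) (G : EdgeList α) : List ℕ :=
  G.n :: G.edges.length ::
    G.edges.flatMap fun e => e.1.val :: e.2.1.val :: encLabel e.2.2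

/-- There is a walk of total weight `ℓ` from one vertex to another. -/
inductive HasWalk (directed : Bool) (G : EdgeList ℕ) : Fin G.n → Fin G.n → ℕ → Prop where
  | nil (x : Fin G.n) : HasWalk directed G x x 0
  | cons {x y z : Fin G.n} {w ℓ : ℕ} (h : G.Arc directed x y w)
      (hw : HasWalk directed G y z ℓ) : HasWalk directed G x z (w + ℓ)

/-- The shortest path distance from `x` to `y` (infinite if `y` cannot be reached). -/
def dist (directed : Bool) (G : EdgeList ℕ) (x y : Fin G.n) : ℕ∞ :=
  ⨅ (ℓ : ℕ) (_ : HasWalk directed G x y ℓ), (ℓ : ℕ∞)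

/-- The eccentricity of `x`. -/
def ecc (directed : Bool) (G : EdgeList ℕ) (x : Fin G.n) : ℕ∞ :=
  ⨆ y : Fin G.n, G.dist directed x y

/-- In an undirected graph, `a < b < c` are the vertices of a triangle of total weight `t`. -/
def IsTriangle (G : EdgeList ℤ) (a b c : Fin G.n) (t : ℤ) : Prop :=
  a < b ∧ b < c ∧ ∃ u v w : ℤ,
    G.Arc false a b u ∧ G.Arc false b c v ∧ G.Arc false a c w ∧ t = u + v + w

/-- The set of triangles of negative weight. -/
def negTriangles (G : EdgeList ℤ) : Set (Fin G.n × Fin G.n × Fin G.n) :=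
  {q | ∃ t < 0, G.IsTriangle q.1 q.2.1 q.2.2 t}

/-- `D` is a dominating set of the underlying undirected graph. -/
def IsDominating (G : EdgeList α) (D : Finset (Fin G.n)) : Prop :=
  ∀ v, v ∈ D ∨ ∃ u ∈ D, G.toSimpleGraph.Adj u v

end EdgeList

/-! ### Eccentricities -/

/-- Instances of Eccentricities: connected simple graphs with at least two vertices and positive
integer edge weights, all equal to one in the unweighted case. (A directed graph is connected if
its underlying undirected graph is.) -/
structure EccInstance (directed weighted : Bool) where
  graph : EdgeList ℕ
  two_le : 2 ≤ graph.n
  simple : graph.IsSimple directed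
  connected : graph.toSimpleGraph.Connected
  weight_pos : ∀ e ∈ graph.edges, 0 < e.2.2
  weight_one : weighted = false → ∀ e ∈ graph.edges, e.2.2 = 1

/-- A distance as a word: `0` stands for infinity and `d + 1` for the finite value `d`. -/
def distWord (d : ℕ∞) : ℕ := if d = ⊤ then 0 else d.toNat + 1

/-- Eccentricities: output the eccentricity of every vertex. -/
def eccentricities (directed weighted : Bool) : GraphProblem where
  Inst := EccInstance directed weighted
  encode x := x.graph.encode fun w => [w]
  Sol x out := out = List.ofFn fun v => distWord (x.graph.ecc directed v)
  numVerts x := x.graph.n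
  numEdges x := x.graph.edges.length

/-! ### Triangle finding -/

/-- An integer as a pair of words: sign and absolute value. -/
def intWords (w : ℤ) : List ℕ := [if w < 0 then 1 else 0, w.natAbs]

/-- The words for a triple of vertices. -/
def tripleWords {n : ℕ} (q : Fin n × Fin n × Fin n) : List ℕ :=
  [q.1.val, q.2.1.val, q.2.2.val]

/-- Connected simple undirected graphs with at least two vertices and integer edge weights. -/
structure TriInstance where
  graph : EdgeList ℤ
  two_le : 2 ≤ graph.n
  simple : graph.IsSimple false
  connected : graph.toSimpleGraph.Connected

/-- Minimum weight triangle: output a triangle of minimum weight, or the empty sequence if there is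
no triangle. -/
def minWeightTriangle : GraphProblem where
  Inst := TriInstance
  encode x := x.graph.encode intWords
  Sol x out :=
    (∃ a b c t, x.graph.IsTriangle a b c t ∧
      (∀ a' b' c' t', x.graph.IsTriangle a' b' c' t' → t ≤ t') ∧
      out = tripleWords (a, b, c)) ∨
    ((∀ a b c t, ¬ x.graph.IsTriangle a b c t) ∧ out = [])
  numVerts x := x.graph.n
  numEdges x := x.graph.edges.length

/-- Negative triangle: output a triangle of negative weight, or the empty sequence if there is no
such triangle. -/
def negativeTriangle : GraphProblem where
  Inst := TriInstance
  encode x := x.graph.encode intWords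
  Sol x out :=
    (∃ q ∈ x.graph.negTriangles, out = tripleWords q) ∨
    (x.graph.negTriangles = ∅ ∧ out = [])
  numVerts x := x.graph.n
  numEdges x := x.graph.edges.length

/-- Negative triangle listing: given a graph and a number `L`, list `L` distinct triangles of
negative weight, or all of them if there are fewer than `L`. -/
def negativeTriangleListing : GraphProblem where
  Inst := TriInstance × ℕ
  encode x := x.2 :: x.1.graph.encode intWords
  Sol x out := ∃ l : List (Fin x.1.graph.n × Fin x.1.graph.n × Fin x.1.graph.n),
    l.Nodup ∧ (∀ q ∈ l, q ∈ x.1.graph.negTriangles) ∧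
    l.length = min x.2 x.1.graph.negTriangles.ncard ∧
    out = l.flatMap tripleWords
  numVerts x := x.1.graph.n
  numEdges x := x.1.graph.edges.length

/-- The triangle finding problems in the sub-cubic equivalence class. -/
inductive TriangleProblem where
  | minWeight
  | negative
  | negativeListing

def TriangleProblem.problem : TriangleProblem → GraphProblem
  | .minWeight => minWeightTriangle
  | .negative => negativeTriangle
  | .negativeListing => negativeTriangleListing

/-! ### The hypotheses -/

/-- A formula in conjunctive normal form, without repeated clauses, whose clauses have at most `k`
literals. The literal `(i, true)` is the variable `i`, and `(i, false)` is its negation. -/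
structure KCNF (k : ℕ) where
  n : ℕ
  clauses : List (List (Fin n × Bool))
  nodup : clauses.Nodup
  width : ∀ c ∈ clauses, c.length ≤ k

def KCNF.Satisfiable {k : ℕ} (φ : KCNF k) : Prop :=
  ∃ a : Fin φ.n → Bool, ∀ c ∈ φ.clauses, ∃ l ∈ c, a l.1 = l.2

open Classical in
/-- `k`-SAT: output `1` if the formula is satisfiable and `0` otherwise. -/
def kSAT (k : ℕ) : Problem where
  Inst := KCNF k
  encode φ := φ.n :: φ.clauses.length ::
    φ.clauses.flatMap fun c => c.length :: c.flatMap fun l => [l.1.val, l.2.toNat]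
  Sol φ out := out = [if φ.Satisfiable then 1 else 0]

/-- The Strong Exponential Time Hypothesis. -/
def SETH : Prop :=
  ∀ δ : ℝ, δ < 1 → ∃ k : ℕ, ¬ SolvableInTime (kSAT k) fun φ => (2 : ℝ) ^ (δ * (φ.n : ℝ))

/-- Nonempty simple undirected graphs. -/
structure DomInstance where
  graph : EdgeList Unit
  pos : 0 < graph.n
  simple : graph.IsSimple false

/-- `k`-Dominating Set: output `1` followed by the elements of a dominating set of size `k`, or `0`
if there is no such set. -/
def dominatingSet (k : ℕ) : Problem where
  Inst := DomInstance
  encode x := x.graph.encode fun _ => []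
  Sol x out :=
    (∃ l : List (Fin x.graph.n), l.Nodup ∧ l.length = k ∧ x.graph.IsDominating l.toFinset ∧
      out = 1 :: l.map Fin.val) ∨
    ((¬ ∃ D : Finset (Fin x.graph.n), D.card = k ∧ x.graph.IsDominating D) ∧ out = [0])

/-- The `k`-Dominating Set Hypothesis. -/
def KDSH : Prop :=
  ∃ k₀ : ℕ, ∀ k ≥ k₀, ∀ ε : ℝ, 0 < ε →
    ¬ SolvableInTime (dominatingSet k) fun x => (x.graph.n : ℝ) ^ ((k : ℝ) - ε)

/-! ### Time bounds for sparse graphs -/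

/-- The filter on pairs `(m, n)` with `n - 1 ≤ m` along which `n` tends to infinity and
`m = n ^ (1 + o(1))`. -/
def sparseLimit : Filter (ℕ × ℕ) :=
  comap Prod.snd atTop ⊓
    comap (fun p : ℕ × ℕ => Real.log p.1 / Real.log p.2) (𝓝 1) ⊓
    𝓟 {p | p.2 ≤ p.1 + 1}

/-- A time bound: a positive function `T(m,n)`, defined for `m ≥ n - 1` and `n ≥ 2`, that has a
growth exponent on sparse graphs, i.e. `T(m,n) = n ^ (c + o(1))` when `m = n ^ (1 + o(1))`, for some
`c` in the extended reals. The bound `m ^ α * n ^ β`, possibly times logarithms, has the exponent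
`α + β`. -/
def IsTimeBound (T : ℕ → ℕ → ℝ) : Prop :=
  (∀ m n : ℕ, 2 ≤ n → n ≤ m + 1 → 0 < T m n) ∧
  ∃ c : EReal, Tendsto
    (fun p : ℕ × ℕ => ((Real.log (T p.1 p.2) / Real.log p.2 : ℝ) : EReal)) sparseLimit (𝓝 c)

/-- `T` is a smaller time bound than `T'` for sparse graphs: for some `γ, ε > 0`,
`T(m,n) = O(m ^ (-ε) * T'(m,n))` for all values of `m = O(n ^ (1 + γ))`. -/
def IsSmallerForSparse (T T' : ℕ → ℕ → ℝ) : Prop :=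
  ∃ γ ε : ℝ, 0 < γ ∧ 0 < ε ∧ ∀ K : ℝ, 0 < K → ∃ C : ℝ, 0 < C ∧
    ∀ m n : ℕ, 2 ≤ n → n ≤ m + 1 → (m : ℝ) ≤ K * (n : ℝ) ^ (1 + γ) →
      T m n ≤ C * (1 / (m : ℝ) ^ ε * T' m n)

end SparseSplit

end

open SparseSplit

namespace SparseSplit

/-! The bound is `m ^ (3 / 2)`, for all three triangle problems.

Upper bound. For every edge, run through the neighbors of its endpoint of smaller degree and look up
in a weight matrix whether the neighbor closes a triangle; a triangle is recorded only from the edge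
between its two smallest vertices, hence once. The number of steps is the sum over the edges of the
smaller endpoint degree. By Cauchy–Schwarz, the square of this sum is at most `m` times the sum over
the edges of `deg u * deg v`, hence at most `m * (2 * m) ^ 2` (`SimpleEdges.scanCost_sq_le`). A
minimum weight triangle, a negative triangle or the first `L` negative triangles are then read off
from the list (`hasAlgorithm_triangleProblem`).

Lower bound. Let `T'` be a time bound for Eccentricities, with growth exponent `c`. If `c < 2`, then
`T' m n ≤ n ^ q` for some `q < 2` on all large graphs with `m ≤ n ^ (1 + η)`, and both hypotheses
fail. The common intermediate problem is to find disjoint sets, one from each of two families of `N`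
subsets of a `d`-element universe. Join sets to their elements and add two adjacent hubs, one for
each family, both joined to all elements. A set of the first family has eccentricity 3 if some set
of the second family is disjoint from it, and at most 2 otherwise (`distWord_ecc`). The graph has `V
= 2 * N + d + 2` vertices and `O(V * (d + 2))` edges, so it is sparse if `d` is small.

For `k`-SAT, the sets are indexed by the assignments to half of the variables and consist of the
clauses left unsatisfied; the formula is satisfiable iff two such sets are disjoint
(`satisfiable_iff`). Here `N` is about `2 ^ (n / 2)`. A formula without repeated clauses has only
polynomially many of them, so `d = 2 ^ (o(n))` without any sparsification. A time of `V ^ q` gives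
`2 ^ (δ * n)` with one `δ < 1` for all `k` (`not_SETH_of_hasAlgorithm`).

For dominating sets of size `2 * h`, the sets are indexed by the `h`-tuples of vertices and consist
of the undominated vertices. Here `N = n ^ h` and `d = n`, and the graph is as sparse as desired for
large `h`. A time of `V ^ q` gives `n ^ (h * q) = n ^ (2 * h - h * (2 - q))`
(`not_KDSH_of_hasAlgorithm`).

Hence `c ≥ 2`, so `T' m n ≥ n ^ (7 / 4)` on large sparse graphs, which exceeds `m ^ (3 / 2)` by a
power of `m` (`isSmallerForSparse_of_growth`).

All algorithms are actual word RAM programs. They are written in a small structured language with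
arrays ("banks") and local variables. `Runs` carries correctness, time and word size together, and
`solvableInTime_of_runs` turns a verified structured program into a machine program. `Runs.toCmd`
lets the assumed Eccentricities program run as a subroutine inside one bank. -/

/-! ### A structured language on top of the word RAM

The memory is divided into sixteen interleaved banks. Twelve of them are visible to the programs of
the structured language, one holds the values of local variables, one holds temporary values. -/

/-- The contents of the twelve visible memory banks. -/
abbrev Banks := Fin 12 → ℕ → ℕ

/-- Expressions: constants, local variables (de Bruijn indices), bank entries and operations. -/
inductive Ex where
  | c (n : ℕ)
  | v (i : ℕ)
  | a (b : Fin 12) (e : Ex)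
  | op (f : WordOp) (x y : Ex)

namespace Ex

instance : Add Ex := ⟨.op .add⟩
instance : Sub Ex := ⟨.op .sub⟩
instance : Mul Ex := ⟨.op .mul⟩
instance : Div Ex := ⟨.op .div⟩
instance : Mod Ex := ⟨.op .mod⟩
instance (n : ℕ) : OfNat Ex n := ⟨.c n⟩

/-- The expression `x < y`. -/
abbrev lt (x y : Ex) : Ex := .op .lt x y

/-- The value of an expression. -/
def val (env : List ℕ) (σ : Banks) : Ex → ℕ
  | c n => n
  | v i => env.getD i 0
  | a b e => σ b (e.val env σ)
  | op f x y => f.eval (x.val env σ) (y.val env σ)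

/-- The operations whose results can be larger than their arguments. -/
def grows : WordOp → Bool
  | .add | .mul | .or | .xor | .shl => true
  | _ => false

/-- No intermediate value of the expression exceeds `B`. -/
def ok (B : ℕ) (env : List ℕ) (σ : Banks) : Ex → Prop
  | c n => n ≤ B
  | v _ => True
  | a _ e => e.ok B env σ
  | op f x y => x.ok B env σ ∧ y.ok B env σ ∧
      (grows f = true → f.eval (x.val env σ) (y.val env σ) ≤ B)

/-- The number of machine operations for an expression. -/
def size : Ex → ℕ
  | c _ => 1
  | v _ => 1
  | a _ e => e.size + 3
  | op _ x y => x.size + y.size + 1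

section
variable (env : List ℕ) (σ : Banks) (B n i : ℕ) (b : Fin 12) (x y : Ex)

@[simp] theorem val_ofNat : val env σ (no_index (OfNat.ofNat n) : Ex) = n := rfl
@[simp] theorem val_c : val env σ (.c n) = n := rfl
@[simp] theorem val_v : val env σ (.v i) = env.getD i 0 := rfl
@[simp] theorem val_a : val env σ (.a b x) = σ b (x.val env σ) := rfl
@[simp] theorem val_add : val env σ (x + y) = x.val env σ + y.val env σ := rfl
@[simp] theorem val_sub : val env σ (x - y) = x.val env σ - y.val env σ := rfl
@[simp] theorem val_mul : val env σ (x * y) = x.val env σ * y.val env σ := rfl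
@[simp] theorem val_div : val env σ (x / y) = x.val env σ / y.val env σ := rfl
@[simp] theorem val_mod : val env σ (x % y) = x.val env σ % y.val env σ := rfl
@[simp] theorem val_lt : val env σ (.op .lt x y) =
    if x.val env σ < y.val env σ then 1 else 0 := rfl
@[simp] theorem val_eq : val env σ (.op .eq x y) =
    if x.val env σ = y.val env σ then 1 else 0 := rfl
@[simp] theorem val_shl : val env σ (.op .shl x y) = x.val env σ <<< y.val env σ := rfl
@[simp] theorem val_shr : val env σ (.op .shr x y) = x.val env σ >>> y.val env σ := rfl

@[simp] theorem ok_ofNat : ok B env σ (no_index (OfNat.ofNat n) : Ex) ↔ n ≤ B := Iff.rfl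
@[simp] theorem ok_c : ok B env σ (.c n) ↔ n ≤ B := Iff.rfl
@[simp] theorem ok_v : ok B env σ (.v i) ↔ True := Iff.rfl
@[simp] theorem ok_a : ok B env σ (.a b x) ↔ x.ok B env σ := Iff.rfl
@[simp] theorem ok_add : ok B env σ (x + y) ↔
    x.ok B env σ ∧ y.ok B env σ ∧ x.val env σ + y.val env σ ≤ B := by
  change _ ∧ _ ∧ _ ↔ _
  simp [grows, WordOp.eval]
@[simp] theorem ok_mul : ok B env σ (x * y) ↔
    x.ok B env σ ∧ y.ok B env σ ∧ x.val env σ * y.val env σ ≤ B := by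
  change _ ∧ _ ∧ _ ↔ _
  simp [grows, WordOp.eval]
@[simp] theorem ok_shl : ok B env σ (.op .shl x y) ↔
    x.ok B env σ ∧ y.ok B env σ ∧ x.val env σ <<< y.val env σ ≤ B := by
  change _ ∧ _ ∧ _ ↔ _
  simp [grows, WordOp.eval]
@[simp] theorem ok_sub : ok B env σ (x - y) ↔ x.ok B env σ ∧ y.ok B env σ := by
  change _ ∧ _ ∧ _ ↔ _
  simp [grows]
@[simp] theorem ok_div : ok B env σ (x / y) ↔ x.ok B env σ ∧ y.ok B env σ := by
  change _ ∧ _ ∧ _ ↔ _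
  simp [grows]
@[simp] theorem ok_mod : ok B env σ (x % y) ↔ x.ok B env σ ∧ y.ok B env σ := by
  change _ ∧ _ ∧ _ ↔ _
  simp [grows]
@[simp] theorem ok_lt : ok B env σ (.op .lt x y) ↔ x.ok B env σ ∧ y.ok B env σ := by
  change _ ∧ _ ∧ _ ↔ _
  simp [grows]
@[simp] theorem ok_eq : ok B env σ (.op .eq x y) ↔ x.ok B env σ ∧ y.ok B env σ := by
  change _ ∧ _ ∧ _ ↔ _
  simp [grows]
@[simp] theorem ok_shr : ok B env σ (.op .shr x y) ↔ x.ok B env σ ∧ y.ok B env σ := by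
  change _ ∧ _ ∧ _ ↔ _
  simp [grows]

end

/-- Code that leaves the value of an expression in the temporary cell `t`, for `d` local
variables. -/
def compile (d : ℕ) : Ex → ℕ → Prog
  | c n, t => .assign (.dir (16 * t + 1)) .add (.const n) (.const 0)
  | v i, t => .assign (.dir (16 * t + 1)) .add
      (if i < d then .cell (.dir (16 * (d - 1 - i))) else .const 0) (.const 0)
  | a b e, t => .seq (e.compile d t) <| .seq
      (.assign (.dir (16 * t + 1)) .mul (.cell (.dir (16 * t + 1))) (.const 16)) <| .seq
      (.assign (.dir (16 * t + 1)) .add (.cell (.dir (16 * t + 1))) (.const (b.val + 4)))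
      (.assign (.dir (16 * t + 1)) .add (.cell (.ind (16 * t + 1))) (.const 0))
  | op f x y, t => .seq (x.compile d t) <| .seq (y.compile d (t + 1))
      (.assign (.dir (16 * t + 1)) f (.cell (.dir (16 * t + 1))) (.cell (.dir (16 * (t + 1) + 1))))

end Ex

/-- The memory `s` holds the bank contents `σ` and the values `env` of the local variables. -/
def Rep (env : List ℕ) (σ : Banks) (s : Mem) : Prop :=
  (∀ (b : Fin 12) i, s (16 * i + (b.val + 4)) = σ b i) ∧
    ∀ j < env.length, s (16 * (env.length - 1 - j)) = env.getD j 0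

/-- All values are at most `B`. -/
def Bdd (B : ℕ) (env : List ℕ) (σ : Banks) : Prop :=
  1 ≤ B ∧ (∀ b i, σ b i ≤ B) ∧ ∀ j, env.getD j 0 ≤ B

/-- Temporaries are the cells congruent to 1 modulo 16, whereas local variables occupy the residue 0
and the banks the residues 4 to 15. -/
theorem Rep.update_tmp {env : List ℕ} {σ : Banks} {s : Mem} (h : Rep env σ s) (t x : ℕ) :
    Rep env σ (Function.update s (16 * t + 1) x) := by
  refine ⟨fun b i => ?_, fun j hj => ?_⟩
  · rw [Function.update_of_ne (by omega), h.1]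
  · rw [Function.update_of_ne (by omega), h.2 j hj]

theorem Exec.assign' {W : ℕ} {s : Mem} {dst : Loc} {f : WordOp} {a b : Operand} {x i : ℕ}
    (hi : dst.addr s = i) (hx : f.eval (a.val s) (b.val s) = x) (h : x ≤ W) :
    Exec W (.assign dst f a b) s 1 (Function.update s i x) := by
  subst hi hx; exact Exec.assign s dst f a b h

/-- `ok` asks for a bound only at the operations in `grows`. Every other operation yields at most
its first operand, or at most 1. -/
theorem Ex.val_le {B : ℕ} {env : List ℕ} {σ : Banks} (hB : Bdd B env σ) :
    ∀ e : Ex, e.ok B env σ → e.val env σ ≤ B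
  | .c _, h => h
  | .v i, _ => hB.2.2 i
  | .a b _, _ => hB.2.1 b _
  | .op f x y, ⟨hx, hy, h⟩ => by
    have h1 := Ex.val_le hB x hx
    have h2 := Ex.val_le hB y hy
    have h0 := hB.1
    change f.eval (x.val env σ) (y.val env σ) ≤ B
    generalize x.val env σ = p at *
    generalize y.val env σ = q at *
    cases f <;> simp only [grows, WordOp.eval] at h ⊢
    · exact h trivial
    · omega
    · exact h trivial
    · exact (Nat.div_le_self _ _).trans h1
    · exact (Nat.mod_le _ _).trans h1
    · split_ifs <;> omega
    · split_ifs <;> omega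
    · exact Nat.and_le_left.trans h1
    · exact h trivial
    · exact h trivial
    · exact h trivial
    · rw [Nat.shiftRight_eq_div_pow]; exact (Nat.div_le_self _ _).trans h1

/-- The right operand is computed one temporary higher than the left one. The last clause of the
conclusion, that lower temporaries survive, keeps the left operand available. Words up to `16 * B +
16` are enough for the address of any entry of any bank with index at most `B`. -/
theorem Ex.compile_spec {B : ℕ} {env : List ℕ} {σ : Banks} (hB : Bdd B env σ) :
    ∀ (e : Ex) (t : ℕ) (s : Mem), e.ok B env σ → Rep env σ s →
      ∃ s', Exec (16 * B + 16) (e.compile env.length t) s e.size s' ∧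
        s' (16 * t + 1) = e.val env σ ∧ Rep env σ s' ∧
        ∀ j < t, s' (16 * j + 1) = s (16 * j + 1)
  | .c n, t, s, h, hs => by
    refine ⟨_, Exec.assign' (x := n) rfl rfl ?_, by simp [Loc.addr], hs.update_tmp _ _, ?_⟩
    · change n ≤ B at h
      omega
    · intro j hj
      exact Function.update_of_ne (show 16 * j + 1 ≠ 16 * t + 1 by omega) _ _
  | .v i, t, s, h, hs => by
    refine ⟨_, Exec.assign' (x := env.getD i 0) rfl ?_ ?_, by simp [Loc.addr],
      hs.update_tmp _ _, ?_⟩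
    · split_ifs with h1
      · exact hs.2 i h1
      · simp [Operand.val, WordOp.eval, List.getElem?_eq_none (not_lt.mp h1)]
    · have := hB.2.2 i
      omega
    · intro j hj
      exact Function.update_of_ne (show 16 * j + 1 ≠ 16 * t + 1 by omega) _ _
  | .a b e, t, s, h, hs => by
    obtain ⟨s1, e1, v1, r1, k1⟩ := Ex.compile_spec hB e t s h hs
    have hv := Ex.val_le hB e h
    have hb := b.2
    refine ⟨_, (Exec.seq e1 (Exec.seq (Exec.assign' (x := e.val env σ * 16) rfl ?_ ?_)
      (Exec.seq (Exec.assign' (x := e.val env σ * 16 + (b.val + 4)) rfl ?_ ?_)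
      (Exec.assign' (x := σ b (e.val env σ)) rfl ?_ ?_)))), ?_, ?_, ?_⟩
    · simp [Operand.val, Loc.addr, WordOp.eval, v1]
    · omega
    · simp [Operand.val, Loc.addr, WordOp.eval]
    · omega
    · have := ((r1.update_tmp t (e.val env σ * 16)).update_tmp t
        (e.val env σ * 16 + (b.val + 4))).1 b (e.val env σ)
      rw [mul_comm 16 (e.val env σ)] at this
      simpa [Operand.val, Loc.addr, WordOp.eval] using this
    · have := hB.2.1 b (e.val env σ)
      omega
    · simp [Loc.addr]
    · exact ((r1.update_tmp _ _).update_tmp _ _).update_tmp _ _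
    · intro j hj
      simp only [Loc.addr]
      rw [Function.update_of_ne (by omega), Function.update_of_ne (by omega),
        Function.update_of_ne (by omega), k1 j hj]
  | .op f x y, t, s, h, hs => by
    have hv := Ex.val_le hB (.op f x y) h
    obtain ⟨s1, e1, v1, r1, k1⟩ := Ex.compile_spec hB x t s h.1 hs
    obtain ⟨s2, e2, v2, r2, k2⟩ := Ex.compile_spec hB y (t + 1) s1 h.2.1 r1
    refine ⟨_, ?_, ?_, r2.update_tmp t (Ex.val env σ (.op f x y)), ?_⟩
    · have := Exec.seq e1 (Exec.seq e2 (Exec.assign' (dst := .dir (16 * t + 1)) (f := f)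
        (a := .cell (.dir (16 * t + 1))) (b := .cell (.dir (16 * (t + 1) + 1)))
        (x := Ex.val env σ (.op f x y)) (W := 16 * B + 16) rfl ?_ ?_))
      · rw [← add_assoc] at this
        exact this
      · change f.eval (s2 (16 * t + 1)) (s2 (16 * (t + 1) + 1)) = _
        rw [v2, k2 t (by omega), v1]
        rfl
      · omega
    · simp
    · intro j hj
      rw [Function.update_of_ne (by omega), k2 j (by omega), k1 j hj]

/-- Commands. `letE e C` runs `C` with one more local variable, whose value is that of `e`;
`forV i C` runs `C` with one more local variable, for all values from `0` to the value of the local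
variable `i` (exclusive). -/
inductive Cmd where
  | skip
  | store (b : Fin 12) (i e : Ex)
  | seq (C D : Cmd)
  | ite (e : Ex) (C D : Cmd)
  | letE (e : Ex) (C : Cmd)
  | forV (i : ℕ) (C : Cmd)
  | whileE (e : Ex) (C : Cmd)

infixr:30 " ;; " => Cmd.seq

namespace Cmd

/-- With `d` local variables in scope, the next one goes to the cell `16 * d`. In a store, the cell
1 receives the address and the cell 17 the value. A loop condition is computed before the loop and
again at the end of its body, so that the cell 1 is current at each test. -/
def compile (d : ℕ) : Cmd → Prog
  | skip => .skip
  | store b i e => .seq (i.compile d 0) <| .seq (e.compile d 1) <| .seq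
      (.assign (.dir 1) .mul (.cell (.dir 1)) (.const 16)) <| .seq
      (.assign (.dir 1) .add (.cell (.dir 1)) (.const (b.val + 4)))
      (.assign (.ind 1) .add (.cell (.dir 17)) (.const 0))
  | seq C D => .seq (C.compile d) (D.compile d)
  | ite e C D => .seq (e.compile d 0) (.branch (.cell (.dir 1)) (C.compile d) (D.compile d))
  | letE e C => .seq (e.compile d 0) <| .seq
      (.assign (.dir (16 * d)) .add (.cell (.dir 1)) (.const 0)) (C.compile (d + 1))
  | forV i C => .seq (.assign (.dir (16 * d)) .add (.const 0) (.const 0)) <| .seq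
      ((Ex.lt (.v 0) (.v (i + 1))).compile (d + 1) 0) <|
      .loop (.cell (.dir 1)) <| .seq (C.compile (d + 1)) <| .seq
        (.assign (.dir (16 * d)) .add (.cell (.dir (16 * d))) (.const 1))
        ((Ex.lt (.v 0) (.v (i + 1))).compile (d + 1) 0)
  | whileE e C => .seq (e.compile d 0) <|
      .loop (.cell (.dir 1)) <| .seq (C.compile d) (e.compile d 0)

/-- The number of machine steps per step of the structured program. -/
def cost : Cmd → ℕ
  | skip => 1
  | store _ i e => i.size + e.size + 3
  | seq C D => C.cost + D.cost
  | ite e C D => e.size + 1 + C.cost + D.cost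
  | letE e C => e.size + 1 + C.cost
  | forV _ C => 5 + C.cost
  | whileE e C => e.size + 1 + C.cost

end Cmd

/-- From bank contents `σ`, the program `C` halts after at most `T` steps, without exceeding the
value `B`, in bank contents that satisfy `Q`. -/
def Runs (B : ℕ) (C : Cmd) (env : List ℕ) (σ : Banks) (T : ℕ) (Q : Banks → Prop) : Prop :=
  Bdd B env σ → ∀ s, Rep env σ s → ∃ t s' σ',
    Exec (16 * B + 16) (C.compile env.length) s t s' ∧ t ≤ C.cost * T ∧ Rep env σ' s' ∧
    (∀ b i, σ' b i ≤ B) ∧ Q σ'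

namespace Runs

variable {B : ℕ} {C D : Cmd} {env : List ℕ} {σ : Banks} {T T₁ T₂ : ℕ} {Q : Banks → Prop}

theorem mono {Q' : Banks → Prop} (h : Runs B C env σ T₁ Q) (hT : T₁ ≤ T)
    (hQ : ∀ σ, Q σ → Q' σ) : Runs B C env σ T Q' := by
  intro hB s hs
  obtain ⟨t, s', σ', h1, h2, h3, h4, h5⟩ := h hB s hs
  exact ⟨t, s', σ', h1, h2.trans (Nat.mul_le_mul_left _ hT), h3, h4, hQ _ h5⟩

theorem time_le (h : Runs B C env σ T₁ Q) (hT : T₁ ≤ T) : Runs B C env σ T Q :=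
  h.mono hT fun _ => id

theorem skip (h : Q σ) : Runs B .skip env σ 1 Q :=
  fun hB s hs => ⟨1, s, σ, Exec.skip s, by simp [Cmd.cost], hs, hB.2.1, h⟩

theorem store {b : Fin 12} {i e : Ex} (hi : i.ok B env σ) (he : e.ok B env σ)
    (hQ : Q (Function.update σ b (Function.update (σ b) (i.val env σ) (e.val env σ)))) :
    Runs B (.store b i e) env σ 1 Q := by
  intro hB s hs
  obtain ⟨s1, e1, v1, r1, -⟩ := i.compile_spec hB 0 s hi hs
  obtain ⟨s2, e2, v2, r2, k2⟩ := e.compile_spec hB 1 s1 he r1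
  have hi' := Ex.val_le hB i hi
  have he' := Ex.val_le hB e he
  have hb := b.2
  replace k2 := (k2 0 one_pos).trans v1
  simp only [mul_zero, zero_add, mul_one] at k2 v1 v2
  have r3 := (r2.update_tmp 0 (i.val env σ * 16)).update_tmp 0 (i.val env σ * 16 + (b.val + 4))
  simp only [mul_zero, zero_add] at r3
  refine ⟨_, _, _, Exec.seq e1 (Exec.seq e2 (Exec.seq (Exec.assign' (i := 1)
    (x := i.val env σ * 16) rfl ?_ ?_)
    (Exec.seq (Exec.assign' (i := 1) (x := i.val env σ * 16 + (b.val + 4)) rfl ?_ ?_)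
    (Exec.assign' (i := 16 * i.val env σ + (b.val + 4)) (x := e.val env σ) ?_ ?_ ?_)))),
    ?_, ?_, ?_, hQ⟩
  · simp [Operand.val, Loc.addr, WordOp.eval, k2]
  · omega
  · simp [Operand.val, Loc.addr, WordOp.eval]
  · omega
  · simp [Loc.addr, mul_comm]
  · simp [Operand.val, Loc.addr, WordOp.eval, v2]
  · omega
  · simp only [Cmd.cost]; omega
  · refine ⟨fun b' j => ?_, fun j hj => ?_⟩
    · by_cases h : b' = b
      · subst h
        rw [Function.update_self]
        by_cases h' : j = i.val env σ
        · subst h'; simp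
        · rw [Function.update_of_ne (by omega), Function.update_of_ne h']
          exact r3.1 b' j
      · rw [Function.update_of_ne h, Function.update_of_ne]
        · exact r3.1 b' j
        · have := b'.2
          have : b'.val ≠ b.val := fun h' => h (Fin.ext h')
          omega
    · rw [Function.update_of_ne (by omega)]
      exact r3.2 j hj
  · intro b' j
    by_cases h : b' = b
    · subst h
      rw [Function.update_self]
      by_cases h' : j = i.val env σ
      · subst h'; simpa using he'
      · rw [Function.update_of_ne h']; exact hB.2.1 _ _
    · rw [Function.update_of_ne h]; exact hB.2.1 _ _

/-- Costs add up along the program text and times along the run, so the product of the two sums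
dominates the sum of the two products. -/
theorem seq (h : Runs B C env σ T₁ fun σ' => Runs B D env σ' T₂ Q) :
    Runs B (.seq C D) env σ (T₁ + T₂) Q := by
  intro hB s hs
  obtain ⟨t, s1, σ1, e1, h1, r1, b1, h2⟩ := h hB s hs
  obtain ⟨t', s2, σ2, e2, h3, r2, b2, h4⟩ := h2 ⟨hB.1, b1, hB.2.2⟩ s1 r1
  refine ⟨t + t', s2, σ2, e1.seq e2, ?_, r2, b2, h4⟩
  simp only [Cmd.cost]
  nlinarith

theorem seq' (h : Runs B C env σ T₁ fun σ' => Runs B D env σ' T₂ Q) (hT : T₁ + T₂ ≤ T) :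
    Runs B (.seq C D) env σ T Q :=
  (seq h).time_le hT

theorem ite {e : Ex} (he : e.ok B env σ) (h1 : e.val env σ ≠ 0 → Runs B C env σ T Q)
    (h2 : e.val env σ = 0 → Runs B D env σ T Q) : Runs B (.ite e C D) env σ (1 + T) Q := by
  intro hB s hs
  obtain ⟨s1, e1, v1, r1, -⟩ := e.compile_spec hB 0 s he hs
  simp only [mul_zero, zero_add] at v1
  by_cases h : e.val env σ = 0
  · obtain ⟨t, s', σ', e2, h3, h4, h5, h6⟩ := h2 h hB s1 r1
    refine ⟨_, s', σ', e1.seq (.branch_false (v1.trans h) e2), ?_, h4, h5, h6⟩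
    simp only [Cmd.cost]
    nlinarith [Nat.zero_le (C.cost * T), Nat.zero_le (e.size * T)]
  · obtain ⟨t, s', σ', e2, h3, h4, h5, h6⟩ := h1 h hB s1 r1
    refine ⟨_, s', σ', e1.seq (.branch_true (fun h0 => h (v1.symm.trans h0)) e2), ?_, h4, h5, h6⟩
    simp only [Cmd.cost]
    nlinarith [Nat.zero_le (D.cost * T), Nat.zero_le (e.size * T)]

/-- Variables are stored by depth and not by index: a new variable takes a fresh cell and the older
ones stay in place although their indices shift. -/
theorem _root_.SparseSplit.Rep.push {s : Mem} (h : Rep env σ s) (x : ℕ) :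
    Rep (x :: env) σ (Function.update s (16 * env.length) x) := by
  refine ⟨fun b i => ?_, fun j hj => ?_⟩
  · have := b.2
    rw [Function.update_of_ne (by omega), h.1]
  · rcases j with _ | j
    · simp
    · rw [List.length_cons] at hj ⊢
      rw [Function.update_of_ne (by omega), List.getD_cons_succ, ← h.2 j (by omega)]
      congr 2; omega

theorem _root_.SparseSplit.Rep.pop {s : Mem} {x : ℕ} (h : Rep (x :: env) σ s) : Rep env σ s := by
  refine ⟨h.1, fun j hj => ?_⟩
  have := h.2 (j + 1) (by simpa using hj)
  rw [List.getD_cons_succ] at this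
  rw [← this]
  simp only [List.length_cons]
  congr 2; omega

theorem _root_.SparseSplit.Bdd.push {x : ℕ} (h : Bdd B env σ) (hx : x ≤ B) : Bdd B (x :: env) σ := by
  refine ⟨h.1, h.2.1, fun j => ?_⟩
  rcases j with _ | j
  · simpa using hx
  · simpa using h.2.2 j

theorem letE {e : Ex} (he : e.ok B env σ) (h : Runs B C (e.val env σ :: env) σ T Q) :
    Runs B (.letE e C) env σ (1 + T) Q := by
  intro hB s hs
  obtain ⟨s1, e1, v1, r1, -⟩ := e.compile_spec hB 0 s he hs
  simp only [mul_zero, zero_add] at v1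
  have he' := Ex.val_le hB e he
  obtain ⟨t, s', σ', e2, h3, h4, h5, h6⟩ := h (hB.push he') _ (r1.push _)
  refine ⟨_, s', σ', e1.seq (Exec.seq (Exec.assign' (i := 16 * env.length)
    (x := e.val env σ) rfl ?_ ?_) e2), ?_, h4.pop, h5, h6⟩
  · simp [Operand.val, Loc.addr, WordOp.eval, v1]
  · omega
  · simp only [Cmd.cost]
    nlinarith [Nat.zero_le (e.size * T)]

/-- Commands write only to banks, so the body cannot change the counter or the limit, and the number
of rounds is known on entry. The times `τ k` may vary with the round, which is essential for the
enumeration of triangles. -/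
theorem forV {i : ℕ} {τ : ℕ → ℕ} (I : ℕ → Banks → Prop) (h0 : I 0 σ)
    (h : ∀ k < env.getD i 0, ∀ σ', I k σ' → Runs B C (k :: env) σ' (τ k) (I (k + 1)))
    (hQ : ∀ σ', I (env.getD i 0) σ' → Q σ') :
    Runs B (.forV i C) env σ (1 + ∑ k ∈ Finset.range (env.getD i 0), (τ k + 1)) Q := by
  intro hB s hs
  set n := env.getD i 0 with hn
  have hnB : n ≤ B := hB.2.2 i
  set cond := Ex.lt (.v 0) (.v (i + 1)) with hcond
  have hsz : cond.size = 3 := rfl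
  have hval : ∀ k σ', cond.val (k :: env) σ' = if k < n then 1 else 0 := by
    intro k σ'; simp only [hcond, Ex.val_lt, Ex.val_v, List.getD_cons_zero, List.getD_cons_succ, hn]
  have hok : ∀ k σ', cond.ok B (k :: env) σ' := by intro k σ'; simp [hcond]
  -- Induction on the number `r` of rounds that remain; the cell 1 already holds the truth value of
  -- the loop test.
  have key : ∀ r k, k + r = n → ∀ σ' s', I k σ' → Rep (k :: env) σ' s' → Bdd B (k :: env) σ' →
      s' 1 = (if k < n then 1 else 0) →
      ∃ t s'' σ'', Exec (16 * B + 16) (.loop (.cell (.dir 1)) <| .seq (C.compile (env.length + 1)) <|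
        .seq (.assign (.dir (16 * env.length)) .add (.cell (.dir (16 * env.length))) (.const 1))
        (cond.compile (env.length + 1) 0)) s' t s'' ∧
        t ≤ 1 + (5 + C.cost) * ∑ k ∈ Finset.Ico k n, (τ k + 1) ∧
        Rep env σ'' s'' ∧ (∀ b i, σ'' b i ≤ B) ∧ I n σ'' := by
    intro r
    induction r with
    | zero =>
      intro k hk σ' s' hI hR hB' h1
      simp only [add_zero] at hk
      subst hk
      rw [if_neg (lt_irrefl _)] at h1
      exact ⟨1, s', σ', Exec.loop_done h1, by simp, hR.pop, hB'.2.1, hI⟩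
    | succ r ih =>
      intro k hk σ' s' hI hR hB' h1
      have hkn : k < n := by omega
      rw [if_pos hkn] at h1
      obtain ⟨t1, s1, σ1, e1, l1, r1, b1, I1⟩ := h k hkn σ' hI hB' s' hR
      have r2 := r1.pop.push (k + 1)
      have hB2 : Bdd B ((k + 1) :: env) σ1 := Bdd.push ⟨hB.1, b1, hB.2.2⟩ (by omega)
      obtain ⟨s3, e3, v3, r3, -⟩ := cond.compile_spec hB2 0 _ (hok _ _) r2
      simp only [mul_zero, zero_add] at v3
      rw [hval] at v3
      obtain ⟨t4, s4, σ4, e4, l4, r4, b4, I4⟩ := ih (k + 1) (by omega) σ1 s3 I1 r3 hB2 v3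
      refine ⟨_, s4, σ4, Exec.loop_step (by simp [Operand.val, Loc.addr, h1])
        (Exec.seq e1 (Exec.seq (Exec.assign' (i := 16 * env.length) (x := k + 1) rfl ?_ ?_) e3)) e4,
        ?_, r4, b4, I4⟩
      · have := r1.2 0 (by simp)
        simp only [List.length_cons, Nat.add_sub_cancel, Nat.sub_zero, List.getD_cons_zero] at this
        simp [Operand.val, Loc.addr, WordOp.eval, this]
      · omega
      · rw [Finset.sum_eq_sum_Ico_succ_bot hkn, hsz]
        nlinarith [Nat.zero_le (τ k)]
  obtain ⟨s1, e1, v1, r1, -⟩ := cond.compile_spec (hB.push (Nat.zero_le B)) 0 _ (hok _ _)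
    (hs.push 0)
  simp only [mul_zero, zero_add] at v1
  rw [hval] at v1
  obtain ⟨t, s2, σ2, e2, l2, r2, b2, I2⟩ := key n 0 (by omega) σ s1 h0 r1 (hB.push (Nat.zero_le B)) v1
  refine ⟨_, s2, σ2, Exec.seq (Exec.assign' (i := 16 * env.length) (x := 0) rfl rfl (by omega))
    (Exec.seq e1 e2), ?_, r2, b2, hQ _ I2⟩
  simp only [Cmd.cost]
  rw [Finset.range_eq_Ico, hsz]
  nlinarith

/-- A loop whose iterations all have the same time bound. -/
theorem forV_const {i : ℕ} {t : ℕ} (I : ℕ → Banks → Prop) (h0 : I 0 σ)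
    (h : ∀ k < env.getD i 0, ∀ σ', I k σ' → Runs B C (k :: env) σ' t (I (k + 1)))
    (hQ : ∀ σ', I (env.getD i 0) σ' → Q σ') :
    Runs B (.forV i C) env σ (1 + env.getD i 0 * (t + 1)) Q := by
  simpa using forV (τ := fun _ => t) I h0 h hQ

theorem while_done {e : Ex} (he : e.ok B env σ) (h : e.val env σ = 0) (hQ : Q σ) :
    Runs B (.whileE e C) env σ 1 Q := by
  intro hB s hs
  obtain ⟨s1, e1, v1, r1, -⟩ := e.compile_spec hB 0 s he hs
  simp only [mul_zero, zero_add] at v1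
  exact ⟨_, s1, σ, e1.seq (.loop_done (v1.trans h)), by simp only [Cmd.cost]; omega, r1, hB.2.1, hQ⟩

theorem while_step {e : Ex} (he : e.ok B env σ) (h : e.val env σ ≠ 0)
    (hC : Runs B C env σ T₁ fun σ' => Runs B (.whileE e C) env σ' T₂ Q) :
    Runs B (.whileE e C) env σ (T₁ + T₂ + 1) Q := by
  intro hB s hs
  obtain ⟨s1, e1, v1, r1, -⟩ := e.compile_spec hB 0 s he hs
  simp only [mul_zero, zero_add] at v1
  obtain ⟨t2, s2, σ2, e2, l2, r2, b2, h2⟩ := hC hB s1 r1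
  obtain ⟨t3, s3, σ3, e3, l3, r3, b3, h3⟩ := h2 ⟨hB.1, b2, hB.2.2⟩ s2 r2
  simp only [Cmd.compile] at e3
  -- The condition is evaluated at the end of the body, while the run for the remaining loop begins
  -- with the same evaluation. Splitting that run gives the evaluation `e4`, which closes the first
  -- round, and the rest `e5` of the loop.
  cases e3 with
  | @seq _ _ _ s4 _ t4 t5 e4 e5 =>
    refine ⟨_, s3, σ3, e1.seq (.loop_step (fun h0 => h (v1.symm.trans h0)) (e2.seq e4) e5),
      ?_, r3, b3, h3⟩
    simp only [Cmd.cost] at l3 ⊢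
    nlinarith [Nat.zero_le (e.size * T₁), Nat.zero_le T₁]

end Runs

/-! ### Converting between the input/output format and the banks -/

theorem Exec.mono {W W' : ℕ} (hW : W ≤ W') {P : Prog} {s s' : Mem} {t : ℕ}
    (h : Exec W P s t s') : Exec W' P s t s' := by
  induction h with
  | skip s => exact .skip s
  | assign s dst f a b h => exact .assign s dst f a b (h.trans hW)
  | seq _ _ ih1 ih2 => exact .seq ih1 ih2
  | branch_true h _ ih => exact .branch_true h ih
  | branch_false h _ ih => exact .branch_false h ih
  | loop_done h => exact .loop_done h
  | loop_step h _ _ ih1 ih2 => exact .loop_step h ih1 ih2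

/-- The machine program `P` halts after at most `T` steps in a memory satisfying `Q`. -/
def Halts (W : ℕ) (P : Prog) (s : Mem) (T : ℕ) (Q : Mem → Prop) : Prop :=
  ∃ t s', Exec W P s t s' ∧ t ≤ T ∧ Q s'

namespace Halts

variable {W T T₁ T₂ : ℕ} {P P' : Prog} {s : Mem} {Q Q' : Mem → Prop}

theorem mono (h : Halts W P s T₁ Q) (hT : T₁ ≤ T) (hQ : ∀ s, Q s → Q' s) : Halts W P s T Q' :=
  let ⟨t, s', h1, h2, h3⟩ := h
  ⟨t, s', h1, h2.trans hT, hQ _ h3⟩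

theorem seq (h : Halts W P s T₁ fun s' => Halts W P' s' T₂ Q) : Halts W (.seq P P') s (T₁ + T₂) Q :=
  let ⟨_, _, h1, h2, _, _, h3, h4, h5⟩ := h
  ⟨_, _, h1.seq h3, Nat.add_le_add h2 h4, h5⟩

theorem assign {dst : Loc} {f : WordOp} {a b : Operand} (i x : ℕ) (hi : dst.addr s = i)
    (hx : f.eval (a.val s) (b.val s) = x) (h : x ≤ W) (hQ : Q (Function.update s i x)) :
    Halts W (.assign dst f a b) s 1 Q :=
  ⟨1, _, Exec.assign' hi hx h, le_rfl, hQ⟩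

/-- The index of the invariant `I` is the exact number of rounds that remain. -/
theorem loop {a : Operand} {t : ℕ} (I : ℕ → Mem → Prop)
    (h0 : ∀ s, I 0 s → a.val s = 0 ∧ Q s)
    (h1 : ∀ k s, I (k + 1) s → a.val s ≠ 0 ∧ Halts W P s t (I k)) :
    ∀ k s, I k s → Halts W (.loop a P) s (1 + k * (t + 1)) Q
  | 0, s, h => ⟨1, s, .loop_done (h0 s h).1, by simp, (h0 s h).2⟩
  | k + 1, s, h => by
    obtain ⟨ha, t1, s1, e1, l1, I1⟩ := h1 k s h
    obtain ⟨t2, s2, e2, l2, q2⟩ := Halts.loop I h0 h1 k s1 I1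
    exact ⟨_, s2, .loop_step ha e1 e2, by nlinarith, q2⟩

end Halts

/-- Moves the input into the first bank. -/
def unpack : Prog :=
  .seq (.assign (.dir 0) .add (.cell (.dir 0)) (.const 4)) <|
  .seq (.assign (.dir 0) .mul (.cell (.dir 0)) (.const 16)) <|
  .seq (.assign (.dir 0) .add (.cell (.dir 0)) (.const 1)) <|
  .seq (.assign (.ind 0) .add (.cell (.dir 1)) (.const 0)) <|
  .seq (.assign (.dir 0) .add (.cell (.dir 0)) (.const 16)) <|
  .seq (.assign (.ind 0) .add (.cell (.dir 2)) (.const 0)) <|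
  .seq (.assign (.dir 0) .add (.cell (.dir 0)) (.const 16)) <|
  .seq (.assign (.ind 0) .add (.cell (.dir 3)) (.const 0)) <|
  .seq (.assign (.dir 1) .div (.cell (.dir 0)) (.const 16)) <|
  .seq (.assign (.dir 1) .sub (.cell (.dir 1)) (.const 6)) <|
  .seq (.assign (.dir 2) .lt (.const 3) (.cell (.dir 1))) <|
  .seq (.loop (.cell (.dir 2)) <|
    .seq (.assign (.dir 3) .mul (.cell (.dir 1)) (.const 16)) <|
    .seq (.assign (.dir 3) .add (.cell (.dir 3)) (.const 4)) <|
    .seq (.assign (.ind 3) .add (.cell (.ind 1)) (.const 0)) <|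
    .seq (.assign (.ind 1) .add (.const 0) (.const 0)) <|
    .seq (.assign (.dir 1) .sub (.cell (.dir 1)) (.const 1)) <|
    .assign (.dir 2) .lt (.const 3) (.cell (.dir 1))) <|
  .seq (.assign (.dir 52) .add (.cell (.ind 0)) (.const 0)) <|
  .seq (.assign (.dir 0) .sub (.cell (.dir 0)) (.const 16)) <|
  .seq (.assign (.dir 36) .add (.cell (.ind 0)) (.const 0)) <|
  .seq (.assign (.dir 0) .sub (.cell (.dir 0)) (.const 16)) <|
  .seq (.assign (.dir 20) .add (.cell (.ind 0)) (.const 0)) <|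
  .seq (.assign (.dir 1) .div (.cell (.dir 0)) (.const 16)) <|
  .assign (.dir 4) .sub (.cell (.dir 1)) (.const 4)

theorem loadInput_le {W : ℕ} {x : List ℕ} (hW : inputSize x ≤ W) (i : ℕ) : loadInput x i ≤ W := by
  rcases i with _ | i
  · simp only [loadInput, inputSize] at *; omega
  · refine le_trans ?_ hW
    have : ∀ (l : List ℕ) (i : ℕ), l.getD i 0 ≤ l.foldr max 0 := by
      intro l
      induction l with
      | nil => simp
      | cons a l ih =>
        intro i
        rcases i with _ | i
        · simp
        · simp only [List.getD_cons_succ, List.foldr_cons]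
          exact (ih i).trans (le_max_right _ _)
    simp only [loadInput, inputSize]
    have := this x i
    omega

theorem loadInput_eq_zero {x : List ℕ} {i : ℕ} (h : x.length < i) : loadInput x i = 0 := by
  rcases i with _ | i
  · omega
  · simp only [loadInput]
    exact List.getD_eq_default _ _ (by omega)

-- The input cell `a` has to move to the cell `16 * a + 4`. In descending order every destination
-- lies above all the cells that are still to be read. Each source is zeroed after copying, because
-- it may itself belong to a bank. The cells 0 to 3 serve as registers, so the words 1 to 3 are
-- first rescued to cells congruent to 1 modulo 16 above the input, where `Rep` imposes nothing.
set_option maxHeartbeats 1000000 in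
theorem unpack_spec {W : ℕ} (x : List ℕ) (hx : inputSize x ≤ W)
    (hW : 16 * (x.length + 8) ≤ W) :
    Halts W unpack (loadInput x) (50 + 7 * x.length)
      (Rep [] (Function.update (fun _ _ => 0) 0 (loadInput x))) := by
  have hle := loadInput_le hx
  set ℓ := x.length with hℓ
  have hz : ∀ i, ℓ < i → loadInput x i = 0 := fun i h => loadInput_eq_zero h
  set L := loadInput x with hL
  have hL0 : L 0 = ℓ := rfl
  clear_value L
  -- `k` is the largest cell not moved yet, and the loop ends at `k ≤ 3`. Above `k`, the cells of
  -- the banks already have their final contents as far as they are due.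
  let Inv : ℕ → Mem → Prop := fun r s => ∃ k, r = k - 3 ∧ k ≤ ℓ ∧ s 0 = 16 * (ℓ + 6) + 1 ∧ s 1 = k ∧
    s 2 = (if 3 < k then 1 else 0) ∧ s (16 * (ℓ + 6) + 1) = L 3 ∧ s (16 * (ℓ + 5) + 1) = L 2 ∧
    s (16 * (ℓ + 4) + 1) = L 1 ∧ (∀ a, 4 ≤ a → a ≤ k → s a = L a) ∧
    (∀ a, k < a → 4 ≤ a % 16 → s a = if a % 16 = 4 ∧ 3 < a / 16 ∧ k < a / 16 then L (a / 16) else 0)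
  have main : ∀ s, Inv (ℓ - 3) s → Halts W (.loop (.cell (.dir 2)) <|
    .seq (.assign (.dir 3) .mul (.cell (.dir 1)) (.const 16)) <|
    .seq (.assign (.dir 3) .add (.cell (.dir 3)) (.const 4)) <|
    .seq (.assign (.ind 3) .add (.cell (.ind 1)) (.const 0)) <|
    .seq (.assign (.ind 1) .add (.const 0) (.const 0)) <|
    .seq (.assign (.dir 1) .sub (.cell (.dir 1)) (.const 1)) <|
    .assign (.dir 2) .lt (.const 3) (.cell (.dir 1))) s (1 + (ℓ - 3) * (6 + 1)) (Inv 0) := by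
    refine Halts.loop (t := 6) Inv ?_ ?_ _
    · intro s hs
      refine ⟨?_, hs⟩
      obtain ⟨k, h1, h2, h3, h4, h5, -⟩ := hs
      simp only [Operand.val, Loc.addr, h5]
      rw [if_neg (by omega)]
    · rintro r s ⟨k, h1, h2, h3, h4, h5, h6, h7, h8, h9, h10⟩
      refine ⟨?_, ?_⟩
      · simp only [Operand.val, Loc.addr, h5]
        rw [if_pos (by omega)]; omega
      · refine .mono (.seq <| .assign 3 (k * 16) rfl (by simp [Operand.val, Loc.addr, WordOp.eval, h4]) (by omega) <|
          .seq <| .assign 3 (k * 16 + 4) rfl (by simp [Operand.val, Loc.addr, WordOp.eval]) (by omega) <|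
          .seq <| .assign (k * 16 + 4) (L k) (by simp [Loc.addr]) ?_ ?_ <|
          .seq <| .assign k 0 ?_ rfl (by omega) <|
          .seq <| .assign 1 (k - 1) rfl ?_ (by omega) <|
          .assign 2 (if 3 < k - 1 then 1 else 0) rfl ?_ ?_ ?_) le_rfl fun _ => id
        · simp [Operand.val, Loc.addr, WordOp.eval, h4, Function.update_apply]
          rw [if_neg (by omega), if_neg (by omega)]
          exact h9 k (by omega) le_rfl
        · exact hle k
        · simp [Loc.addr, h4]
        · simp [Operand.val, Loc.addr, WordOp.eval, Function.update_apply, h4]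
          rw [if_neg (by omega)]
        · simp [Operand.val, Loc.addr, WordOp.eval]
        · split_ifs <;> omega
        · refine ⟨k - 1, by omega, by omega, ?_, ?_, ?_, ?_, ?_, ?_, ?_, ?_⟩
          · simp [Function.update_apply, h3]; omega
          · simp
          · simp
          · simp only [Function.update_apply]
            repeat rw [if_neg (by omega)]
            exact h6
          · simp only [Function.update_apply]
            repeat rw [if_neg (by omega)]
            exact h7
          · simp only [Function.update_apply]
            repeat rw [if_neg (by omega)]
            exact h8
          · intro a ha1 ha2
            simp only [Function.update_apply]
            repeat rw [if_neg (by omega)]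
            exact h9 a ha1 (by omega)
          · intro a ha1 ha2
            simp only [Function.update_apply]
            rw [if_neg (by omega), if_neg (by omega)]
            by_cases e1 : a = k
            · subst e1
              rw [if_pos rfl, if_neg (by omega)]
            · rw [if_neg e1]
              by_cases e2 : a = k * 16 + 4
              · rw [if_pos e2, if_pos (by omega)]
                congr 1; omega
              · rw [if_neg e2, if_neg (by omega), if_neg (by omega), h10 a (by omega) ha2]
                congr 1
                rw [eq_iff_iff]
                constructor <;> intro h <;> refine ⟨h.1, h.2.1, ?_⟩ <;> omega
  apply Halts.mono (hQ := fun _ => id)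
  refine (.seq <| .assign 0 (ℓ + 4) rfl (by simp [Operand.val, Loc.addr, WordOp.eval, hL0]) (by omega) <|
    .seq <| .assign 0 ((ℓ + 4) * 16) rfl (by simp [Operand.val, Loc.addr, WordOp.eval]) (by omega) <|
    .seq <| .assign 0 (16 * (ℓ + 4) + 1) rfl (by simp [Operand.val, Loc.addr, WordOp.eval, mul_comm]) (by omega) <|
    .seq <| .assign (16 * (ℓ + 4) + 1) (L 1) (by simp [Loc.addr]) (by simp [Operand.val, Loc.addr, WordOp.eval]) (hle 1) <|
    .seq <| .assign 0 (16 * (ℓ + 5) + 1) rfl (by simp [Operand.val, Loc.addr, WordOp.eval]; omega) (by omega) <|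
    .seq <| .assign (16 * (ℓ + 5) + 1) (L 2) (by simp [Loc.addr]) (by simp [Operand.val, Loc.addr, WordOp.eval]) (hle 2) <|
    .seq <| .assign 0 (16 * (ℓ + 6) + 1) rfl (by simp [Operand.val, Loc.addr, WordOp.eval]; omega) (by omega) <|
    .seq <| .assign (16 * (ℓ + 6) + 1) (L 3) (by simp [Loc.addr]) (by simp [Operand.val, Loc.addr, WordOp.eval, Function.update_apply]; rw [if_neg (by omega), if_neg (by omega)]) (hle 3) <|
    .seq <| .assign 1 (ℓ + 6) rfl (by simp [Operand.val, Loc.addr, WordOp.eval]; omega) (by omega) <|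
    .seq <| .assign 1 ℓ rfl (by simp [Operand.val, Loc.addr, WordOp.eval]) (by omega) <|
    .seq <| .assign 2 (if 3 < ℓ then 1 else 0) rfl (by simp [Operand.val, Loc.addr, WordOp.eval]) (by split_ifs <;> omega) <|
    .seq (T₂ := 1 + (1 + (1 + (1 + (1 + (1 + 1)))))) <| (main _ ?_).mono le_rfl ?_)
  · refine ⟨ℓ, rfl, le_rfl, ?_, ?_, ?_, ?_, ?_, ?_, ?_, ?_⟩
    · simp
    · simp
    · simp
    · simp
    · simp
    · simp
    · intro a h1 h2
      simp only [Function.update_apply]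
      repeat rw [if_neg (by omega)]
    · intro a h1 h2
      simp only [Function.update_apply]
      rw [hz a h1]
      repeat rw [if_neg (by omega)]
      split_ifs with h
      · exact (hz _ h.2.2).symm
      · rfl
  · rintro s ⟨k, h1, h2, h3, h4, h5, h6, h7, h8, h9, h10⟩
    refine .seq <| .assign 52 (L 3) rfl (by simp [Operand.val, Loc.addr, WordOp.eval, h3, h6]) (hle 3) <|
      .seq <| .assign 0 (16 * (ℓ + 5) + 1) rfl (by simp [Operand.val, Loc.addr, WordOp.eval, h3]; omega) (by omega) <|
      .seq <| .assign 36 (L 2) rfl ?_ (hle 2) <|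
      .seq <| .assign 0 (16 * (ℓ + 4) + 1) rfl (by simp [Operand.val, Loc.addr, WordOp.eval]; omega) (by omega) <|
      .seq <| .assign 20 (L 1) rfl ?_ (hle 1) <|
      .seq <| .assign 1 (ℓ + 4) rfl (by simp [Operand.val, Loc.addr, WordOp.eval]; omega) (by omega) <|
      .assign 4 ℓ rfl (by simp [Operand.val, Loc.addr, WordOp.eval]) (by omega) ?_
    · simp only [Operand.val, Loc.addr, WordOp.eval, Function.update_self, Function.update_apply, add_zero]
      repeat rw [if_neg (by omega)]
      exact h7
    · simp only [Operand.val, Loc.addr, WordOp.eval, Function.update_self, Function.update_apply, add_zero]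
      repeat rw [if_neg (by omega)]
      exact h8
    · refine ⟨fun b i => ?_, fun j hj => by simp at hj⟩
      have hb := b.2
      simp only [Function.update_apply]
      by_cases e0 : b = 0
      · subst e0
        simp only [if_true, Fin.val_zero, zero_add]
        by_cases i0 : i = 0
        · subst i0; simp [hL0]
        by_cases i1 : i = 1
        · subst i1; simp
        by_cases i2 : i = 2
        · subst i2; simp
        by_cases i3 : i = 3
        · subst i3; simp
        repeat rw [if_neg (by omega)]
        rw [h10 _ (by omega) (by omega), if_pos (by omega)]
        congr 1; omega
      · have e0' : b.val ≠ 0 := fun h => e0 (Fin.ext h)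
        rw [if_neg e0]
        repeat rw [if_neg (by omega)]
        rw [h10 _ (by omega) (by omega), if_neg (by omega)]
  · omega

/-- Moves the contents of the second bank into the output format. -/
def pack : Prog :=
  .seq (.assign (.dir 0) .add (.cell (.dir 5)) (.const 4)) <|
  .seq (.assign (.dir 0) .mul (.cell (.dir 0)) (.const 16)) <|
  .seq (.assign (.dir 0) .add (.cell (.dir 0)) (.const 1)) <|
  .seq (.assign (.ind 0) .add (.cell (.dir 5)) (.const 0)) <|
  .seq (.assign (.dir 0) .add (.cell (.dir 0)) (.const 16)) <|
  .seq (.assign (.ind 0) .add (.cell (.dir 21)) (.const 0)) <|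
  .seq (.assign (.dir 0) .add (.cell (.dir 0)) (.const 16)) <|
  .seq (.assign (.ind 0) .add (.cell (.dir 37)) (.const 0)) <|
  .seq (.assign (.dir 0) .add (.cell (.dir 0)) (.const 16)) <|
  .seq (.assign (.ind 0) .add (.cell (.dir 53)) (.const 0)) <|
  .seq (.assign (.dir 1) .add (.const 4) (.const 0)) <|
  .seq (.assign (.dir 2) .div (.cell (.dir 0)) (.const 16)) <|
  .seq (.assign (.dir 2) .sub (.cell (.dir 2)) (.const 6)) <|
  .seq (.assign (.dir 2) .lt (.cell (.dir 1)) (.cell (.dir 2))) <|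
  .seq (.loop (.cell (.dir 2)) <|
    .seq (.assign (.dir 3) .mul (.cell (.dir 1)) (.const 16)) <|
    .seq (.assign (.dir 3) .add (.cell (.dir 3)) (.const 5)) <|
    .seq (.assign (.ind 1) .add (.cell (.ind 3)) (.const 0)) <|
    .seq (.assign (.dir 1) .add (.cell (.dir 1)) (.const 1)) <|
    .seq (.assign (.dir 2) .div (.cell (.dir 0)) (.const 16)) <|
    .seq (.assign (.dir 2) .sub (.cell (.dir 2)) (.const 6)) <|
    .assign (.dir 2) .lt (.cell (.dir 1)) (.cell (.dir 2))) <|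
  .seq (.assign (.dir 3) .add (.cell (.ind 0)) (.const 0)) <|
  .seq (.assign (.dir 0) .sub (.cell (.dir 0)) (.const 16)) <|
  .seq (.assign (.dir 2) .add (.cell (.ind 0)) (.const 0)) <|
  .seq (.assign (.dir 0) .sub (.cell (.dir 0)) (.const 16)) <|
  .seq (.assign (.dir 1) .add (.cell (.ind 0)) (.const 0)) <|
  .seq (.assign (.dir 0) .sub (.cell (.dir 0)) (.const 16)) <|
  .assign (.dir 0) .add (.cell (.ind 0)) (.const 0)

-- The reverse movement, in ascending order: the source `16 * k + 5` of the output cell `k` lies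
-- above everything written so far. The length and the words 1 to 3 are rescued before the copying
-- starts, since the cells 0 to 3 are registers. The limit `ℓ + 1` has no register of its own and is
-- recomputed each time from the pointer `16 * (ℓ + 7) + 1` in the cell 0.
set_option maxHeartbeats 1000000 in
theorem pack_spec {W : ℕ} {σ : Banks} {s : Mem} (hs : Rep [] σ s) (hσ : ∀ i, σ 1 i ≤ W)
    (hW : 16 * (σ 1 0 + 8) ≤ W) :
    Halts W pack s (50 + 8 * σ 1 0)
      (fun s' => readOutput s' = (List.range (σ 1 0)).map fun i => σ 1 (i + 1)) := by
  have hL : ∀ i, s (16 * i + 5) = σ 1 i := fun i => hs.1 1 i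
  set L := σ 1
  set ℓ := L 0 with hℓ
  have v0 : s 5 = ℓ := hL 0
  have v1 : s 21 = L 1 := hL 1
  have v2 : s 37 = L 2 := hL 2
  have v3 : s 53 = L 3 := hL 3
  clear_value L
  clear hs
  let Inv : ℕ → Mem → Prop := fun r s => ∃ k, r = ℓ + 1 - k ∧ 4 ≤ k ∧ k ≤ ℓ + 4 ∧
    s 0 = 16 * (ℓ + 7) + 1 ∧ s 1 = k ∧
    s 2 = (if k < ℓ + 1 then 1 else 0) ∧ s (16 * (ℓ + 7) + 1) = L 3 ∧ s (16 * (ℓ + 6) + 1) = L 2 ∧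
    s (16 * (ℓ + 5) + 1) = L 1 ∧ s (16 * (ℓ + 4) + 1) = ℓ ∧ (∀ a, 4 ≤ a → a < k → s a = L a) ∧
    (∀ a, k ≤ 16 * a + 5 → s (16 * a + 5) = L a)
  have main : ∀ s, Inv (ℓ + 1 - 4) s → Halts W (.loop (.cell (.dir 2)) <|
    .seq (.assign (.dir 3) .mul (.cell (.dir 1)) (.const 16)) <|
    .seq (.assign (.dir 3) .add (.cell (.dir 3)) (.const 5)) <|
    .seq (.assign (.ind 1) .add (.cell (.ind 3)) (.const 0)) <|
    .seq (.assign (.dir 1) .add (.cell (.dir 1)) (.const 1)) <|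
    .seq (.assign (.dir 2) .div (.cell (.dir 0)) (.const 16)) <|
    .seq (.assign (.dir 2) .sub (.cell (.dir 2)) (.const 6)) <|
    .assign (.dir 2) .lt (.cell (.dir 1)) (.cell (.dir 2))) s (1 + (ℓ + 1 - 4) * (7 + 1)) (Inv 0) := by
    refine Halts.loop (t := 7) Inv ?_ ?_ _
    · intro s hs
      refine ⟨?_, hs⟩
      obtain ⟨k, h1, h2, h3, h4, h5, h6, -⟩ := hs
      simp only [Operand.val, Loc.addr, h6]
      rw [if_neg (by omega)]
    · rintro r s ⟨k, h1, h2, h3, h4, h5, h6, h7, h8, h9, h10, h11, h12⟩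
      refine ⟨?_, ?_⟩
      · simp only [Operand.val, Loc.addr, h6]
        rw [if_pos (by omega)]; omega
      · refine .mono (.seq <| .assign 3 (k * 16) rfl (by simp [Operand.val, Loc.addr, WordOp.eval, h5]) (by omega) <|
          .seq <| .assign 3 (16 * k + 5) rfl (by simp [Operand.val, Loc.addr, WordOp.eval, mul_comm]) (by omega) <|
          .seq <| .assign k (L k) (by simp [Loc.addr, h5]) ?_ (hσ k) <|
          .seq <| .assign 1 (k + 1) rfl ?_ (by omega) <|
          .seq <| .assign 2 (ℓ + 7) rfl ?_ (by omega) <|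
          .seq <| .assign 2 (ℓ + 1) rfl ?_ (by omega) <|
          .assign 2 (if k + 1 < ℓ + 1 then 1 else 0) rfl ?_ ?_ ?_) le_rfl fun _ => id
        · simp only [Operand.val, Loc.addr, WordOp.eval, Function.update_apply, if_true, add_zero]
          repeat rw [if_neg (by omega)]
          exact h12 k (by omega)
        · simp [Operand.val, Loc.addr, WordOp.eval, Function.update_apply, h5]
          omega
        · simp [Operand.val, Loc.addr, WordOp.eval, Function.update_apply, h4]
          rw [if_neg (by omega)]; omega
        · simp [Operand.val, Loc.addr, WordOp.eval]
        · simp [Operand.val, Loc.addr, WordOp.eval]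
        · split_ifs <;> omega
        · refine ⟨k + 1, by omega, by omega, by omega, ?_, ?_, ?_, ?_, ?_, ?_, ?_, ?_, ?_⟩
          · simp [Function.update_apply, h4]; omega
          · simp
          · simp
          · simp only [Function.update_apply]
            repeat rw [if_neg (by omega)]
            exact h7
          · simp only [Function.update_apply]
            repeat rw [if_neg (by omega)]
            exact h8
          · simp only [Function.update_apply]
            repeat rw [if_neg (by omega)]
            exact h9
          · simp only [Function.update_apply]
            repeat rw [if_neg (by omega)]
            exact h10
          · intro a ha1 ha2
            simp only [Function.update_apply]
            rw [if_neg (by omega), if_neg (by omega), if_neg (by omega), if_neg (by omega)]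
            by_cases e : a = k
            · rw [if_pos e, e]
            · rw [if_neg e, if_neg (by omega), if_neg (by omega)]
              exact h11 a ha1 (by omega)
          · intro a ha
            simp only [Function.update_apply]
            repeat rw [if_neg (by omega)]
            exact h12 a (by omega)
  apply Halts.mono (hQ := fun _ => id)
  refine (.seq <| .assign 0 (ℓ + 4) rfl (by simp [Operand.val, Loc.addr, WordOp.eval, v0]) (by omega) <|
    .seq <| .assign 0 ((ℓ + 4) * 16) rfl (by simp [Operand.val, Loc.addr, WordOp.eval]) (by omega) <|
    .seq <| .assign 0 (16 * (ℓ + 4) + 1) rfl (by simp [Operand.val, Loc.addr, WordOp.eval, mul_comm]) (by omega) <|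
    .seq <| .assign (16 * (ℓ + 4) + 1) ℓ (by simp [Loc.addr]) (by simp [Operand.val, Loc.addr, WordOp.eval, v0]) (by omega) <|
    .seq <| .assign 0 (16 * (ℓ + 5) + 1) rfl (by simp [Operand.val, Loc.addr, WordOp.eval]; omega) (by omega) <|
    .seq <| .assign (16 * (ℓ + 5) + 1) (L 1) (by simp [Loc.addr]) ?_ (hσ 1) <|
    .seq <| .assign 0 (16 * (ℓ + 6) + 1) rfl (by simp [Operand.val, Loc.addr, WordOp.eval]; omega) (by omega) <|
    .seq <| .assign (16 * (ℓ + 6) + 1) (L 2) (by simp [Loc.addr]) ?_ (hσ 2) <|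
    .seq <| .assign 0 (16 * (ℓ + 7) + 1) rfl (by simp [Operand.val, Loc.addr, WordOp.eval]; omega) (by omega) <|
    .seq <| .assign (16 * (ℓ + 7) + 1) (L 3) (by simp [Loc.addr]) ?_ (hσ 3) <|
    .seq <| .assign 1 4 rfl rfl (by omega) <|
    .seq <| .assign 2 (ℓ + 7) rfl (by simp [Operand.val, Loc.addr, WordOp.eval]; omega) (by omega) <|
    .seq <| .assign 2 (ℓ + 1) rfl (by simp [Operand.val, Loc.addr, WordOp.eval]) (by omega) <|
    .seq <| .assign 2 (if 4 < ℓ + 1 then 1 else 0) rfl (by simp [Operand.val, Loc.addr, WordOp.eval]) (by split_ifs <;> omega) <|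
    .seq (T₂ := 1 + (1 + (1 + (1 + (1 + (1 + 1)))))) <| (main _ ?_).mono le_rfl ?_)
  · simp only [Operand.val, Loc.addr, WordOp.eval, Function.update_apply, add_zero]
    repeat rw [if_neg (by omega)]
    exact v1
  · simp only [Operand.val, Loc.addr, WordOp.eval, Function.update_apply, add_zero]
    repeat rw [if_neg (by omega)]
    exact v2
  · simp only [Operand.val, Loc.addr, WordOp.eval, Function.update_apply, add_zero]
    repeat rw [if_neg (by omega)]
    exact v3
  · refine ⟨4, rfl, le_rfl, by omega, ?_, ?_, ?_, ?_, ?_, ?_, ?_, ?_, ?_⟩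
    · simp
    · simp
    · simp
    · simp
    · simp
    · simp
    · simp
    · intro a h1 h2
      omega
    · intro a h1
      simp only [Function.update_apply]
      repeat rw [if_neg (by omega)]
      exact hL a
  · rintro s ⟨k, h1, h2, h3, h4, h5, h6, h7, h8, h9, h10, h11, h12⟩
    refine .seq <| .assign 3 (L 3) rfl (by simp [Operand.val, Loc.addr, WordOp.eval, h4, h7]) (hσ 3) <|
      .seq <| .assign 0 (16 * (ℓ + 6) + 1) rfl (by simp [Operand.val, Loc.addr, WordOp.eval, h4]; omega) (by omega) <|
      .seq <| .assign 2 (L 2) rfl ?_ (hσ 2) <|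
      .seq <| .assign 0 (16 * (ℓ + 5) + 1) rfl (by simp [Operand.val, Loc.addr, WordOp.eval]; omega) (by omega) <|
      .seq <| .assign 1 (L 1) rfl ?_ (hσ 1) <|
      .seq <| .assign 0 (16 * (ℓ + 4) + 1) rfl (by simp [Operand.val, Loc.addr, WordOp.eval]; omega) (by omega) <|
      .assign 0 ℓ rfl ?_ (by omega) ?_
    · simp only [Operand.val, Loc.addr, WordOp.eval, Function.update_self, Function.update_apply, add_zero]
      repeat rw [if_neg (by omega)]
      exact h8
    · simp only [Operand.val, Loc.addr, WordOp.eval, Function.update_self, Function.update_apply, add_zero]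
      repeat rw [if_neg (by omega)]
      exact h9
    · simp only [Operand.val, Loc.addr, WordOp.eval, Function.update_self, Function.update_apply, add_zero]
      repeat rw [if_neg (by omega)]
      exact h10
    · rw [readOutput, Function.update_self]
      refine List.map_congr_left fun i hi => ?_
      rw [List.mem_range] at hi
      simp only [Function.update_apply]
      by_cases i1 : i = 0
      · subst i1; simp
      by_cases i2 : i = 1
      · subst i2; simp
      by_cases i3 : i = 2
      · subst i3; simp
      repeat rw [if_neg (by omega)]
      exact h11 _ (by omega) (by omega)
  · omega

theorem two_le_inputSize (x : List ℕ) : 2 ≤ inputSize x := by simp [inputSize]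

/-- The bank contents at the start, on the input `x`. -/
def initBanks (x : List ℕ) : Banks := Function.update (fun _ _ => 0) 0 (loadInput x)

/-- The output left in the second bank. -/
def outWords (σ : Banks) : List ℕ := (List.range (σ 1 0)).map fun i => σ 1 (i + 1)

/-- A structured program gives an algorithm for the word RAM. -/
theorem solvableInTime_of_runs {Q : Problem} {T : Q.Inst → ℝ} (P : Cmd) (C : ℕ)
    (hC : 1 ≤ C) (hT : ∀ x, 1 ≤ T x)
    (hlen : ∀ x, ((Q.encode x).length : ℝ) ≤ C * T x)
    (h : ∀ x, ∃ τ : ℕ, (τ : ℝ) ≤ C * T x ∧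
      Runs ((inputSize (Q.encode x) + ⌈T x⌉₊) ^ C) P [] (initBanks (Q.encode x)) τ
        fun σ => (σ 1 0 : ℝ) ≤ C * T x ∧ Q.Sol x (outWords σ)) :
    SolvableInTime Q T := by
  -- One constant plays two roles. As a factor it covers the time `100 + 15 * C * T` of both
  -- conversions and `P.cost * C * T` of the program; as an exponent it gives words of size at least
  -- `200 * Z ^ C`, because `Z ≥ 2`.
  refine ⟨.seq unpack (.seq (P.compile 0) pack), 100 + 15 * C + P.cost * C + C + 20, fun x => ?_⟩
  obtain ⟨τ, hτ, hrun⟩ := h x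
  set Z := inputSize (Q.encode x) + ⌈T x⌉₊ with hZ
  have hZ1 : inputSize (Q.encode x) ≤ Z := by omega
  have hZ2 : 2 ≤ Z := (two_le_inputSize _).trans hZ1
  have hBZ : Z ≤ Z ^ C := Nat.le_self_pow (by omega) Z
  have hW : 200 * Z ^ C ≤ Z ^ (100 + 15 * C + P.cost * C + C + 20) := by
    calc 200 * Z ^ C ≤ 2 ^ 8 * Z ^ C := Nat.mul_le_mul_right _ (by norm_num)
      _ ≤ Z ^ 8 * Z ^ C := Nat.mul_le_mul_right _ (Nat.pow_le_pow_left hZ2 8)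
      _ = Z ^ (8 + C) := (pow_add _ _ _).symm
      _ ≤ _ := Nat.pow_le_pow_right (by omega) (by nlinarith [Nat.zero_le (P.cost * C)])
  set W := Z ^ (100 + 15 * C + P.cost * C + C + 20)
  set B := Z ^ C
  clear_value W B
  have hlen2 : (Q.encode x).length + 2 ≤ Z := by
    refine le_trans ?_ hZ1
    simp only [inputSize]; omega
  obtain ⟨t1, s1, e1, l1, r1⟩ := unpack_spec (W := W) (Q.encode x) (by omega) (by omega)
  obtain ⟨t2, s2, σ2, e2, l2, r2, b2, q1, q2⟩ := hrun ⟨by omega, fun b i => by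
    simp only [initBanks, Function.update_apply]
    split_ifs
    · exact loadInput_le (hZ1.trans hBZ) i
    · simp, fun j => by simp⟩ s1 r1
  obtain ⟨t3, s3, e3, l3, r3⟩ := pack_spec (W := W) r2 (fun i => (b2 1 i).trans (by omega))
    (by have := b2 1 0; omega)
  refine ⟨_, s3, e1.seq ((e2.mono (by omega)).seq e3), ?_, ?_⟩
  · have h1 : (t1 : ℝ) ≤ 50 + 7 * (Q.encode x).length := by exact_mod_cast l1
    have h2 : (t2 : ℝ) ≤ P.cost * τ := by exact_mod_cast l2
    have h3 : (t3 : ℝ) ≤ 50 + 8 * σ2 1 0 := by exact_mod_cast l3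
    have h4 := hlen x
    have h5 := hT x
    have h6 : (P.cost : ℝ) * τ ≤ P.cost * (C * T x) := by gcongr
    have h7 : (0 : ℝ) ≤ C * T x := by positivity
    push_cast
    nlinarith
  · rw [r3]; exact q2

/-! ### Running a machine program inside a bank -/

/-- The address of a location, for a machine whose memory is the bank `b`. -/
def Loc.toEx (b : Fin 12) : Loc → Ex
  | .dir a => .c a
  | .ind a => .a b (.c a)

def Operand.toEx (b : Fin 12) : Operand → Ex
  | .const c => .c c
  | .cell l => .a b (l.toEx b)

/-- The machine program `P` with the bank `b` as its memory. -/
def Prog.toCmd (b : Fin 12) : Prog → Cmd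
  | .skip => .skip
  | .assign dst f x y => .store b (dst.toEx b) (.op f (x.toEx b) (y.toEx b))
  | .seq P Q => .seq (P.toCmd b) (Q.toCmd b)
  | .branch x P Q => .ite (x.toEx b) (P.toCmd b) (Q.toCmd b)
  | .loop x P => .whileE (x.toEx b) (P.toCmd b)

def Loc.maxConst : Loc → ℕ
  | .dir a => a
  | .ind a => a

def Operand.maxConst : Operand → ℕ
  | .const c => c
  | .cell l => l.maxConst

/-- A bound on the constants in a program. -/
def Prog.maxConst : Prog → ℕ
  | .skip => 0
  | .assign dst _ x y => dst.maxConst + x.maxConst + y.maxConst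
  | .seq P Q => P.maxConst + Q.maxConst
  | .branch x P Q => x.maxConst + P.maxConst + Q.maxConst
  | .loop x P => x.maxConst + P.maxConst

section
variable {B : ℕ} {env : List ℕ} {σ : Banks} {b : Fin 12}

theorem Loc.val_toEx (l : Loc) : (l.toEx b).val env σ = l.addr (σ b) := by
  cases l <;> rfl

theorem Loc.ok_toEx (l : Loc) (h : l.maxConst ≤ B) : (l.toEx b).ok B env σ := by
  cases l <;> exact h

theorem Operand.val_toEx (x : Operand) : (x.toEx b).val env σ = x.val (σ b) := by
  cases x with
  | const c => rfl
  | cell l => simp [Operand.toEx, Operand.val, Loc.val_toEx]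

theorem Operand.ok_toEx (x : Operand) (h : x.maxConst ≤ B) : (x.toEx b).ok B env σ := by
  cases x with
  | const c => exact h
  | cell l => exact Loc.ok_toEx l h

/-- The simulation is step by step, so the time in structured steps is the machine time. The
constants of the program turn into constants of expressions, whence the condition on `maxConst`. -/
theorem Runs.toCmd {W : ℕ} (hW : W ≤ B) {P : Prog} {s s' : Mem} {t : ℕ} (h : Exec W P s t s') :
    P.maxConst ≤ B → ∀ σ : Banks, σ b = s →
      Runs B (P.toCmd b) env σ t fun σ' => σ' = Function.update σ b s' := by
  induction h with
  | skip s =>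
    rintro - σ rfl
    exact Runs.skip (Function.update_eq_self b σ).symm
  | assign s dst f x y h =>
    rintro hc σ rfl
    simp only [Prog.maxConst] at hc
    refine Runs.store (dst.ok_toEx (by omega))
      ⟨x.ok_toEx (by omega), y.ok_toEx (by omega), fun _ => ?_⟩ ?_
    · rw [x.val_toEx, y.val_toEx]; exact h.trans hW
    · rw [dst.val_toEx]
      simp only [Ex.val]
      rw [x.val_toEx, y.val_toEx]
  | seq _ _ ih1 ih2 =>
    rintro hc σ rfl
    simp only [Prog.maxConst] at hc
    refine Runs.seq ((ih1 (by omega) σ rfl).mono le_rfl ?_)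
    rintro _ rfl
    refine (ih2 (by omega) _ (Function.update_self ..)).mono le_rfl ?_
    rintro _ rfl
    rw [Function.update_idem]
  | branch_true h _ ih =>
    rintro hc σ rfl
    simp only [Prog.maxConst] at hc
    refine (Runs.ite (Operand.ok_toEx _ (by omega)) (fun _ => ih (by omega) σ rfl)
      fun h0 => absurd ?_ h).time_le (add_comm _ _).le
    rwa [Operand.val_toEx] at h0
  | branch_false h _ ih =>
    rintro hc σ rfl
    simp only [Prog.maxConst] at hc
    refine (Runs.ite (Operand.ok_toEx _ (by omega)) (fun h0 => absurd h ?_)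
      fun _ => ih (by omega) σ rfl).time_le (add_comm _ _).le
    rwa [Operand.val_toEx] at h0
  | loop_done h =>
    rintro hc σ rfl
    simp only [Prog.maxConst] at hc
    refine Runs.while_done (Operand.ok_toEx _ (by omega)) ?_ (Function.update_eq_self b σ).symm
    rwa [Operand.val_toEx]
  | loop_step h _ _ ih1 ih2 =>
    rintro hc σ rfl
    simp only [Prog.maxConst] at hc
    refine Runs.while_step (Operand.ok_toEx _ (by omega)) ?_
      ((ih1 (by omega) σ rfl).mono le_rfl ?_)
    · rwa [Operand.val_toEx]
    · rintro _ rfl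
      refine (ih2 (by simpa [Prog.maxConst] using hc) _ (Function.update_self ..)).mono le_rfl ?_
      rintro _ rfl
      rw [Function.update_idem]

end

/-! ### Lists in banks -/

/-- Appends a word to the list held in the bank `b`. -/
def Cmd.push (b : Fin 12) (e : Ex) : Cmd :=
  .store b (.a b 0 + 1) e ;; .store b 0 (.a b 0 + 1)

theorem loadInput_append (L : List ℕ) (x : ℕ) :
    loadInput (L ++ [x]) =
      Function.update (Function.update (loadInput L) (L.length + 1) x) 0 (L.length + 1) := by
  funext i
  rcases i with _ | i
  · simp [loadInput]
  · rw [Function.update_of_ne (by omega)]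
    by_cases h : i = L.length
    · subst h; simp [loadInput]
    · rw [Function.update_of_ne (by omega)]
      simp only [loadInput, List.getD_eq_getElem?_getD, List.getElem?_append]
      by_cases h' : i < L.length
      · rw [if_pos h']
      · rw [if_neg h', List.getElem?_eq_none (l := L) (by omega),
          List.getElem?_eq_none (l := [x]) (by rw [List.length_singleton]; omega)]

theorem loadInput_set (L : List ℕ) (i x : ℕ) (hi : i < L.length) :
    Function.update (loadInput L) (i + 1) x = loadInput (L.set i x) := by
  funext j
  rcases j with _ | j
  · rw [Function.update_of_ne (by omega)]; simp [loadInput]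
  · by_cases h : j = i
    · subst h; simp [loadInput, hi]
    · rw [Function.update_of_ne (by omega)]
      simp only [loadInput, List.getD_eq_getElem?_getD]
      rw [List.getElem?_set_ne (Ne.symm h)]

@[simp] theorem loadInput_nil : loadInput [] = fun _ => 0 := by
  funext i; cases i <;> rfl

theorem outWords_of_loadInput {σ : Banks} {L : List ℕ} (h : σ 1 = loadInput L) :
    outWords σ = L := by
  rw [outWords, h]
  refine List.ext_getElem (by simp [loadInput]) fun i h1 h2 => ?_
  simp [loadInput, h2]

theorem Runs.push {B : ℕ} {env : List ℕ} {σ : Banks} {b : Fin 12} {e : Ex} {L : List ℕ}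
    {Q : Banks → Prop} (hL : σ b = loadInput L) (he : e.ok B env σ) (hB : L.length + 1 ≤ B)
    (hQ : Q (Function.update σ b (loadInput (L ++ [e.val env σ])))) :
    Runs B (.push b e) env σ 2 Q := by
  have h0 : loadInput L 0 = L.length := rfl
  refine Runs.seq (T₁ := 1) (T₂ := 1) (Runs.store ?_ he (Runs.store ?_ ?_ ?_))
  · simp only [Ex.ok_add, Ex.ok_a, Ex.ok_ofNat, Ex.val_a, Ex.val_ofNat, hL, h0]; omega
  · simp
  · simp only [Ex.ok_add, Ex.ok_a, Ex.ok_ofNat, Ex.val_add, Ex.val_a, Ex.val_ofNat, hL,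
      Function.update_self]
    rw [Function.update_of_ne (by omega), h0]; omega
  · simp only [Ex.val_add, Ex.val_a, Ex.val_ofNat, Function.update_self, Function.update_idem]
    rw [hL, h0, Function.update_of_ne (by omega), h0, ← loadInput_append]
    exact hQ

/-! ### Matrices in banks -/

/-- The nonzero entries of the matrix `m` with `D` columns are those with `p`. -/
def IsMat (D : ℕ) (m : ℕ → ℕ) (p : ℕ → ℕ → Prop) : Prop :=
  ∀ u c, c < D → (m (u * D + c) ≠ 0 ↔ p u c)

theorem mul_add_inj {D u c u' c' : ℕ} (hc : c < D) (hc' : c' < D) :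
    u * D + c = u' * D + c' ↔ u = u' ∧ c = c' := by
  constructor
  · intro h
    have h1 : u = u' := by
      have := congrArg (· / D) h
      have hD : 0 < D := by omega
      simpa [mul_comm _ D, Nat.mul_add_div hD, Nat.div_eq_of_lt hc, Nat.div_eq_of_lt hc'] using this
    subst h1
    exact ⟨rfl, by omega⟩
  · rintro ⟨rfl, rfl⟩; rfl

theorem IsMat.set {D : ℕ} {m : ℕ → ℕ} {p : ℕ → ℕ → Prop} (h : IsMat D m p) {u c x : ℕ}
    (hc : c < D) (hx : x ≠ 0) :
    IsMat D (Function.update m (u * D + c) x) fun u' c' => p u' c' ∨ (u' = u ∧ c' = c) := by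
  intro u' c' hc'
  by_cases e : u' = u ∧ c' = c
  · simp [e.1, e.2, hx]
  · rw [Function.update_of_ne fun h' => e ((mul_add_inj hc' hc).mp h'), h u' c' hc']
    simp [e]

theorem IsMat.congr {D : ℕ} {m : ℕ → ℕ} {p q : ℕ → ℕ → Prop} (h : IsMat D m p)
    (hpq : ∀ u c, c < D → (p u c ↔ q u c)) : IsMat D m q :=
  fun u c hc => (h u c hc).trans (hpq u c hc)

/-! ### The graph of a pair of families of sets

The vertices are `2 * N` sets, `d` elements, and two hubs. The relation `f u c` says that the element
`c` belongs to the set `u`. The first hub is joined to the first `N` sets and to the elements, the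
second hub to the other sets and to the elements, and the two hubs are joined. -/

/-- The vertex `u` is joined to the vertex `2 * N + c`. -/
def ovBit (N d : ℕ) (f : ℕ → ℕ → Prop) (u c : ℕ) : Prop :=
  (u < 2 * N ∧ c < d ∧ f u c) ∨ (u < 2 * N ∧ c = d + u / N) ∨
  (2 * N ≤ u ∧ u < 2 * N + d ∧ (c = d ∨ c = d + 1)) ∨ (u = 2 * N + d ∧ c = d + 1)

section
variable (N d : ℕ) (f : ℕ → ℕ → Prop)

/-- Listed edges ascend. This excludes loops, and an undirected edge cannot appear a second time in
the opposite direction. -/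
theorem ovBit_lt {N d : ℕ} {f : ℕ → ℕ → Prop} {u c : ℕ} (h : ovBit N d f u c) : u < 2 * N + c := by
  unfold ovBit at h
  omega

open Classical in
/-- The edges, directed towards the vertices with larger numbers. -/
noncomputable def ovEdges : List (Fin (2 * N + d + 2) × Fin (2 * N + d + 2) × ℕ) :=
  ((List.finRange (2 * N + d + 2) ×ˢ List.finRange (d + 2)).filter
    fun p => ovBit N d f p.1.val p.2.val).map
    fun p => (p.1, ⟨2 * N + p.2.val, by omega⟩, 1)

/-- The graph. In the directed case each edge is listed in both directions. -/
noncomputable abbrev ovGraph (directed : Bool) : EdgeList ℕ where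
  n := 2 * N + d + 2
  edges := ovEdges N d f ++ if directed then (ovEdges N d f).map fun e => (e.2.1, e.1, 1) else []

open Classical in
/-- The words that encode the edges. -/
noncomputable def ovWords (flip : Bool) : List ℕ :=
  (List.range (2 * N + d + 2)).flatMap fun u => (List.range (d + 2)).flatMap fun c =>
    if ovBit N d f u c then (if flip then [2 * N + c, u, 1] else [u, 2 * N + c, 1]) else []

theorem range_flatMap_eq {α : Type} (n : ℕ) (g : ℕ → List α) :
    (List.range n).flatMap g = (List.finRange n).flatMap fun i => g i.val := by
  rw [← List.map_coe_finRange_eq_range, List.flatMap_map]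

theorem filter_flatMap_eq {α β : Type} (l : List α) (p : α → Prop) [DecidablePred p]
    (g : α → List β) :
    (l.filter fun a => p a).flatMap g = l.flatMap fun a => if p a then g a else [] := by
  induction l with
  | nil => rfl
  | cons a l ih =>
    by_cases h : p a
    · simp [h, ih]
    · simp [h, ih]

theorem product_flatMap_eq {α β γ : Type} (l : List α) (l' : List β) (g : α × β → List γ) :
    (l ×ˢ l').flatMap g = l.flatMap fun a => l'.flatMap fun b => g (a, b) := by
  change (List.product l l').flatMap g = _
  rw [List.product, List.flatMap_assoc]
  simp [List.flatMap_map]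

/-- `ovWords` has the shape in which two nested loops emit the edges. The edge list, a filtered
product, is flattened to that shape. -/
theorem ovGraph_encode (directed : Bool) :
    (ovGraph N d f directed).encode (fun w => [w]) =
      (2 * N + d + 2) :: (ovGraph N d f directed).edges.length ::
        (ovWords N d f false ++ if directed then ovWords N d f true else []) := by
  have h1 : (ovEdges N d f).flatMap (fun e => [e.1.val, e.2.1.val, e.2.2]) = ovWords N d f false := by
    classical
    rw [ovEdges, List.flatMap_map, filter_flatMap_eq, product_flatMap_eq, ovWords, range_flatMap_eq]
    simp only [range_flatMap_eq, Bool.false_eq_true, if_false]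
  have h2 : (ovEdges N d f).flatMap (fun e => [e.2.1.val, e.1.val, 1]) = ovWords N d f true := by
    classical
    rw [ovEdges, List.flatMap_map, filter_flatMap_eq, product_flatMap_eq, ovWords, range_flatMap_eq]
    simp only [range_flatMap_eq, if_true]
  rw [EdgeList.encode]
  congr 2
  refine (List.flatMap_append (xs := ovEdges N d f)).trans (congrArg₂ _ h1 ?_)
  cases directed
  · simp
  · simp only [if_true]
    rw [List.flatMap_map]
    exact h2

variable {N d f}

theorem mem_ovEdges {x y : Fin (2 * N + d + 2)} {w : ℕ} :
    (x, y, w) ∈ ovEdges N d f ↔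
      w = 1 ∧ ∃ c < d + 2, y.val = 2 * N + c ∧ ovBit N d f x.val c := by
  classical
  simp only [ovEdges, List.mem_map, List.mem_filter, List.mem_product, List.mem_finRange,
    true_and, decide_eq_true_eq, Prod.mk.injEq, Prod.exists]
  constructor
  · rintro ⟨a, c, h, rfl, rfl, rfl⟩
    exact ⟨rfl, c, c.2, rfl, h⟩
  · rintro ⟨rfl, c, hc, hy, h⟩
    exact ⟨x, ⟨c, hc⟩, h, rfl, Fin.ext hy.symm, rfl⟩

theorem ovEdges_lt {e : Fin (2 * N + d + 2) × Fin (2 * N + d + 2) × ℕ}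
    (h : e ∈ ovEdges N d f) : e.1.val < e.2.1.val := by
  obtain ⟨x, y, w⟩ := e
  obtain ⟨-, c, -, hy, hb⟩ := mem_ovEdges.mp h
  simp only [hy]
  exact ovBit_lt hb

theorem ovEdges_nodup : (ovEdges N d f).Nodup := by
  classical
  rw [ovEdges]
  refine List.Nodup.map ?_ (List.Nodup.filter _ (List.Nodup.product (List.nodup_finRange _)
    (List.nodup_finRange _)))
  rintro ⟨a, b⟩ ⟨a', b'⟩ h
  simp only [Prod.mk.injEq, Fin.mk.injEq, Nat.add_left_cancel_iff, and_true] at h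
  exact Prod.ext h.1 (Fin.ext h.2)

theorem ovEdges_snd {e : Fin (2 * N + d + 2) × Fin (2 * N + d + 2) × ℕ}
    (h : e ∈ ovEdges N d f) : e.2.2 = 1 := (mem_ovEdges.mp (show (e.1, e.2.1, e.2.2) ∈ _ from h)).1

/-- As the listed edges ascend, the unordered pair determines the ordered one. In the directed case
the reversed copies descend, so they are disjoint from the originals. -/
theorem ovGraph_simple (directed : Bool) : (ovGraph N d f directed).IsSimple directed := by
  refine ⟨fun e he => ?_, ?_⟩
  · rcases List.mem_append.mp he with h | h
    · exact fun h' => (ovEdges_lt h).ne (congrArg Fin.val h')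
    · cases directed
      · exact absurd h (by simp)
      · obtain ⟨e', h', rfl⟩ := List.mem_map.mp h
        exact fun h'' => (ovEdges_lt h').ne (congrArg Fin.val h''.symm)
  · cases directed
    · simp only [Bool.false_eq_true, if_false, ovGraph, List.append_nil]
      refine List.Nodup.map_on ?_ ovEdges_nodup
      intro e he e' he' h
      have h1 := ovEdges_lt he
      have h2 := ovEdges_lt he'
      have h3 := ovEdges_snd he
      have h4 := ovEdges_snd he'
      rw [Sym2.eq_iff] at h
      rcases h with h | h
      · exact Prod.ext h.1 (Prod.ext h.2 (h3.trans h4.symm))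
      · rw [h.1, h.2] at h1; omega
    · simp only [if_true, ovGraph, List.map_append, List.map_map]
      rw [List.nodup_append]
      refine ⟨List.Nodup.map_on ?_ ovEdges_nodup, List.Nodup.map_on ?_ ovEdges_nodup, ?_⟩
      · intro e he e' he' h
        have h3 := ovEdges_snd he
        have h4 := ovEdges_snd he'
        rw [Prod.mk.injEq] at h
        exact Prod.ext h.1 (Prod.ext h.2 (h3.trans h4.symm))
      · intro e he e' he' h
        have h3 := ovEdges_snd he
        have h4 := ovEdges_snd he'
        simp only [Function.comp, Prod.mk.injEq] at h
        exact Prod.ext h.2 (Prod.ext h.1 (h3.trans h4.symm))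
      · intro p hp q hq h
        rw [List.mem_map] at hp hq
        obtain ⟨e, he, rfl⟩ := hp
        obtain ⟨e', he', rfl⟩ := hq
        have h1 := ovEdges_lt he
        have h2 := ovEdges_lt he'
        simp only [Function.comp, Prod.mk.injEq] at h
        rw [h.1, h.2] at h1; omega

/-- Adjacency of vertices given by numbers. -/
def ovAdj (N d : ℕ) (f : ℕ → ℕ → Prop) (x y : ℕ) : Prop :=
  (∃ c < d + 2, y = 2 * N + c ∧ ovBit N d f x c) ∨ ∃ c < d + 2, x = 2 * N + c ∧ ovBit N d f y c

theorem ovGraph_arc {directed : Bool} {x y : Fin (2 * N + d + 2)} {w : ℕ} :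
    (ovGraph N d f directed).Arc directed x y w ↔ w = 1 ∧ ovAdj N d f x.val y.val := by
  unfold EdgeList.Arc ovAdj ovGraph
  cases directed
  · simp only [Bool.false_eq_true, if_false, List.append_nil, true_and]
    exact (or_congr mem_ovEdges mem_ovEdges).trans and_or_left.symm
  · simp only [if_true, Bool.true_eq_false, false_and, or_false, List.mem_append, List.mem_map,
      Prod.mk.injEq]
    constructor
    · rintro (h | ⟨⟨a, b, v⟩, h, rfl, rfl, rfl⟩)
      · obtain ⟨h1, h2⟩ := mem_ovEdges.mp h
        exact ⟨h1, Or.inl h2⟩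
      · exact ⟨rfl, Or.inr (mem_ovEdges.mp h).2⟩
    · rintro ⟨rfl, h | h⟩
      · exact Or.inl (mem_ovEdges.mpr ⟨rfl, h⟩)
      · exact Or.inr ⟨(y, x, 1), mem_ovEdges.mpr ⟨rfl, h⟩, rfl, rfl, rfl⟩

theorem ovAdj_hub {u : ℕ} (hN : 0 < N) (hu : u < 2 * N) : ovAdj N d f u (2 * N + d + u / N) := by
  have : u / N < 2 := (Nat.div_lt_iff_lt_mul hN).mpr (by omega)
  exact Or.inl ⟨d + u / N, by omega, by omega, Or.inr (Or.inl ⟨hu, rfl⟩)⟩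

theorem ovAdj_symm {x y : ℕ} (h : ovAdj N d f x y) : ovAdj N d f y x := Or.symm h

theorem ovAdj_fst {u : ℕ} (hu : u < N) : ovAdj N d f u (2 * N + d) := by
  have := ovAdj_hub (d := d) (f := f) (by omega : 0 < N) (by omega : u < 2 * N)
  rwa [Nat.div_eq_of_lt hu] at this

theorem ovAdj_snd {u : ℕ} (h1 : N ≤ u) (h2 : u < 2 * N) : ovAdj N d f u (2 * N + d + 1) := by
  have := ovAdj_hub (d := d) (f := f) (by omega : 0 < N) h2
  rwa [show u / N = 1 from Nat.div_eq_of_lt_le (by omega) (by omega)] at this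

theorem ovAdj_elem {c s : ℕ} (hc : c < d) (hs : s < 2) :
    ovAdj N d f (2 * N + c) (2 * N + d + s) :=
  Or.inl ⟨d + s, by omega, by omega, Or.inr (Or.inr (Or.inl ⟨by omega, by omega, by omega⟩))⟩

theorem ovAdj_hubs : ovAdj N d f (2 * N + d) (2 * N + d + 1) :=
  Or.inl ⟨d + 1, by omega, by omega, Or.inr (Or.inr (Or.inr ⟨rfl, rfl⟩))⟩

theorem ovGraph_adj {directed : Bool} {x y : Fin (2 * N + d + 2)} (h : ovAdj N d f x.val y.val) :
    (ovGraph N d f directed).toSimpleGraph.Adj x y := by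
  have hne : x ≠ y := by
    rintro rfl
    rcases h with ⟨c, -, h1, h2⟩ | ⟨c, -, h1, h2⟩ <;> exact (ovBit_lt h2).ne h1
  refine (SimpleGraph.fromRel_adj _ x y).mpr ?_
  refine ⟨hne, ?_⟩
  rcases h with h | h
  · exact Or.inl ⟨1, List.mem_append_left _ (mem_ovEdges.mpr ⟨rfl, h⟩)⟩
  · exact Or.inr ⟨1, List.mem_append_left _ (mem_ovEdges.mpr ⟨rfl, h⟩)⟩

/-- Every vertex is a hub, or adjacent to a hub. -/
theorem ovAdj_cases {v : ℕ} (hv : v < 2 * N + d + 2) :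
    ∃ s < 2, v = 2 * N + d + s ∨ ovAdj N d f v (2 * N + d + s) := by
  by_cases h1 : v < N
  · exact ⟨0, by omega, Or.inr (ovAdj_fst h1)⟩
  by_cases h2 : v < 2 * N
  · exact ⟨1, by omega, Or.inr (ovAdj_snd (by omega) h2)⟩
  by_cases h3 : v < 2 * N + d
  · obtain ⟨c, rfl⟩ := Nat.exists_eq_add_of_le (by omega : 2 * N ≤ v)
    exact ⟨0, by omega, Or.inr (ovAdj_elem (by omega) (by omega))⟩
  · obtain ⟨c, rfl⟩ := Nat.exists_eq_add_of_le (by omega : 2 * N + d ≤ v)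
    exact ⟨c, by omega, Or.inl rfl⟩

theorem ovGraph_connected (directed : Bool) :
    (ovGraph N d f directed).toSimpleGraph.Connected := by
  let x : Fin (2 * N + d + 2) := ⟨2 * N + d, by omega⟩
  let y : Fin (2 * N + d + 2) := ⟨2 * N + d + 1, by omega⟩
  have hxy : (ovGraph N d f directed).toSimpleGraph.Reachable x y :=
    (ovGraph_adj (x := x) (y := y) ovAdj_hubs).reachable
  have key : ∀ v : Fin (2 * N + d + 2), (ovGraph N d f directed).toSimpleGraph.Reachable v x := by
    intro v
    obtain ⟨s, hs, h⟩ := ovAdj_cases (f := f) v.2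
    have hz : (ovGraph N d f directed).toSimpleGraph.Reachable
        (⟨2 * N + d + s, by omega⟩ : Fin (2 * N + d + 2)) x := by
      rcases (by omega : s = 0 ∨ s = 1) with rfl | rfl
      · exact SimpleGraph.Reachable.refl _
      · exact hxy.symm
    rcases h with h | h
    · rwa [← show v = ⟨2 * N + d + s, by omega⟩ from Fin.ext h] at hz
    · exact (ovGraph_adj (x := v) (y := ⟨2 * N + d + s, by omega⟩) h).reachable.trans hz
  have : Nonempty (Fin (ovGraph N d f directed).n) := ⟨x⟩
  exact ⟨fun v w => (key v).trans (key w).symm⟩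

/-- Every vertex except the second hub has an edge to a larger vertex. This supplies `n ≤ m + 1`,
the range in which a time bound says anything. -/
theorem le_length_ovEdges (hN : 0 < N) : 2 * N + d + 1 ≤ (ovEdges N d f).length := by
  have h : List.range (2 * N + d + 1) ⊆ (ovEdges N d f).map fun e => e.1.val := by
    intro u hu
    rw [List.mem_range] at hu
    have : ∃ c < d + 2, ovBit N d f u c := by
      by_cases h1 : u < 2 * N
      · have : u / N < 2 := (Nat.div_lt_iff_lt_mul hN).mpr (by omega)
        exact ⟨d + u / N, by omega, Or.inr (Or.inl ⟨h1, rfl⟩)⟩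
      · refine ⟨d + 1, by omega, ?_⟩
        unfold ovBit
        omega
    obtain ⟨c, hc, hb⟩ := this
    rw [List.mem_map]
    exact ⟨(⟨u, by omega⟩, ⟨2 * N + c, by omega⟩, 1), mem_ovEdges.mpr ⟨rfl, c, hc, rfl, hb⟩, rfl⟩
  have := (List.subperm_of_subset List.nodup_range h).length_le
  simpa using this

theorem length_ovEdges_le : (ovEdges N d f).length ≤ (2 * N + d + 2) * (d + 2) := by
  classical
  rw [ovEdges, List.length_map]
  refine (List.length_filter_le _ _).trans ?_
  rw [List.length_product, List.length_finRange, List.length_finRange]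

theorem le_length_edges (hN : 0 < N) (directed : Bool) :
    2 * N + d + 2 ≤ (ovGraph N d f directed).edges.length + 1 := by
  have := le_length_ovEdges (d := d) (f := f) hN
  simp only [ovGraph, List.length_append]
  omega

theorem length_edges_le (directed : Bool) :
    (ovGraph N d f directed).edges.length ≤ 2 * ((2 * N + d + 2) * (d + 2)) := by
  have := length_ovEdges_le (N := N) (d := d) (f := f)
  simp only [ovGraph, List.length_append]
  cases directed
  · simp only [Bool.false_eq_true, if_false, List.length_nil]; omega
  · simp only [if_true, List.length_map]; omega

/-- The graph as an instance of Eccentricities. -/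
noncomputable def ovInstance (N d : ℕ) (f : ℕ → ℕ → Prop) (directed weighted : Bool) :
    EccInstance directed weighted where
  graph := ovGraph N d f directed
  two_le := by simp
  simple := ovGraph_simple directed
  connected := ovGraph_connected directed
  weight_pos := by
    intro e he
    have := (ovGraph_arc (x := e.1) (y := e.2.1) (w := e.2.2)).mp (Or.inl he)
    omega
  weight_one := by
    intro _ e he
    exact ((ovGraph_arc (x := e.1) (y := e.2.1) (w := e.2.2)).mp (Or.inl he)).1

theorem EdgeList.HasWalk.cases {directed : Bool} {G : EdgeList ℕ} {x z : Fin G.n} {ℓ : ℕ}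
    (h : G.HasWalk directed x z ℓ) : (x = z ∧ ℓ = 0) ∨ ∃ y w ℓ', G.Arc directed x y w ∧
      G.HasWalk directed y z ℓ' ∧ ℓ = w + ℓ' := by
  cases h with
  | nil => exact Or.inl ⟨rfl, rfl⟩
  | cons h hw => exact Or.inr ⟨_, _, _, h, hw, rfl⟩

theorem ovGraph_dist_le {directed : Bool} {x y : Fin (2 * N + d + 2)} {ℓ : ℕ}
    (h : (ovGraph N d f directed).HasWalk directed x y ℓ) :
    (ovGraph N d f directed).dist directed x y ≤ ℓ := iInf₂_le ℓ h

theorem hasWalk_cons {directed : Bool} {x z : Fin (2 * N + d + 2)} (y ℓ : ℕ)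
    (hy : y < 2 * N + d + 2) (h : ovAdj N d f x.val y)
    (hw : (ovGraph N d f directed).HasWalk directed (⟨y, hy⟩ : Fin (2 * N + d + 2)) z ℓ) :
    (ovGraph N d f directed).HasWalk directed x z (1 + ℓ) :=
  .cons (ovGraph_arc.mpr ⟨rfl, h⟩) hw

theorem hasWalk_one {directed : Bool} {x z : Fin (2 * N + d + 2)} (h : ovAdj N d f x.val z.val) :
    (ovGraph N d f directed).HasWalk directed x z 1 :=
  show (ovGraph N d f directed).HasWalk directed x z (1 + 0) from
    .cons (ovGraph_arc.mpr ⟨rfl, h⟩)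
      (@EdgeList.HasWalk.nil directed (ovGraph N d f directed) z)

/-- The first hub is a neighbor of `i`, of all sets of the first family, of all elements and of the
second hub. Only the sets of the second family need a further step. -/
theorem dist_le_three {directed : Bool} {i : Fin (2 * N + d + 2)} (hi : i.val < N)
    (v : Fin (2 * N + d + 2)) : (ovGraph N d f directed).dist directed i v ≤ 3 ∧
      (¬ (N ≤ v.val ∧ v.val < 2 * N) → (ovGraph N d f directed).dist directed i v ≤ 2) := by
  have hx := ovAdj_fst (d := d) (f := f) hi
  have two : ∀ {x : ℕ∞}, x ≤ 1 → x ≤ 2 := fun h => h.trans (by norm_num)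
  have three : ∀ {x : ℕ∞}, x ≤ 2 → x ≤ 3 := fun h => h.trans (by norm_num)
  have close : ∀ {w : Fin (2 * N + d + 2)}, ovAdj N d f (2 * N + d) w.val →
      (ovGraph N d f directed).dist directed i w ≤ 2 := fun h =>
    ovGraph_dist_le (hasWalk_cons (2 * N + d) 1 (by omega) hx (hasWalk_one h))
  by_cases h1 : v.val < N
  · exact ⟨three (close (ovAdj_symm (ovAdj_fst h1))), fun _ => close (ovAdj_symm (ovAdj_fst h1))⟩
  by_cases h2 : v.val < 2 * N
  · refine ⟨ovGraph_dist_le (hasWalk_cons (2 * N + d) 2 (by omega) hx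
      (hasWalk_cons (2 * N + d + 1) 1 (by omega) ovAdj_hubs (hasWalk_one
        (ovAdj_symm (ovAdj_snd (by omega) h2))))), fun h => absurd ⟨by omega, h2⟩ h⟩
  by_cases h3 : v.val < 2 * N + d
  · obtain ⟨c, hc⟩ := Nat.exists_eq_add_of_le (by omega : 2 * N ≤ v.val)
    have h : ovAdj N d f (2 * N + d) v.val := by
      rw [hc]; exact ovAdj_symm (ovAdj_elem (s := 0) (by omega) (by omega))
    exact ⟨three (close h), fun _ => close h⟩
  by_cases h4 : v.val = 2 * N + d
  · have h : (ovGraph N d f directed).dist directed i v ≤ 1 :=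
      ovGraph_dist_le (hasWalk_one (by rw [h4]; exact hx))
    exact ⟨three (two h), fun _ => two h⟩
  · have h : ovAdj N d f (2 * N + d) v.val := by
      rw [show v.val = 2 * N + d + 1 by omega]; exact ovAdj_hubs
    exact ⟨three (close h), fun _ => close h⟩

theorem dist_le_two {directed : Bool} {i j : Fin (2 * N + d + 2)} (hi : i.val < N)
    (hj : j.val < 2 * N) {c : ℕ} (hc : c < d) (h1 : f i.val c) (h2 : f j.val c) :
    (ovGraph N d f directed).dist directed i j ≤ 2 :=
  ovGraph_dist_le (hasWalk_cons (2 * N + c) 1 (by omega)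
    (Or.inl ⟨c, by omega, rfl, Or.inl ⟨by omega, hc, h1⟩⟩)
    (hasWalk_one (Or.inr ⟨c, by omega, rfl, Or.inl ⟨hj, hc, h2⟩⟩)))

/-- A walk of length at most 2 would need a common neighbor of `i` and `j`. Sets are adjacent only
to elements and to the hub of their own family, so that neighbor would be a common element. -/
theorem three_le_dist {directed : Bool} {i j : Fin (2 * N + d + 2)} (hi : i.val < N)
    (hj : N ≤ j.val) (hj' : j.val < 2 * N) (h : ∀ c < d, ¬ (f i.val c ∧ f j.val c)) :
    3 ≤ (ovGraph N d f directed).dist directed i j := by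
  have hdiv : i.val / N = 0 := Nat.div_eq_of_lt hi
  have hdiv' : j.val / N = 1 := Nat.div_eq_of_lt_le (by omega) (by omega)
  refine le_iInf₂ fun ℓ hw => ?_
  suffices 3 ≤ ℓ by exact_mod_cast this
  by_contra hlt
  rw [not_le] at hlt
  obtain ⟨rfl, -⟩ | ⟨y, w, ℓ', ha0, hw1, rfl⟩ := hw.cases
  · omega
  obtain ⟨rfl, ha⟩ := ovGraph_arc.mp ha0
  have hy : ∃ c < d + 2, y.val = 2 * N + c ∧ ovBit N d f i.val c := by
    rcases ha with h' | ⟨c, _, h', _⟩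
    · exact h'
    · omega
  obtain ⟨c, hc, hyc, hb⟩ := hy
  obtain ⟨rfl, -⟩ | ⟨z, w, ℓ'', ha1, hw2, rfl⟩ := hw1.cases
  · omega
  obtain ⟨rfl, ha'⟩ := ovGraph_arc.mp ha1
  obtain ⟨rfl, -⟩ | ⟨z', w, ℓ''', ha'', -, rfl⟩ := hw2.cases
  · have hb' : ovBit N d f z.val c := by
      rcases ha' with ⟨c', _, h', _⟩ | ⟨c', _, h1, h2⟩
      · omega
      · rwa [show c = c' by omega]
    -- The only hub next to `i` is the column `d`, the only one next to `j` is the column `d + 1`.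
    have hcd : c < d := by
      by_contra hcd
      unfold ovBit at hb hb'
      rw [hdiv] at hb
      rw [hdiv'] at hb'
      omega
    refine h c hcd ⟨?_, ?_⟩
    · rcases hb with h' | h' | h' | h'
      · exact h'.2.2
      all_goals omega
    · rcases hb' with h' | h' | h' | h'
      · exact h'.2.2
      all_goals omega
  · obtain ⟨rfl, -⟩ := ovGraph_arc.mp ha''
    omega

/-- The output word is the eccentricity plus one, so the test `3 < distWord _` asks for eccentricity
at least 3, which can be caused only by a disjoint set of the second family. -/
theorem distWord_ecc {directed : Bool} {i : Fin (2 * N + d + 2)} (hi : i.val < N) :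
    3 < distWord ((ovGraph N d f directed).ecc directed i) ↔
      ∃ j < N, ∀ c < d, ¬ (f i.val c ∧ f (N + j) c) := by
  have h3 : (ovGraph N d f directed).ecc directed i ≤ 3 := iSup_le fun v => (dist_le_three hi v).1
  have hword : ∀ e : ℕ∞, e ≤ 3 → (3 < distWord e ↔ 3 ≤ e) := by
    intro e he
    lift e to ℕ using (lt_of_le_of_lt he (by decide)).ne
    simp only [distWord, ENat.natCast_ne_top, if_false, ENat.toNat_natCast]
    rw [show (3 : ℕ∞) = ((3 : ℕ) : ℕ∞) from rfl, Nat.cast_le]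
    omega
  rw [hword _ h3]
  constructor
  · intro h
    by_contra hcon
    push Not at hcon
    have : (ovGraph N d f directed).ecc directed i ≤ 2 := by
      refine iSup_le fun v => ?_
      by_cases hv : N ≤ v.val ∧ v.val < 2 * N
      · obtain ⟨c, hc, h1, h2⟩ := hcon (v.val - N) (by omega)
        rw [Nat.add_sub_cancel' hv.1] at h2
        exact dist_le_two hi hv.2 hc h1 h2
      · exact (dist_le_three hi v).2 hv
    exact absurd (h.trans this) (by decide)
  · rintro ⟨j, hj, h⟩
    refine le_trans ?_ (le_iSup _ (⟨N + j, by omega⟩ : Fin (2 * N + d + 2)))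
    exact three_le_dist hi (by simp) (by simp; omega) h

end

/-! ### Building the graph and computing the eccentricities

The first two local variables are `d` and `N`, and the bank 3 holds the matrix of `f`. The graph is
built in the bank 2. -/

/-- Adds the entries for the hubs to the matrix; the local variables are
`2 * N`, the number of vertices, `d + 2`, `d` and `N`. -/
def hubCmd : Cmd :=
  .forV 0 (.store 3 (.v 0 * .v 3 + (.v 4 + .v 0 / .v 5)) 1) ;;
  .forV 3 (.store 3 ((.v 1 + .v 0) * .v 3 + .v 4) 1 ;;
    .store 3 ((.v 1 + .v 0) * .v 3 + (.v 4 + 1)) 1) ;;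
  .store 3 ((.v 0 + .v 3) * .v 2 + (.v 3 + 1)) 1

/-- Appends the words for the edges. -/
def emitCmd (flip : Bool) : Cmd :=
  .forV 1 <| .forV 3 <| .ite (.a 3 (.v 1 * .v 4 + .v 0))
    (.push 2 (if flip then .v 2 + .v 0 else .v 1) ;; .push 2 (if flip then .v 1 else .v 2 + .v 0) ;;
      .push 2 1)
    .skip

def ovCmd (directed : Bool) (P : Prog) : Cmd :=
  .letE (.v 0 + 2) <| .letE (2 * .v 2 + .v 1 + 2) <| .letE (2 * .v 3) <|
    hubCmd ;; .push 2 (.v 1) ;; .push 2 0 ;; emitCmd false ;;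
    (if directed then emitCmd true else .skip) ;; .store 2 2 ((.a 2 0 - 2) / 3) ;; P.toCmd 2

theorem mul_add_lt {V D u c : ℕ} (hu : u < V) (hc : c < D) : u * D + c < V * D := by
  calc u * D + c < u * D + D := by omega
    _ = (u + 1) * D := by ring
    _ ≤ V * D := Nat.mul_le_mul_right _ hu

/-! ### Correctness of the graph construction -/

section
variable {B N d : ℕ} {f : ℕ → ℕ → Prop} {env : List ℕ} {σ : Banks}

theorem Runs.hubCmd (hN : 0 < N) (hB : (2 * N + d + 2) * (d + 2) ≤ B)
    (hM : IsMat (d + 2) (σ 3) fun u c => u < 2 * N ∧ c < d ∧ f u c) :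
    Runs B hubCmd ((2 * N) :: (2 * N + d + 2) :: (d + 2) :: d :: N :: env) σ (4 * N + 3 * d + 3)
      fun σ' => ∃ m, σ' = Function.update σ 3 m ∧ IsMat (d + 2) m (ovBit N d f) := by
  have hdB : d + 2 ≤ B := (Nat.le_mul_of_pos_left _ (by omega)).trans hB
  have hVB : 2 * N + d + 2 ≤ B := (Nat.le_mul_of_pos_right _ (by omega)).trans hB
  refine Runs.seq' (T₁ := 1 + 2 * N * (1 + 1)) (T₂ := 1 + d * (2 + 1) + 1)
    (Runs.forV_const (t := 1) (fun k σ' => ∃ m, σ' = Function.update σ 3 m ∧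
      IsMat (d + 2) m fun u c => (u < 2 * N ∧ c < d ∧ f u c) ∨ (u < k ∧ c = d + u / N))
      ⟨σ 3, by simp, by simpa using hM⟩ ?_ ?_) (by omega)
  · rintro k hk _ ⟨m, rfl, hm⟩
    simp only [List.getD_cons_zero] at hk
    have hkN : k / N < 2 := (Nat.div_lt_iff_lt_mul hN).mpr (by omega)
    have := mul_add_lt (V := 2 * N + d + 2) (D := d + 2) (u := k) (c := d + k / N)
      (by omega) (by omega)
    have h0 := Nat.zero_le (k / N)
    refine Runs.store ?_ ?_ ⟨Function.update m (k * (d + 2) + (d + k / N)) 1, ?_, ?_⟩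
    · simp; omega
    · simp; omega
    · simp
    · refine (hm.set (by omega) one_ne_zero).congr fun u c _ => ?_
      constructor
      · rintro ((h | h) | h)
        · exact Or.inl h
        · exact Or.inr ⟨by omega, h.2⟩
        · rw [h.1]; exact Or.inr ⟨by omega, h.2⟩
      · rintro (h | h)
        · exact Or.inl (Or.inl h)
        · by_cases e : u = k
          · subst e; exact Or.inr ⟨rfl, h.2⟩
          · exact Or.inl (Or.inr ⟨by omega, h.2⟩)
  rintro _ ⟨m, rfl, hm⟩
  simp only [List.getD_cons_zero] at hm
  refine Runs.seq (Runs.forV_const (t := 2) (fun k σ' => ∃ m, σ' = Function.update σ 3 m ∧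
      IsMat (d + 2) m fun u c => ((u < 2 * N ∧ c < d ∧ f u c) ∨ (u < 2 * N ∧ c = d + u / N)) ∨
        (2 * N ≤ u ∧ u < 2 * N + k ∧ (c = d ∨ c = d + 1)))
      ⟨m, by simp, by
        refine hm.congr fun u c _ => ?_
        rw [iff_self_or]
        omega⟩ ?_ ?_)
  · rintro k hk _ ⟨m, rfl, hm⟩
    have hk' : k < d := hk
    have := mul_add_lt (V := 2 * N + d + 2) (D := d + 2) (u := 2 * N + k) (c := d + 1)
      (by omega) (by omega)
    refine Runs.seq (T₁ := 1) (T₂ := 1) (Runs.store ?_ ?_ (Runs.store ?_ ?_ ⟨Function.update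
      (Function.update m ((2 * N + k) * (d + 2) + d) 1) ((2 * N + k) * (d + 2) + (d + 1)) 1, ?_, ?_⟩))
    · simp; omega
    · simp; omega
    · simp; omega
    · simp; omega
    · simp
    · refine ((hm.set (by omega) one_ne_zero).set (by omega) one_ne_zero).congr fun u c _ => ?_
      have : ((2 * N ≤ u ∧ u < 2 * N + k ∧ (c = d ∨ c = d + 1)) ∨ (u = 2 * N + k ∧ c = d) ∨
          (u = 2 * N + k ∧ c = d + 1)) ↔
          (2 * N ≤ u ∧ u < 2 * N + (k + 1) ∧ (c = d ∨ c = d + 1)) := by omega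
      rw [or_assoc, or_assoc, this]
  · rintro _ ⟨m, rfl, hm⟩
    have := mul_add_lt (V := 2 * N + d + 2) (D := d + 2) (u := 2 * N + d) (c := d + 1)
      (by omega) (by omega)
    refine Runs.store ?_ ?_ ⟨Function.update m ((2 * N + d) * (d + 2) + (d + 1)) 1, ?_, ?_⟩
    · simp; omega
    · simp; omega
    · simp
    · refine (hm.set (by omega) one_ne_zero).congr fun u c _ => ?_
      simp only [List.getD_cons_succ, List.getD_cons_zero, ovBit]
      tauto

open Classical in
theorem Runs.emitCmd {L : List ℕ} (flip : Bool) (hM : IsMat (d + 2) (σ 3) (ovBit N d f))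
    (hB : L.length + 3 * ((2 * N + d + 2) * (d + 2)) ≤ B) (hσ : σ 2 = loadInput L)
    {Q : Banks → Prop} (hQ : Q (Function.update σ 2 (loadInput (L ++ ovWords N d f flip)))) :
    Runs B (emitCmd flip) ((2 * N) :: (2 * N + d + 2) :: (d + 2) :: d :: N :: env) σ
      (1 + (2 * N + d + 2) * (1 + (d + 2) * (1 + 6 + 1) + 1)) Q := by
  have hdB : d + 2 ≤ B := (Nat.le_mul_of_pos_left _ (by omega : 0 < 2 * N + d + 2)).trans (by omega)
  have hVB : 2 * N + d + 2 ≤ B := (Nat.le_mul_of_pos_right _ (by omega : 0 < d + 2)).trans (by omega)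
  let w : ℕ → ℕ → List ℕ := fun u c =>
    if ovBit N d f u c then (if flip then [2 * N + c, u, 1] else [u, 2 * N + c, 1]) else []
  have hw : ∀ u c, (w u c).length ≤ 3 := by
    intro u c; simp only [w]; split_ifs <;> simp
  have hlen : ∀ u k, ((List.range k).flatMap (w u)).length ≤ 3 * k := by
    intro u k
    rw [List.length_flatMap]
    refine (List.sum_le_card_nsmul _ 3 ?_).trans (by simp [mul_comm])
    simp only [List.mem_map]
    rintro _ ⟨c, -, rfl⟩
    exact hw u c
  have hlen' : ∀ k, ((List.range k).flatMap fun u => (List.range (d + 2)).flatMap (w u)).length ≤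
      k * (3 * (d + 2)) := by
    intro k
    rw [List.length_flatMap]
    refine (List.sum_le_card_nsmul _ (3 * (d + 2)) ?_).trans (by simp)
    simp only [List.mem_map]
    rintro _ ⟨c, -, rfl⟩
    exact hlen c _
  refine Runs.forV_const (t := 1 + (d + 2) * (1 + 6 + 1)) (fun k σ' => σ' = Function.update σ 2
    (loadInput (L ++ (List.range k).flatMap fun u => (List.range (d + 2)).flatMap (w u))))
    (by simp [← hσ]) ?_ (by rintro _ rfl; exact hQ)
  rintro u hu _ rfl
  have hu' : u < 2 * N + d + 2 := hu
  refine Runs.forV_const (t := 1 + 6) (fun k σ' => σ' = Function.update σ 2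
    (loadInput ((L ++ (List.range u).flatMap fun u => (List.range (d + 2)).flatMap (w u)) ++
      (List.range k).flatMap (w u)))) (by simp) ?_
    (by rintro _ rfl; simp [List.range_succ])
  rintro c hc _ rfl
  have hc' : c < d + 2 := hc
  set L' := (L ++ (List.range u).flatMap fun u => (List.range (d + 2)).flatMap (w u)) ++
      (List.range c).flatMap (w u) with hL'
  have hL'len : L'.length + 3 ≤ B := by
    have h1 := hlen u c
    have h2 := hlen' u
    have h3 := mul_add_lt hu' hc'
    simp only [hL', List.length_append]
    nlinarith
  have hidx := mul_add_lt hu' hc'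
  have hstep : (L ++ (List.range u).flatMap fun u => (List.range (d + 2)).flatMap (w u)) ++
      (List.range (c + 1)).flatMap (w u) = L' ++ w u c := by
    simp [hL', List.range_succ]
  rw [hstep]
  have hval : (Ex.a 3 (.v 1 * .v 4 + .v 0)).val
      (c :: u :: (2 * N) :: (2 * N + d + 2) :: (d + 2) :: d :: N :: env)
      (Function.update σ 2 (loadInput L')) = σ 3 (u * (d + 2) + c) := by
    simp
  refine Runs.ite (by simp; omega) ?_ ?_
  · intro h
    rw [hval, hM u c hc'] at h
    refine Runs.seq (T₁ := 2) (T₂ := 4) (Runs.push (L := L') (by simp) ?_ (by omega)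
      (Runs.seq (T₁ := 2) (T₂ := 2) (Runs.push (L := L' ++ [if flip then 2 * N + c else u]) ?_ ?_
        (by simp; omega)
        (Runs.push (L := L' ++ [if flip then 2 * N + c else u] ++ [if flip then u else 2 * N + c])
          ?_ ?_ (by simp; omega) ?_))))
    · cases flip <;> simp; omega
    · cases flip <;> simp
    · cases flip <;> simp; omega
    · cases flip <;> simp
    · simp; omega
    · cases flip <;> simp [w, h]
  · intro h
    rw [hval, ← not_ne_iff, hM u c hc'] at h
    exact (Runs.skip (by simp [w, h])).time_le (by omega)

theorem length_encode {α : Type} (G : EdgeList α) (g : α → List ℕ) (k : ℕ)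
    (hg : ∀ a, (g a).length = k) : (G.encode g).length = 2 + (k + 2) * G.edges.length := by
  simp only [EdgeList.encode, List.length_cons, List.length_flatMap, hg]
  simp; ring

theorem length_ovWords (directed : Bool) :
    (ovWords N d f false ++ if directed then ovWords N d f true else []).length =
      3 * (ovGraph N d f directed).edges.length := by
  have h := congrArg List.length (ovGraph_encode N d f directed)
  rw [length_encode _ _ 1 (fun _ => rfl), List.length_cons, List.length_cons] at h
  omega

theorem Runs.ovCmd (directed : Bool) {P : Prog} {W t : ℕ} {s' : Mem} (hN : 0 < N)
    (hB : 6 * ((2 * N + d + 2) * (d + 2)) + 2 ≤ B) (hWB : W ≤ B) (hP : P.maxConst ≤ B)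
    (hσ : σ 2 = fun _ => 0) (hM : IsMat (d + 2) (σ 3) fun u c => u < 2 * N ∧ c < d ∧ f u c)
    (hrun : Exec W P (loadInput ((ovGraph N d f directed).encode fun w => [w])) t s') :
    Runs B (ovCmd directed P) (d :: N :: env) σ (40 * ((2 * N + d + 2) * (d + 2)) + t)
      fun σ' => ∃ m, σ' = Function.update (Function.update σ 3 m) 2 s' ∧
        IsMat (d + 2) m (ovBit N d f) := by
  have hdB : d + 2 ≤ B := (Nat.le_mul_of_pos_left _ (by omega : 0 < 2 * N + d + 2)).trans (by omega)
  have hVB : 2 * N + d + 2 ≤ B := (Nat.le_mul_of_pos_right _ (by omega : 0 < d + 2)).trans (by omega)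
  have h1 := length_edges_le (N := N) (d := d) (f := f) directed
  have h2 := length_ovWords (N := N) (d := d) (f := f) directed
  have h3 := ovGraph_encode N d f directed
  set m := (ovGraph N d f directed).edges.length
  refine Runs.time_le (T₁ := 1 + (1 + (1 + ((4 * N + 3 * d + 3) + (2 + (2 +
    ((1 + (2 * N + d + 2) * (1 + (d + 2) * (1 + 6 + 1) + 1)) +
    ((1 + (2 * N + d + 2) * (1 + (d + 2) * (1 + 6 + 1) + 1)) + (1 + t))))))))) ?_ (by nlinarith)
  refine Runs.letE (by simp; omega) (Runs.letE (by simp; omega) (Runs.letE (by simp; omega) ?_))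
  simp only [Ex.val_add, Ex.val_mul, Ex.val_v, Ex.val_ofNat, List.getD_cons_zero,
    List.getD_cons_succ]
  refine Runs.seq ((Runs.hubCmd hN (by omega) hM).mono le_rfl ?_)
  rintro _ ⟨M, rfl, hM'⟩
  refine Runs.seq (Runs.push (L := []) (by simp [hσ]) (by simp) (by simp; omega)
    (Runs.seq (Runs.push (L := [2 * N + d + 2]) (by simp) (by simp) (by simp; omega)
    (Runs.seq (Runs.emitCmd (L := [2 * N + d + 2, 0]) false (by simpa using hM')
      (by simp; omega) (by simp) (Runs.seq (T₂ := 1 + t) (Q := _) ?_)))))) 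
  have hlast : ∀ L : List ℕ, L = [2 * N + d + 2, 0] ++
      (ovWords N d f false ++ if directed then ovWords N d f true else []) →
      Runs B (.store 2 2 ((.a 2 0 - 2) / 3) ;; P.toCmd 2)
        ((2 * N) :: (2 * N + d + 2) :: (d + 2) :: d :: N :: env)
        (Function.update (Function.update σ 3 M) 2 (loadInput L)) (1 + t)
        fun σ' => ∃ m, σ' = Function.update (Function.update σ 3 m) 2 s' ∧
          IsMat (d + 2) m (ovBit N d f) := by
    intro L hL
    have hL0 : loadInput L 0 = L.length := rfl
    have hlen : L.length = 2 + 3 * m := by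
      rw [hL, List.length_append, h2, List.length_cons, List.length_singleton]
    refine Runs.seq (Runs.store (by simp; omega) (by simp; omega)
      ((Runs.toCmd hWB hrun hP _ ?_).mono le_rfl ?_))
    · simp only [Ex.val_div, Ex.val_sub, Ex.val_a, Ex.val_ofNat, Function.update_self]
      rw [hL0, hlen, show (2 + 3 * m - 2) / 3 = m by omega, loadInput_set L 1 m (by omega), h3, hL]
      simp
    · rintro _ rfl
      exact ⟨M, by simp, hM'⟩
  cases directed
  · refine (Runs.skip ?_).time_le (by omega)
    simp only [Function.update_idem]
    exact hlast _ (by simp)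
  · refine Runs.emitCmd (L := [2 * N + d + 2, 0] ++ ovWords N d f false) true (by simpa using hM')
      ?_ (by simp) ?_
    · simp only [if_true, List.length_append] at h2 ⊢
      simp only [List.length_cons, List.length_nil]
      have h4 := length_ovWords (N := N) (d := d) (f := f) false
      have h5 : (ovGraph N d f false).edges.length ≤ (2 * N + d + 2) * (d + 2) := by
        simpa using length_ovEdges_le (N := N) (d := d) (f := f)
      simp only [Bool.false_eq_true, if_false, List.append_nil] at h4
      rw [h4]
      simp only [ovGraph, Bool.false_eq_true, if_false, List.append_nil] at h5 ⊢
      omega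
    · simp only [Function.update_idem]
      exact hlast _ (by simp)

end

/-! ### Disjoint sets from eccentricities -/

section
variable {B N d : ℕ} {f : ℕ → ℕ → Prop} {env : List ℕ} {σ : Banks}

/-- Finds a set in the first family that is disjoint from some set in the second family. Its number
plus one is left in the bank 5. -/
def ovFindCmd (directed : Bool) (P : Prog) : Cmd :=
  ovCmd directed P ;; .forV 1 (.ite (.op .lt 3 (.a 2 (.v 0 + 1))) (.store 5 0 (.v 0 + 1)) .skip)

theorem ecc_output {directed weighted : Bool} {s : Mem}
    (h : (eccentricities directed weighted).Sol (ovInstance N d f directed weighted) (readOutput s))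
    {i : ℕ} (hi : i < N) :
    3 < s (i + 1) ↔ ∃ j < N, ∀ c < d, ¬ (f i c ∧ f (N + j) c) := by
  have hV : i < 2 * N + d + 2 := by omega
  change readOutput s = List.ofFn (fun v : Fin (2 * N + d + 2) =>
    distWord ((ovGraph N d f directed).ecc directed v)) at h
  have hlen := congrArg List.length h
  simp only [readOutput, List.length_map, List.length_range, List.length_ofFn] at hlen
  have := congrArg (fun l => l[i]?) h
  simp only [readOutput, List.getElem?_map, List.getElem?_ofFn] at this
  rw [List.getElem?_range (by omega), dif_pos hV] at this
  simp only [Option.map_some, Option.some.injEq] at this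
  rw [this]
  exact distWord_ecc (i := ⟨i, hV⟩) hi

/-- One scan over the first `N` output words. The eccentricities reveal only the set of the first
family, not its partner; a decision problem needs no more, and the partner can be found afterwards
in time `O(N * d)`. -/
theorem Runs.ovFindCmd {directed weighted : Bool} {P : Prog} {W t : ℕ} {s' : Mem} (hN : 0 < N)
    (hB : 6 * ((2 * N + d + 2) * (d + 2)) + 3 ≤ B) (hWB : W ≤ B) (hP : P.maxConst ≤ B)
    (hσ : σ 2 = fun _ => 0) (hσ5 : σ 5 0 = 0)
    (hM : IsMat (d + 2) (σ 3) fun u c => u < 2 * N ∧ c < d ∧ f u c)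
    (hrun : Exec W P (loadInput ((ovGraph N d f directed).encode fun w => [w])) t s')
    (hsol : (eccentricities directed weighted).Sol (ovInstance N d f directed weighted)
      (readOutput s')) :
    Runs B (ovFindCmd directed P) (d :: N :: env) σ (43 * ((2 * N + d + 2) * (d + 2)) + t)
      fun σ' => ∃ m g, σ' = Function.update (Function.update (Function.update σ 3 m) 2 s') 5 g ∧
        IsMat (d + 2) m (ovBit N d f) ∧
        (g 0 = 0 → ∀ i < N, ∀ j < N, ∃ c < d, f i c ∧ f (N + j) c) ∧
        (g 0 ≠ 0 → ∃ i < N, g 0 = i + 1 ∧ ∃ j < N, ∀ c < d, ¬ (f i c ∧ f (N + j) c)) := by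
  have hVB : 2 * N + d + 2 ≤ (2 * N + d + 2) * (d + 2) := Nat.le_mul_of_pos_right _ (by omega)
  refine Runs.seq' (T₂ := 1 + N * ((1 + 1) + 1)) ((Runs.ovCmd directed hN (by omega) hWB hP hσ hM
    hrun).mono le_rfl ?_) (by omega)
  rintro _ ⟨m, rfl, hm⟩
  refine Runs.forV_const (t := 1 + 1) (fun k σ' => ∃ g,
    σ' = Function.update (Function.update (Function.update σ 3 m) 2 s') 5 g ∧
    (g 0 = 0 → ∀ i < k, ∀ j < N, ∃ c < d, f i c ∧ f (N + j) c) ∧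
    (g 0 ≠ 0 → ∃ i < N, g 0 = i + 1 ∧ ∃ j < N, ∀ c < d, ¬ (f i c ∧ f (N + j) c)))
    ⟨σ 5, by
      have : σ 5 = Function.update (Function.update σ 3 m) 2 s' 5 := by simp
      rw [this, Function.update_eq_self], by simp [hσ5], by simp [hσ5]⟩ ?_ ?_
  · rintro k hk _ ⟨g, rfl, h1, h2⟩
    have hk' : k < N := hk
    refine Runs.ite (by simp; omega) ?_ ?_
    · intro h
      refine Runs.store (by simp) (by simp; omega) ⟨Function.update g 0 (k + 1), by simp, by simp, ?_⟩
      intro _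
      refine ⟨k, hk', by simp, (ecc_output hsol hk').mp ?_⟩
      simpa using h
    · intro h
      refine Runs.skip ⟨g, rfl, fun hg i hi => ?_, h2⟩
      by_cases e : i < k
      · exact h1 hg i e
      · have e : i = k := by omega
        subst e
        by_contra hcon
        push Not at hcon
        have := (ecc_output hsol hk').mpr (by
          obtain ⟨j, hj, hc⟩ := hcon
          exact ⟨j, hj, fun c hc' h => hc c hc' h.1 h.2⟩)
        simp at h
        omega
  · rintro _ ⟨g, rfl, h1, h2⟩
    exact ⟨m, g, rfl, hm, h1, h2⟩

end

/-! ### Reading the input -/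

theorem getD_flatMap {α : Type} (e : α → List ℕ) (L : List α) {i r : ℕ} (hi : i < L.length)
    (hr : r < (e L[i]).length) :
    (L.flatMap e).getD (((L.take i).flatMap e).length + r) 0 = (e L[i]).getD r 0 := by
  have h : L.flatMap e = (L.take i).flatMap e ++ (e L[i] ++ (L.drop (i + 1)).flatMap e) := by
    calc L.flatMap e = (L.take i ++ L[i] :: L.drop (i + 1)).flatMap e := by
          rw [List.cons_getElem_drop_succ, List.take_append_drop]
      _ = _ := by rw [List.flatMap_append, List.flatMap_cons]
  rw [h, List.getD_eq_getElem?_getD, List.getElem?_append_right (by omega),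
    List.getElem?_append_left (by omega), List.getD_eq_getElem?_getD]
  congr 2
  omega

theorem length_flatMap_const {α : Type} (e : α → List ℕ) (L : List α) {k : ℕ}
    (hk : ∀ a, (e a).length = k) : (L.flatMap e).length = k * L.length := by
  rw [List.length_flatMap]
  simp [hk, mul_comm]

theorem getD_flatMap_const {α : Type} (e : α → List ℕ) (L : List α) {k i r : ℕ}
    (hk : ∀ a, (e a).length = k) (hi : i < L.length) (hr : r < k) :
    (L.flatMap e).getD (k * i + r) 0 = (e L[i]).getD r 0 := by
  rw [← getD_flatMap e L hi (by rwa [hk]), length_flatMap_const e _ hk, List.length_take,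
    min_eq_left hi.le]

/-! ### Satisfiability -/

/-- The partial assignment `i` satisfies the literal `l`. The bits of `i` below `h` are the values of
`h` variables, the other bits tell which variables these are. -/
def litSat {n : ℕ} (h i : ℕ) (l : Fin n × Bool) : Prop :=
  l.1.val / h = i >>> h ∧ (i >>> (l.1.val % h)) % 2 = l.2.toNat

/-- The partial assignment `i` satisfies no literal of the clause `c`. -/
def unsat {k : ℕ} (φ : KCNF k) (h i c : ℕ) : Prop :=
  ∃ hc : c < φ.clauses.length, ∀ l ∈ φ.clauses[c], ¬ litSat h i l

/-- The words for a clause. -/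
def clauseWords {n : ℕ} (c : List (Fin n × Bool)) : List ℕ :=
  c.length :: c.flatMap fun l => [l.1.val, l.2.toNat]

/-- The matrix of the unsatisfied clauses; the local variables are
`2 * N`, `d`, `N`, `h` and the number of variables. -/
def satMatrixCmd : Cmd :=
  .forV 1 <| .letE (.a 4 0) <| .letE (.a 0 (.v 0)) <|
    .forV 3 (.store 3 (.v 0 * (.v 5 + 2) + .v 3) 1 ;;
      .forV 1 (.letE (.a 0 (.v 3 + 2 * .v 0 + 1)) <|
        .ite (.op .eq (.v 0 / .v 9) (.op .shr (.v 2) (.v 9)) *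
            .op .eq (.op .shr (.v 2) (.v 0 % .v 9) % 2) (.a 0 (.v 4 + 2 * .v 1 + 2)))
          (.store 3 (.v 2 * (.v 7 + 2) + .v 5) 0) .skip)) ;;
    .store 4 0 (.v 1 + 2 * .v 0 + 1)

def satCmd (directed : Bool) (P : Prog) : Cmd :=
  .letE (.a 0 1) <| .letE ((.v 0 + 1) / 2) <| .letE (.op .shl 1 (.v 0)) <| .letE (.a 0 2) <|
    .store 4 0 3 ;; .letE (2 * .v 1) satMatrixCmd ;; ovFindCmd directed P ;;
    .ite (.a 5 0) (.push 1 1) (.push 1 0)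

theorem IsMat.clear {D : ℕ} {m : ℕ → ℕ} {p : ℕ → ℕ → Prop} (h : IsMat D m p) {u c : ℕ}
    (hc : c < D) :
    IsMat D (Function.update m (u * D + c) 0) fun u' c' => p u' c' ∧ ¬ (u' = u ∧ c' = c) := by
  intro u' c' hc'
  by_cases e : u' = u ∧ c' = c
  · simp [e.1, e.2]
  · rw [Function.update_of_ne fun h' => e ((mul_add_inj hc' hc).mp h'), h u' c' hc']
    simp [e]

/-! ### Correctness of the clause matrix -/

section
variable {B k : ℕ} {φ : KCNF k} {σ : Banks}

/-- The position of the clause `c` in the input. -/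
def clausePos (φ : KCNF k) (c : ℕ) : ℕ := 3 + ((φ.clauses.take c).flatMap clauseWords).length

theorem kSAT_encode : (kSAT k).encode φ = φ.n :: φ.clauses.length :: φ.clauses.flatMap clauseWords :=
  rfl

theorem length_clauseWords {n : ℕ} (c : List (Fin n × Bool)) :
    (clauseWords c).length = 2 * c.length + 1 := by
  rw [clauseWords, List.length_cons, length_flatMap_const (k := 2) _ _ (fun _ => rfl)]

theorem loadInput_clause {c r : ℕ} (hc : c < φ.clauses.length)
    (hr : r < 2 * φ.clauses[c].length + 1) :
    loadInput ((kSAT k).encode φ) (clausePos φ c + r) = (clauseWords φ.clauses[c]).getD r 0 := by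
  rw [clausePos, kSAT_encode, show 3 + ((φ.clauses.take c).flatMap clauseWords).length + r =
    ((φ.clauses.take c).flatMap clauseWords).length + r + 1 + 1 + 1 by ring]
  simp only [loadInput, List.getD_cons_succ]
  exact getD_flatMap clauseWords φ.clauses hc (by rwa [length_clauseWords])

theorem clausePos_succ {c : ℕ} (hc : c < φ.clauses.length) :
    clausePos φ (c + 1) = clausePos φ c + 2 * φ.clauses[c].length + 1 := by
  rw [clausePos, clausePos, List.take_add_one, List.getElem?_eq_getElem hc]
  simp only [Option.toList_some, List.flatMap_append, List.length_append, List.flatMap_cons,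
    List.flatMap_nil, List.append_nil, length_clauseWords]
  ring

theorem clausePos_le (c : ℕ) : clausePos φ c ≤ 1 + ((kSAT k).encode φ).length := by
  rw [clausePos, kSAT_encode]
  have : ((φ.clauses.take c).flatMap clauseWords).length ≤
      (φ.clauses.flatMap clauseWords).length := by
    conv_rhs => rw [← List.take_append_drop c φ.clauses]
    rw [List.flatMap_append, List.length_append]
    omega
  simp only [List.length_cons]
  omega

theorem clauseWords_lit {n : ℕ} {ls : List (Fin n × Bool)} {l : ℕ} (hl : l < ls.length) :
    (clauseWords ls).getD (2 * l + 1) 0 = ls[l].1.val ∧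
      (clauseWords ls).getD (2 * l + 2) 0 = ls[l].2.toNat := by
  simp only [clauseWords, List.getD_cons_succ]
  constructor
  · exact getD_flatMap_const (k := 2) (r := 0) (fun l : Fin n × Bool => [l.1.val, l.2.toNat]) ls
      (fun _ => rfl) hl (by omega)
  · exact getD_flatMap_const (k := 2) (r := 1) (fun l : Fin n × Bool => [l.1.val, l.2.toNat]) ls
      (fun _ => rfl) hl (by omega)

/-- Clauses have different lengths, so the bank 4 keeps the current reading position; the first
clause starts at address 3, after the total length and two header words. Each entry is first set to
1 and then cleared by any satisfied literal, in at most `k` rounds, so the whole matrix takes time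
`O(k * N * d)` up to lower order terms. -/
theorem Runs.satMatrixCmd {h N n d : ℕ} {env : List ℕ} (hd : d = φ.clauses.length) (hN : 0 < N)
    (hB : (2 * N + d + 2) * (d + 2) ≤ B) (hlen : ((kSAT k).encode φ).length + 5 ≤ B)
    (h0 : σ 0 = loadInput ((kSAT k).encode φ)) (h3 : σ 3 = fun _ => 0) (h4 : σ 4 0 = 3)
    : Runs B satMatrixCmd ((2 * N) :: d :: N :: h :: n :: env) σ
      (1 + d * (1 + (1 + ((1 + 2 * N * (1 + (1 + k * (1 + (1 + 1) + 1)) + 1)) + 1)) + 1))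
      fun σ' => ∃ m p, σ' = Function.update (Function.update σ 3 m) 4 p ∧
        IsMat (d + 2) m fun u c => u < 2 * N ∧ c < d ∧ unsat φ h u c := by
  have hDB : d + 2 ≤ B := (Nat.le_mul_of_pos_left _ (by omega : 0 < 2 * N + d + 2)).trans (by omega)
  have hVB : 2 * N + d + 2 ≤ B := (Nat.le_mul_of_pos_right _ (by omega : 0 < d + 2)).trans (by omega)
  refine Runs.forV_const (t := 1 + (1 + ((1 + 2 * N * (1 + (1 + k * (1 + (1 + 1) + 1)) + 1)) + 1)))
    (fun c σ' => ∃ m p, σ' = Function.update (Function.update σ 3 m) 4 p ∧ p 0 = clausePos φ c ∧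
      IsMat (d + 2) m fun u c' => u < 2 * N ∧ c' < c ∧ unsat φ h u c')
    ⟨σ 3, σ 4, by simp, by rw [h4]; simp [clausePos], by simp [IsMat, h3]⟩ ?_
    (by rintro _ ⟨m, p, rfl, -, hm⟩; exact ⟨m, p, rfl, hm⟩)
  rintro c hc _ ⟨m, p, rfl, hp, hm⟩
  have hc' : c < d := hc
  have hcφ : c < φ.clauses.length := hd ▸ hc'
  set C := φ.clauses[c] with hC
  have hCk : C.length ≤ k := φ.width _ (List.getElem_mem _)
  have hpos : clausePos φ c + 2 * C.length + 1 ≤ B := by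
    rw [← clausePos_succ hcφ]
    exact (clausePos_le _).trans (by omega)
  have hread : ∀ r, r < 2 * C.length + 1 → σ 0 (clausePos φ c + r) = (clauseWords C).getD r 0 :=
    fun r hr => by rw [h0]; exact loadInput_clause hcφ hr
  have hv : (Ex.a 4 0).val (c :: (2 * N) :: d :: N :: h :: n :: env)
      (Function.update (Function.update σ 3 m) 4 p) = clausePos φ c := by simp [hp]
  refine Runs.letE (by simp) (Runs.letE (by simp) ?_)
  rw [hv]
  have hv2 : (Ex.a 0 (.v 0)).val (clausePos φ c :: c :: (2 * N) :: d :: N :: h :: n :: env)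
      (Function.update (Function.update σ 3 m) 4 p) = C.length := by
    have := hread 0 (by omega)
    simp only [add_zero] at this
    simp [this, clauseWords]
  rw [hv2]
  refine Runs.seq (Runs.forV_const (t := 1 + (1 + k * (1 + (1 + 1) + 1)))
    (fun i σ' => ∃ m, σ' = Function.update (Function.update σ 3 m) 4 p ∧
      IsMat (d + 2) m fun u c' => (u < 2 * N ∧ c' < c ∧ unsat φ h u c') ∨
        (u < i ∧ c' = c ∧ unsat φ h u c'))
    ⟨m, rfl, by simpa using hm⟩ ?_ ?_)
  · rintro i hi _ ⟨m, rfl, hm⟩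
    have hi' : i < 2 * N := hi
    have hidx := mul_add_lt (V := 2 * N + d + 2) (D := d + 2) (u := i) (c := c)
      (by omega) (by omega)
    refine Runs.seq (Runs.store (by simp; omega) (by simp; omega) ?_)
    refine Runs.time_le (T₁ := 1 + C.length * (1 + (1 + 1) + 1)) (Runs.forV_const (t := 1 + (1 + 1))
      (fun l σ' => ∃ m, σ' = Function.update (Function.update σ 3 m) 4 p ∧
        IsMat (d + 2) m fun u c' => ((u < 2 * N ∧ c' < c ∧ unsat φ h u c') ∨
          (u < i ∧ c' = c ∧ unsat φ h u c')) ∨ (u = i ∧ c' = c ∧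
            ∀ l' (h' : l' < C.length), l' < l → ¬ litSat h i C[l']))
      ⟨Function.update m (i * (d + 2) + c) 1, ?_, ?_⟩ ?_ ?_) (by gcongr)
    · simp [Function.update_comm]
    · simpa using hm.set (u := i) (c := c) (by omega) one_ne_zero
    · rintro l hl _ ⟨m, rfl, hm⟩
      have hl' : l < C.length := hl
      have hr1 := hread (2 * l + 1) (by omega)
      have hr2 := hread (2 * l + 2) (by omega)
      rw [(clauseWords_lit hl').1] at hr1
      rw [(clauseWords_lit hl').2] at hr2
      rw [← add_assoc] at hr1 hr2
      refine Runs.letE (by simp; omega) ?_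
      have hv3 : (Ex.a 0 (.v 3 + 2 * .v 0 + 1)).val
          (l :: i :: C.length :: clausePos φ c :: c :: (2 * N) :: d :: N :: h :: n :: env)
          (Function.update (Function.update σ 3 m) 4 p) = C[l].1.val := by
        simp [hr1]
      rw [hv3]
      -- The product of the two comparisons is their conjunction: the variable belongs to the half
      -- described by `i`, and its bit agrees with the sign of the literal.
      have hv4 : (Ex.op .eq (.v 0 / .v 9) (.op .shr (.v 2) (.v 9)) *
            .op .eq (.op .shr (.v 2) (.v 0 % .v 9) % 2) (.a 0 (.v 4 + 2 * .v 1 + 2))).val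
          (C[l].1.val :: l :: i :: C.length :: clausePos φ c :: c :: (2 * N) :: d :: N :: h :: n :: env)
          (Function.update (Function.update σ 3 m) 4 p) ≠ 0 ↔ litSat h i C[l] := by
        simp [hr2, litSat, and_comm]
      have hone : 1 ≤ B := by omega
      refine Runs.ite ?_ ?_ ?_
      · simp only [Ex.ok_mul, Ex.ok_eq, Ex.ok_div, Ex.ok_v, Ex.ok_shr, Ex.ok_mod, Ex.ok_a,
          Ex.ok_add, Ex.ok_ofNat, Ex.val_mul, Ex.val_eq, Ex.val_add, Ex.val_v, Ex.val_ofNat,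
          List.getD_cons_succ, List.getD_cons_zero, true_and, and_true]
        refine ⟨by omega, ?_⟩
        split_ifs <;> simp
        omega
      · intro hval
        rw [hv4] at hval
        refine Runs.store (by simp; omega) (by simp) ⟨Function.update m (i * (d + 2) + c) 0, ?_, ?_⟩
        · simp [Function.update_comm]
        · refine (hm.clear (by omega)).congr fun u c' _ => ?_
          constructor
          · rintro ⟨(h1 | h1) | h1, h2⟩
            · exact Or.inl (Or.inl h1)
            · exact Or.inl (Or.inr h1)
            · exact absurd ⟨h1.1, h1.2.1⟩ h2
          · rintro ((h1 | h1) | h1)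
            · exact ⟨Or.inl (Or.inl h1), by omega⟩
            · exact ⟨Or.inl (Or.inr h1), by omega⟩
            · exact absurd hval (h1.2.2 l hl' (by omega))
      · intro hval
        rw [← not_ne_iff, hv4] at hval
        refine Runs.skip ⟨m, rfl, hm.congr fun u c' _ => or_congr Iff.rfl
          (and_congr Iff.rfl (and_congr Iff.rfl ⟨fun h1 l' h' hl'' => ?_, fun h1 l' h' hl'' =>
            h1 l' h' (by omega)⟩))⟩
        by_cases e : l' = l
        · subst e; exact hval
        · exact h1 l' h' (by omega)
    · rintro _ ⟨m, rfl, hm⟩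
      refine ⟨m, rfl, hm.congr fun u c' _ => ?_⟩
      have hfin : ∀ u, (∀ l' (h' : l' < C.length), l' < (C.length :: clausePos φ c :: c ::
          (2 * N) :: d :: N :: h :: n :: env).getD 0 0 → ¬ litSat h u C[l']) ↔ unsat φ h u c := by
        intro u
        simp only [List.getD_cons_zero]
        constructor
        · intro h1
          refine ⟨hcφ, fun l hl => ?_⟩
          obtain ⟨l', h', rfl⟩ := List.getElem_of_mem hl
          exact h1 l' h' h'
        · rintro ⟨_, h1⟩ l' h' _
          exact h1 _ (List.getElem_mem _)
      constructor
      · rintro ((h1 | h1) | h1)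
        · exact Or.inl h1
        · exact Or.inr ⟨by omega, h1.2⟩
        · refine Or.inr ⟨by omega, h1.2.1, ?_⟩
          rw [h1.1, h1.2.1]
          exact (hfin i).mp h1.2.2
      · rintro (h1 | ⟨h1, rfl, h2⟩)
        · exact Or.inl (Or.inl h1)
        · by_cases e : u = i
          · subst e; exact Or.inr ⟨rfl, rfl, (hfin u).mpr h2⟩
          · exact Or.inl (Or.inr ⟨by omega, rfl, h2⟩)
  · rintro _ ⟨m, rfl, hm⟩
    refine Runs.store (by simp) (by simp; omega) ⟨m, Function.update p 0 (clausePos φ (c + 1)), ?_,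
      by simp, hm.congr fun u c' _ => ?_⟩
    · simp [clausePos_succ hcφ, hC]
    · have hN2 : (C.length :: clausePos φ c :: c :: (2 * N) :: d :: N :: h :: n :: env).getD 3 0 =
        2 * N := rfl
      rw [hN2]
      constructor
      · rintro (h1 | ⟨h1, rfl, h2⟩)
        · exact ⟨h1.1, by omega, h1.2.2⟩
        · exact ⟨h1, by omega, h2⟩
      · rintro ⟨h1, h2, h3⟩
        by_cases e : c' = c
        · exact Or.inr ⟨h1, e, h3⟩
        · exact Or.inl ⟨h1, by omega, h3⟩

end

/-- Cut an assignment into the values `i` of the first `h` variables and the values `j` of the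
others. A literal is true iff the half that owns its variable satisfies it, so a clause is false iff
both halves leave it unsatisfied. Adding `2 ^ h` to `j` sets the bit that marks the second half. -/
theorem satisfiable_iff {k : ℕ} (φ : KCNF k) {h : ℕ} (hn : φ.n ≤ 2 * h) :
    φ.Satisfiable ↔ ∃ i < 2 ^ h, ∃ j < 2 ^ h, ∀ c < φ.clauses.length,
      ¬ (unsat φ h i c ∧ unsat φ h (2 ^ h + j) c) := by
  have shr : ∀ i t, (i >>> t) % 2 = (i.testBit t).toNat := by
    intro i t
    rw [Nat.testBit_eq_decide_div_mod_eq, Nat.shiftRight_eq_div_pow]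
    have := Nat.mod_lt (i / 2 ^ t) (by norm_num : 2 > 0)
    rcases (by omega : i / 2 ^ t % 2 = 0 ∨ i / 2 ^ t % 2 = 1) with e | e <;> simp [e]
  have hi0 : ∀ i < 2 ^ h, i >>> h = 0 := fun i hi => by
    rw [Nat.shiftRight_eq_div_pow, Nat.div_eq_of_lt hi]
  have hj1 : ∀ j < 2 ^ h, (2 ^ h + j) >>> h = 1 := fun j hj => by
    rw [Nat.shiftRight_eq_div_pow, Nat.add_div_left _ (by positivity), Nat.div_eq_of_lt hj]
  have hdiv : ∀ v : Fin φ.n, v.val / h = 0 ∧ v.val < h ∨ v.val / h = 1 ∧ ¬ v.val < h := by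
    intro v
    have := v.2
    by_cases hv : v.val < h
    · exact Or.inl ⟨Nat.div_eq_of_lt hv, hv⟩
    · exact Or.inr ⟨Nat.div_eq_of_lt_le (by omega) (by omega), hv⟩
  -- The hypothesis says that `a` is the assignment glued together from the bits of `i` and `j`.
  have key : ∀ (a : Fin φ.n → Bool), ∀ i < 2 ^ h, ∀ j < 2 ^ h,
      (∀ v : Fin φ.n, (if v.val < h then i else 2 ^ h + j).testBit (v.val % h) = a v) →
      ∀ l : Fin φ.n × Bool, (a l.1 = l.2 ↔ litSat h i l ∨ litSat h (2 ^ h + j) l) := by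
    intro a i hi j hj ha l
    have h1 := ha l.1
    have hb : ∀ b b' : Bool, b.toNat = b'.toNat ↔ b = b' := by decide
    simp only [litSat, shr, hi0 i hi, hj1 j hj, hb]
    rcases hdiv l.1 with ⟨e1, e2⟩ | ⟨e1, e2⟩
    · rw [if_pos e2] at h1
      simp [e1, h1]
    · rw [if_neg e2] at h1
      simp [e1, h1]
  have key2 : ∀ (a : Fin φ.n → Bool), ∀ i < 2 ^ h, ∀ j < 2 ^ h,
      (∀ v : Fin φ.n, (if v.val < h then i else 2 ^ h + j).testBit (v.val % h) = a v) →
      ((∀ c ∈ φ.clauses, ∃ l ∈ c, a l.1 = l.2) ↔ ∀ c < φ.clauses.length,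
        ¬ (unsat φ h i c ∧ unsat φ h (2 ^ h + j) c)) := by
    intro a i hi j hj ha
    constructor
    · rintro hs c hc ⟨⟨_, h1⟩, ⟨_, h2⟩⟩
      obtain ⟨l, hl, hal⟩ := hs _ (List.getElem_mem hc)
      rcases (key a i hi j hj ha l).mp hal with h' | h'
      · exact h1 l hl h'
      · exact h2 l hl h'
    · intro hs c' hc'
      obtain ⟨c, hc, rfl⟩ := List.getElem_of_mem hc'
      by_contra hcon
      push Not at hcon
      refine hs c hc ⟨⟨hc, fun l hl h' => hcon l hl ((key a i hi j hj ha l).mpr (Or.inl h'))⟩,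
        ⟨hc, fun l hl h' => hcon l hl ((key a i hi j hj ha l).mpr (Or.inr h'))⟩⟩
  constructor
  · rintro ⟨a, ha⟩
    -- Extended by `false`, since `2 * h` can exceed the number of variables by one.
    let a' : ℕ → Bool := fun v => if hv : v < φ.n then a ⟨v, hv⟩ else false
    refine ⟨Nat.ofBits fun t : Fin h => a' t, Nat.ofBits_lt_two_pow _,
      Nat.ofBits fun t : Fin h => a' (h + t), Nat.ofBits_lt_two_pow _,
      (key2 a _ (Nat.ofBits_lt_two_pow _) _ (Nat.ofBits_lt_two_pow _) ?_).mp ha⟩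
    intro v
    have hv := v.2
    rcases hdiv v with ⟨e1, e2⟩ | ⟨e1, e2⟩
    · rw [if_pos e2, Nat.mod_eq_of_lt e2, Nat.testBit_ofBits_lt _ _ e2]
      simp [a']
    · have e3 : v.val % h = v.val - h := by
        rw [Nat.mod_eq_sub_mod (by omega), Nat.mod_eq_of_lt (by omega)]
      rw [if_neg e2, e3, Nat.testBit_two_pow_add_gt (by omega), Nat.testBit_ofBits_lt _ _ (by omega)]
      simp [a', Nat.add_sub_cancel' (not_lt.mp e2)]
  · rintro ⟨i, hi, j, hj, hs⟩
    exact ⟨fun v => (if v.val < h then i else 2 ^ h + j).testBit (v.val % h),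
      (key2 _ i hi j hj fun v => rfl).mpr hs⟩

theorem Runs.satCmd {B k W t : ℕ} {φ : KCNF k} {h N d : ℕ} {directed weighted : Bool} {P : Prog}
    {s' : Mem} (hh : h = (φ.n + 1) / 2) (hN : N = 2 ^ h) (hd : d = φ.clauses.length)
    (hB : 6 * ((2 * N + d + 2) * (d + 2)) + 3 ≤ B) (hlen : ((kSAT k).encode φ).length + 5 ≤ B)
    (hn : φ.n + 1 ≤ B) (hWB : W ≤ B) (hP : P.maxConst ≤ B)
    (hrun : Exec W P (loadInput ((ovGraph N d (unsat φ h) directed).encode fun w => [w])) t s')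
    (hsol : (eccentricities directed weighted).Sol (ovInstance N d (unsat φ h) directed weighted)
      (readOutput s')) :
    Runs B (satCmd directed P) [] (initBanks ((kSAT k).encode φ))
      ((4 * k + 70) * ((2 * N + d + 2) * (d + 2)) + t)
      fun σ => σ 1 0 = 1 ∧ (kSAT k).Sol φ (outWords σ) := by
  have hN0 : 0 < N := by rw [hN]; positivity
  have hDB : d + 2 ≤ B := (Nat.le_mul_of_pos_left _ (by omega : 0 < 2 * N + d + 2)).trans (by omega)
  have hVB : 2 * N + d + 2 ≤ B := (Nat.le_mul_of_pos_right _ (by omega : 0 < d + 2)).trans (by omega)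
  have h1 : loadInput ((kSAT k).encode φ) 1 = φ.n := rfl
  have h2 : loadInput ((kSAT k).encode φ) 2 = d := hd ▸ rfl
  have hshl : 1 <<< ((φ.n + 1) / 2) = N := by rw [hN, hh, Nat.one_shiftLeft]
  refine Runs.time_le (T₁ := 1 + (1 + (1 + (1 + (1 + ((1 + (1 + d * (1 + (1 + ((1 + 2 * N * (1 +
    (1 + k * (1 + (1 + 1) + 1)) + 1)) + 1)) + 1))) +
    ((43 * ((2 * N + d + 2) * (d + 2)) + t) + (1 + 2)))))))) ?_ (by
      have : (2 * N + d + 2) * (d + 2) = 2 * N * d + 4 * N + d * d + 4 * d + 4 := by ring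
      rw [this]
      nlinarith [Nat.zero_le (k * d), Nat.zero_le (k * N), Nat.zero_le (N * d),
        Nat.zero_le (k * (d * d)), Nat.zero_le k])
  refine Runs.letE (by simp; omega) (Runs.letE ?_ (Runs.letE ?_ (Runs.letE (by simp; omega) ?_)))
  · simp [initBanks, h1]; omega
  · simp [initBanks, h1, hshl]; omega
  simp only [Ex.val_add, Ex.val_div, Ex.val_a, Ex.val_v, Ex.val_ofNat, List.getD_cons_zero,
    Ex.val_shl, initBanks, Function.update_self, h1, h2, hshl]
  refine Runs.seq (Runs.store (by simp) (by simp; omega) (Runs.seq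
    (Runs.letE (by simp; omega) ((Runs.satMatrixCmd (φ := φ) hd hN0 (by omega) hlen (by simp) (by simp)
      (by simp)).mono le_rfl ?_))))
  rintro _ ⟨m, p, rfl, hm⟩
  rw [← hh]
  refine Runs.seq ((Runs.ovFindCmd (weighted := weighted) hN0 hB hWB hP (by simp) (by simp)
    (by simpa [← hh] using hm) hrun hsol).mono le_rfl ?_)
  rintro _ ⟨m', g, rfl, -, hg1, hg2⟩
  have hsat := satisfiable_iff φ (h := h) (by omega)
  rw [← hN, ← hd] at hsat
  refine Runs.ite (by simp) ?_ ?_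
  · intro hval
    simp only [Ex.val_a, Ex.val_ofNat, Function.update_self] at hval
    obtain ⟨i, hi, -, j, hj, hc⟩ := hg2 hval
    refine Runs.push (L := []) (by simp) (by simp; omega) (by simp; omega) ⟨by simp [loadInput], ?_⟩
    rw [outWords_of_loadInput (L := [1]) (by simp)]
    change _ = [_]
    rw [if_pos (hsat.mpr ⟨i, hi, j, hj, hc⟩)]
  · intro hval
    simp only [Ex.val_a, Ex.val_ofNat, Function.update_self] at hval
    refine Runs.push (L := []) (by simp) (by simp) (by simp; omega) ⟨by simp [loadInput], ?_⟩
    rw [outWords_of_loadInput (L := [0]) (by simp)]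
    change _ = [_]
    rw [if_neg fun hs => ?_]
    obtain ⟨i, hi, j, hj, hc⟩ := hsat.mp hs
    obtain ⟨c, hc', hc''⟩ := hg1 hval i hi j hj
    exact hc c hc' hc''

/-! ### Growth of time bounds -/

/-- Unfolds the filter: `log m / log n` is close to 1 once `m ≤ n ^ (1 + η)` and `n` is large,
because the lower bound is automatic from `n ≤ m + 1`. -/
theorem eventually_sparseLimit {p : ℕ × ℕ → Prop} (h : ∀ᶠ x in sparseLimit, p x) :
    ∃ η > (0 : ℝ), ∃ n₀ : ℕ, ∀ m n : ℕ, n₀ ≤ n → n ≤ m + 1 → (m : ℝ) ≤ (n : ℝ) ^ (1 + η) →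
      p (m, n) := by
  have hb := (((atTop_basis (α := ℕ)).comap (Prod.snd (α := ℕ))).inf
    ((Metric.nhds_basis_ball (x := (1 : ℝ))).comap
      fun p : ℕ × ℕ => Real.log p.1 / Real.log p.2)).inf
    (hasBasis_principal {p : ℕ × ℕ | p.2 ≤ p.1 + 1})
  obtain ⟨⟨⟨n₁, ε⟩, u⟩, ⟨⟨htriv, hε⟩, htriv'⟩, hs⟩ := hb.eventually_iff.mp h
  simp only at hε hs
  -- From `n ≤ 2 * m` one gets `log m ≥ log n - log 2`, so the quotient exceeds `1 - ε` as soon as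
  -- `log n > log 2 / ε`.
  obtain ⟨n₂, hn₂⟩ := eventually_atTop.mp ((Real.tendsto_log_atTop.comp
    tendsto_natCast_atTop_atTop).eventually_gt_atTop (Real.log 2 / ε))
  refine ⟨ε / 2, by positivity, n₁ + n₂ + 2, fun m n hn hmn hm => hs ?_⟩
  have h1 := hn₂ n (by omega)
  simp only [Function.comp] at h1
  rw [div_lt_iff₀ hε] at h1
  have hn2 : (2 : ℝ) ≤ n := by exact_mod_cast (by omega : 2 ≤ n)
  have hm1 : (1 : ℝ) ≤ m := by exact_mod_cast (by omega : 1 ≤ m)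
  have hln : 0 < Real.log n := Real.log_pos (by linarith)
  have hnm : (n : ℝ) ≤ 2 * m := by exact_mod_cast (by omega : n ≤ 2 * m)
  refine ⟨⟨by simp; omega, ?_⟩, hmn⟩
  simp only [Set.mem_preimage, Metric.mem_ball, Real.dist_eq]
  rw [abs_lt, lt_sub_iff_add_lt, sub_lt_iff_lt_add, lt_div_iff₀ hln, div_lt_iff₀ hln]
  have h2 : Real.log n ≤ Real.log 2 + Real.log m := by
    rw [← Real.log_mul (by norm_num) (by linarith)]
    exact Real.log_le_log (by linarith) hnm
  have h3 : Real.log m ≤ (1 + ε / 2) * Real.log n := by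
    rw [← Real.log_rpow (by linarith)]
    exact Real.log_le_log (by linarith) hm
  constructor
  · nlinarith
  · nlinarith

/-- The dichotomy for the growth exponent: below 2, or at least 2. In the second case `7 / 4` is
just some number below 2 that is large enough for the comparison with `m ^ (3 / 2)`. -/
theorem IsTimeBound.growth_cases {T : ℕ → ℕ → ℝ} (h : IsTimeBound T) :
    (∃ q η : ℝ, 3 / 2 ≤ q ∧ q < 2 ∧ 0 < η ∧ ∃ n₀ : ℕ, ∀ m n : ℕ, n₀ ≤ n → n ≤ m + 1 →
      (m : ℝ) ≤ (n : ℝ) ^ (1 + η) → T m n ≤ (n : ℝ) ^ q) ∨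
    (∃ η > (0 : ℝ), ∃ n₀ : ℕ, ∀ m n : ℕ, n₀ ≤ n → n ≤ m + 1 →
      (m : ℝ) ≤ (n : ℝ) ^ (1 + η) → (n : ℝ) ^ (7 / 4 : ℝ) ≤ T m n) := by
  obtain ⟨hpos, c, hc⟩ := h
  have hlog : ∀ n : ℕ, 2 ≤ n → 0 < Real.log n := fun n hn =>
    Real.log_pos (by exact_mod_cast (by omega : 1 < n))
  have hn0 : ∀ n : ℕ, 2 ≤ n → (0 : ℝ) < n := fun n hn => by exact_mod_cast (by omega : 0 < n)
  by_cases h2 : c < ((2 : ℝ) : EReal)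
  · left
    obtain ⟨q, hq1, hq2⟩ := EReal.lt_iff_exists_real_btwn.mp h2
    obtain ⟨η, hη, n₀, hn⟩ := eventually_sparseLimit (hc.eventually_lt_const hq1)
    -- The exponent is raised to at least `3 / 2` so that the time for building the graphs is
    -- dominated by `V ^ q`.
    refine ⟨max q (3 / 2), η, le_max_right _ _, max_lt (by exact_mod_cast hq2) (by norm_num), hη,
      n₀ + 2, fun m n h1 h2 h3 => ?_⟩
    have h4 := hn m n (by omega) h2 h3
    rw [EReal.coe_lt_coe_iff, div_lt_iff₀ (hlog n (by omega)), ← Real.log_rpow (hn0 n (by omega)),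
      Real.log_lt_log_iff (hpos m n (by omega) h2) (Real.rpow_pos_of_pos (hn0 n (by omega)) _)] at h4
    exact h4.le.trans (Real.rpow_le_rpow_of_exponent_le (by exact_mod_cast (by omega : 1 ≤ n))
      (le_max_left _ _))
  · right
    have h3 : ((7 / 4 : ℝ) : EReal) < c :=
      lt_of_lt_of_le (EReal.coe_lt_coe_iff.mpr (by norm_num)) (not_lt.mp h2)
    obtain ⟨η, hη, n₀, hn⟩ := eventually_sparseLimit (hc.eventually_const_lt h3)
    refine ⟨η, hη, n₀ + 2, fun m n h1 h2 h3 => ?_⟩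
    have h4 := hn m n (by omega) h2 h3
    rw [EReal.coe_lt_coe_iff, lt_div_iff₀ (hlog n (by omega)), ← Real.log_rpow (hn0 n (by omega)),
      Real.log_lt_log_iff (Real.rpow_pos_of_pos (hn0 n (by omega)) _)
        (hpos m n (by omega) h2)] at h4
    exact h4.le

theorem exists_nat_rpow_ge (K : ℝ) {a : ℝ} (ha : 0 < a) : ∃ n₀ : ℕ, ∀ n ≥ n₀, K ≤ (n : ℝ) ^ a :=
  eventually_atTop.mp (((tendsto_rpow_atTop ha).comp
    tendsto_natCast_atTop_atTop).eventually_ge_atTop K)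

theorem exists_bound (F : ℕ → ℕ → ℝ) (a b : ℕ) :
    ∃ C : ℝ, 0 < C ∧ ∀ m n : ℕ, m ≤ a → n ≤ b → F m n ≤ C := by
  refine ⟨1 + ∑ p ∈ Finset.range (a + 1) ×ˢ Finset.range (b + 1), |F p.1 p.2|, by positivity,
    fun m n hm hn => ?_⟩
  have := Finset.single_le_sum (f := fun p : ℕ × ℕ => |F p.1 p.2|)
    (s := Finset.range (a + 1) ×ˢ Finset.range (b + 1)) (fun _ _ => abs_nonneg _)
    (a := (m, n)) (by simp; omega)
  have := le_abs_self (F m n)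
  simp only at *
  linarith

/-- For large `n` the exponents decide: with `η ≤ 1 / 20`, the product `(1 + η) * (3 / 2 + 1 / 20)`
stays below `7 / 4`. What remains are finitely many pairs `(m, n)`, since `m` is bounded in terms of
`n`; there the positivity of `T` gives a constant. -/
theorem isSmallerForSparse_of_growth {T : ℕ → ℕ → ℝ}
    (hpos : ∀ m n : ℕ, 2 ≤ n → n ≤ m + 1 → 0 < T m n)
    (h : ∃ η > (0 : ℝ), ∃ n₀ : ℕ, ∀ m n : ℕ, n₀ ≤ n → n ≤ m + 1 →
      (m : ℝ) ≤ (n : ℝ) ^ (1 + η) → (n : ℝ) ^ (7 / 4 : ℝ) ≤ T m n) :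
    IsSmallerForSparse (fun m _ => (m : ℝ) ^ (3 / 2 : ℝ)) T := by
  obtain ⟨η', hη', n₀, hn₀⟩ := h
  set η := min η' (1 / 20) with hη
  have hη0 : 0 < η := lt_min hη' (by norm_num)
  have hη1 : η ≤ 1 / 20 := min_le_right _ _
  -- Halving `η` leaves room for the factor `K`, which is at most `n ^ (η / 2)` for large `n`.
  refine ⟨η / 2, 1 / 20, by positivity, by norm_num, fun K hK => ?_⟩
  obtain ⟨n₁, hn₁⟩ := exists_nat_rpow_ge K (half_pos hη0)
  obtain ⟨C, hC0, hC⟩ := exists_bound (fun m n => (m : ℝ) ^ (3 / 2 : ℝ) * (m : ℝ) ^ (1 / 20 : ℝ) /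
    T m n) ⌈K * ((n₀ + n₁ : ℕ) : ℝ) ^ (1 + η / 2)⌉₊ (n₀ + n₁)
  refine ⟨C + 1, by positivity, fun m n hn hmn hm => ?_⟩
  have hm1 : (1 : ℝ) ≤ m := by exact_mod_cast (by omega : 1 ≤ m)
  have hn1 : (1 : ℝ) ≤ n := by exact_mod_cast (by omega : 1 ≤ n)
  have hT := hpos m n hn hmn
  have hme : 0 < (m : ℝ) ^ (1 / 20 : ℝ) := by positivity
  suffices hmain : (m : ℝ) ^ (3 / 2 : ℝ) * (m : ℝ) ^ (1 / 20 : ℝ) ≤ (C + 1) * T m n by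
    rw [← le_div_iff₀ hme] at hmain
    refine hmain.trans_eq ?_
    field_simp
  by_cases hlarge : n₀ + n₁ ≤ n
  · have h1 : (m : ℝ) ≤ (n : ℝ) ^ (1 + η) := by
      refine hm.trans ?_
      calc K * (n : ℝ) ^ (1 + η / 2) ≤ (n : ℝ) ^ (η / 2) * (n : ℝ) ^ (1 + η / 2) := by
            gcongr; exact hn₁ n (by omega)
        _ = (n : ℝ) ^ (1 + η) := by rw [← Real.rpow_add (by linarith)]; congr 1; ring
    have h2 := hn₀ m n (by omega) hmn (h1.trans (Real.rpow_le_rpow_of_exponent_le hn1 (by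
      have := min_le_left η' (1 / 20); linarith)))
    calc (m : ℝ) ^ (3 / 2 : ℝ) * (m : ℝ) ^ (1 / 20 : ℝ) = (m : ℝ) ^ (31 / 20 : ℝ) := by
          rw [← Real.rpow_add (by linarith)]; norm_num
      _ ≤ ((n : ℝ) ^ (1 + η)) ^ (31 / 20 : ℝ) := by gcongr
      _ = (n : ℝ) ^ ((1 + η) * (31 / 20)) := by rw [Real.rpow_mul (by linarith)]
      _ ≤ (n : ℝ) ^ (7 / 4 : ℝ) := Real.rpow_le_rpow_of_exponent_le hn1 (by linarith)
      _ ≤ T m n := h2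
      _ ≤ (C + 1) * T m n := by nlinarith
  · have h1 := hC m n (by
      refine Nat.cast_le.mp (hm.trans (le_trans ?_ (Nat.le_ceil _)))
      gcongr
      omega) (by omega)
    rw [div_le_iff₀ hT] at h1
    nlinarith

/-! ### Eccentricities of the graphs for orthogonal vectors -/

/-- The bound that a sub-quadratic time bound gives for the graphs with `V` vertices and at most
`2 * V * D` edges. -/
theorem exists_time_bound {T' : ℕ → ℕ → ℝ} {q η : ℝ} {n₀ : ℕ} (hη : 0 < η)
    (h : ∀ m n : ℕ, n₀ ≤ n → n ≤ m + 1 → (m : ℝ) ≤ (n : ℝ) ^ (1 + η) → T' m n ≤ (n : ℝ) ^ q)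
    (A : ℝ) :
    ∃ K : ℕ, ∀ (V D : ℕ) (T : ℝ), 0 < D → D ≤ V → 1 ≤ T → ((V * D : ℕ) : ℝ) ≤ A * T →
      (V : ℝ) ^ q ≤ A * T → (D : ℝ) ≤ A * (V : ℝ) ^ (η / 2) →
      ∀ m, m ≤ 2 * (V * D) → V ≤ m + 1 → T' m V ≤ K * T ∧ ((V * D : ℕ) : ℝ) ≤ K * T := by
  obtain ⟨n₁, hn₁⟩ := exists_nat_rpow_ge (2 * A) (half_pos hη)
  -- The hypothesis says nothing about fewer than `n₀` vertices, and the edge bound needs `V ^ (η /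
  -- 2) ≥ 2 * A`. The remaining graphs have `V ≤ n₀ + n₁` and `m ≤ 2 * V * D ≤ 2 * V ^ 2`, so `T'`
  -- is bounded on them.
  obtain ⟨C, hC0, hC⟩ := exists_bound T' (2 * ((n₀ + n₁) * (n₀ + n₁))) (n₀ + n₁)
  refine ⟨⌈A⌉₊ + ⌈C⌉₊, fun V D T hD hDV hT h1 h2 h3 m hm hV => ?_⟩
  have e1 : A * T ≤ ((⌈A⌉₊ + ⌈C⌉₊ : ℕ) : ℝ) * T := by
    have := Nat.le_ceil A
    have : (0 : ℝ) ≤ (⌈C⌉₊ : ℝ) := by positivity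
    push_cast
    gcongr
    linarith
  have e2 : C ≤ ((⌈A⌉₊ + ⌈C⌉₊ : ℕ) : ℝ) * T := by
    have := Nat.le_ceil C
    have : (0 : ℝ) ≤ (⌈A⌉₊ : ℝ) := by positivity
    push_cast
    nlinarith
  refine ⟨?_, h1.trans e1⟩
  by_cases hlarge : n₀ + n₁ ≤ V
  · refine (h m V (by omega) hV ?_).trans (h2.trans e1)
    have hV0 : (0 : ℝ) < V := by exact_mod_cast (by omega : 0 < V)
    calc (m : ℝ) ≤ ((2 * (V * D) : ℕ) : ℝ) := Nat.cast_le.mpr hm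
      _ = V * (2 * D) := by push_cast; ring
      _ ≤ V * (2 * A * (V : ℝ) ^ (η / 2)) := mul_le_mul_of_nonneg_left (by linarith) hV0.le
      _ ≤ V * ((V : ℝ) ^ (η / 2) * (V : ℝ) ^ (η / 2)) := by gcongr; exact hn₁ V (by omega)
      _ = (V : ℝ) ^ (1 + η) := by
        rw [← Real.rpow_add hV0, add_halves, Real.rpow_add hV0, Real.rpow_one]
  · refine (hC m V (hm.trans ?_) (by omega)).trans e2
    gcongr <;> omega

/-- Constant factors are absorbed into the exponent: `c ≤ 2 ^ c ≤ Z ^ c`. -/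
theorem le_pow_of_le_mul {Z a c : ℕ} (hZ : 2 ≤ Z) (h : a ≤ c * Z) : a ≤ Z ^ (c + 1) := by
  rw [pow_succ]
  refine h.trans (Nat.mul_le_mul_right _ ?_)
  exact (Nat.lt_two_pow_self).le.trans (Nat.pow_le_pow_left hZ c)

theorem foldr_max_le {l : List ℕ} {b : ℕ} (h : ∀ x ∈ l, x ≤ b) : l.foldr max 0 ≤ b := by
  induction l with
  | nil => simp
  | cons a l ih =>
    simp only [List.mem_cons, forall_eq_or_imp] at h
    exact max_le h.1 (ih h.2)

theorem inputSize_ovGraph_le (N d : ℕ) (f : ℕ → ℕ → Prop) (directed : Bool) :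
    inputSize ((ovGraph N d f directed).encode fun w => [w]) ≤
      12 * ((2 * N + d + 2) * (d + 2)) := by
  have h1 := length_edges_le (N := N) (d := d) (f := f) directed
  have hV : 2 * N + d + 2 ≤ (2 * N + d + 2) * (d + 2) := Nat.le_mul_of_pos_right _ (by omega)
  have h4 : 4 ≤ (2 * N + d + 2) * (d + 2) := by nlinarith
  have hw : ∀ e ∈ (ovGraph N d f directed).edges, e.2.2 = 1 := fun e he =>
    ((ovGraph_arc (x := e.1) (y := e.2.1) (w := e.2.2)).mp (Or.inl he)).1
  have h2 : ((ovGraph N d f directed).encode fun w => [w]).foldr max 0 ≤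
      2 * ((2 * N + d + 2) * (d + 2)) := by
    refine foldr_max_le fun x hx => ?_
    simp only [EdgeList.encode, List.mem_cons, List.mem_flatMap, List.not_mem_nil, or_false] at hx
    rcases hx with rfl | rfl | ⟨e, he, rfl | rfl | rfl⟩
    · omega
    · exact h1
    · have : e.1.val < 2 * N + d + 2 := e.1.2
      omega
    · have : e.2.1.val < 2 * N + d + 2 := e.2.1.2
      omega
    · rw [hw e he]; omega
  rw [inputSize, length_encode _ _ 1 (fun _ => rfl)]
  omega

/-- The assumed algorithm on the graph of the set families, with time and word size expressed by the
parameters of the original problem. The input size is at most `12 * K * Z` and the rounded time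
bound at most `K * Z`, whence the factor 13 in the exponent. -/
theorem exists_exec_ov {directed weighted : Bool} {T' : ℕ → ℕ → ℝ} {P : Prog} {C₀ : ℕ}
    (hP : ∀ x : (eccentricities directed weighted).Inst, ∃ (t : ℕ) (s : Mem),
      Exec ((inputSize ((eccentricities directed weighted).encode x) +
        ⌈T' ((eccentricities directed weighted).numEdges x)
          ((eccentricities directed weighted).numVerts x)⌉₊) ^ C₀) P
        (loadInput ((eccentricities directed weighted).encode x)) t s ∧
      (t : ℝ) ≤ C₀ * T' ((eccentricities directed weighted).numEdges x)
        ((eccentricities directed weighted).numVerts x) ∧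
      (eccentricities directed weighted).Sol x (readOutput s))
    {N d : ℕ} (hN : 0 < N) (f : ℕ → ℕ → Prop) {K Z : ℕ} {T : ℝ} (hZ : 2 ≤ Z) (hTZ : ⌈T⌉₊ ≤ Z)
    (h : ∀ m, m ≤ 2 * ((2 * N + d + 2) * (d + 2)) → 2 * N + d + 2 ≤ m + 1 →
      T' m (2 * N + d + 2) ≤ K * T ∧ (((2 * N + d + 2) * (d + 2) : ℕ) : ℝ) ≤ K * T) :
    ∃ W t s', W ≤ Z ^ ((13 * K + 1) * C₀) ∧
      Exec W P (loadInput ((ovGraph N d f directed).encode fun w => [w])) t s' ∧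
      (t : ℝ) ≤ C₀ * (K * T) ∧
      (eccentricities directed weighted).Sol (ovInstance N d f directed weighted)
        (readOutput s') := by
  obtain ⟨t, s, h1, h2, h3⟩ := hP (ovInstance N d f directed weighted)
  obtain ⟨e1, e2⟩ := h (ovGraph N d f directed).edges.length (length_edges_le directed)
    (le_length_edges hN directed)
  refine ⟨_, t, s, ?_, h1, ?_, h3⟩
  · rw [pow_mul]
    refine Nat.pow_le_pow_left (le_pow_of_le_mul hZ ?_) _
    have hKT : (K : ℝ) * T ≤ ((K * Z : ℕ) : ℝ) := by
      push_cast
      gcongr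
      exact Nat.ceil_le.mp hTZ
    have h4 : (2 * N + d + 2) * (d + 2) ≤ K * Z := by exact_mod_cast e2.trans hKT
    have h5 : ⌈T' (ovGraph N d f directed).edges.length (2 * N + d + 2)⌉₊ ≤ K * Z :=
      Nat.ceil_le.mpr (e1.trans hKT)
    have h6 := inputSize_ovGraph_le N d f directed
    change inputSize ((ovGraph N d f directed).encode fun w => [w]) +
      ⌈T' (ovGraph N d f directed).edges.length (2 * N + d + 2)⌉₊ ≤ _
    nlinarith
  · exact h2.trans (by gcongr; exact e1)

/-! ### The reduction from satisfiability -/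

/-- A clause is a list of at most `k` literals, so it is determined by its first `k` optional
entries, each of which has `2 * n + 1` possible values. -/
theorem KCNF.length_clauses_le {k : ℕ} (φ : KCNF k) : φ.clauses.length ≤ (2 * φ.n + 1) ^ k := by
  have h := (φ.nodup.map_on (f := fun (l : List (Fin φ.n × Bool)) (i : Fin k) => l[i.val]?) ?_)
  · have h' := h.length_le_card
    simpa [mul_comm] using h'
  · intro c hc c' hc' e
    refine List.ext_getElem? fun i => ?_
    by_cases hi : i < k
    · exact congrFun e ⟨i, hi⟩
    · rw [List.getElem?_eq_none ((φ.width c hc).trans (not_lt.mp hi)),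
        List.getElem?_eq_none ((φ.width c' hc').trans (not_lt.mp hi))]

/-- A polynomial is bounded by any exponential, from `x ^ k / k! ≤ exp x` at `x = c * (2 * n + 1)`;
the choice of `c` makes `exp x` equal to `exp c * 2 ^ (κ * n)`. -/
theorem exists_pow_le (k : ℕ) {κ : ℝ} (hκ : 0 < κ) :
    ∃ A : ℝ, 1 ≤ A ∧ ∀ n : ℕ, ((2 * n + 1 : ℕ) : ℝ) ^ k + 2 ≤ A * 2 ^ (κ * n) := by
  set c := κ * Real.log 2 / 2 with hc
  have hc0 : 0 < c := by have := Real.log_pos one_lt_two; positivity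
  have hA : 0 ≤ k.factorial * Real.exp c / c ^ k := by positivity
  refine ⟨k.factorial * Real.exp c / c ^ k + 2, by linarith, fun n => ?_⟩
  have h1 := Real.pow_div_factorial_le_exp (c * (2 * n + 1 : ℕ)) (by positivity) k
  rw [div_le_iff₀ (by positivity), mul_pow, mul_comm, ← le_div_iff₀ (by positivity)] at h1
  have h2 : Real.exp (c * (2 * n + 1 : ℕ)) = Real.exp c * 2 ^ (κ * n) := by
    rw [Real.rpow_def_of_pos two_pos, ← Real.exp_add, hc]
    congr 1
    push_cast
    ring
  have h3 : (1 : ℝ) ≤ 2 ^ (κ * n) := Real.one_le_rpow (by norm_num) (by positivity)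
  rw [h2] at h1
  calc ((2 * n + 1 : ℕ) : ℝ) ^ k + 2 ≤ Real.exp c * 2 ^ (κ * n) * k.factorial / c ^ k +
        2 * 2 ^ (κ * n) := by linarith
    _ = _ := by ring

theorem length_kSAT_encode_le {k : ℕ} (φ : KCNF k) :
    ((kSAT k).encode φ).length ≤ 2 + (2 * k + 1) * φ.clauses.length := by
  rw [kSAT_encode, List.length_cons, List.length_cons, List.length_flatMap]
  have := List.sum_le_card_nsmul (φ.clauses.map fun c => (clauseWords c).length) (2 * k + 1) (by
    simp only [List.mem_map]
    rintro _ ⟨c, hc, rfl⟩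
    have := φ.width c hc
    rw [length_clauseWords]
    omega)
  rw [List.length_map, smul_eq_mul, mul_comm] at this
  omega

/-- The graph has about `2 ^ (n / 2)` vertices, so time `V ^ q` becomes `2 ^ (q * n / 2)` up to a
constant. The exponent `δ` depends on `q` only and not on the clause width, as the negation of SETH
requires. -/
theorem not_SETH_of_hasAlgorithm {directed weighted : Bool} {T' : ℕ → ℕ → ℝ} {q η : ℝ} {n₀ : ℕ}
    (hq : 3 / 2 ≤ q) (hq2 : q < 2) (hη : 0 < η)
    (h : ∀ m n : ℕ, n₀ ≤ n → n ≤ m + 1 → (m : ℝ) ≤ (n : ℝ) ^ (1 + η) → T' m n ≤ (n : ℝ) ^ q)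
    (halg : HasAlgorithm (eccentricities directed weighted) T') : ¬ SETH := by
  intro hS
  -- `(q + 2) / 4` is the midpoint of `q / 2` and 1.
  obtain ⟨k, hk⟩ := hS ((q + 2) / 4) (by linarith)
  refine hk ?_
  obtain ⟨P, C₀, hP⟩ := halg
  set δ := (q + 2) / 4 with hδ
  set κ := min (η / 4) (1 / 16) with hκ
  have hκ0 : 0 < κ := lt_min (by linarith) (by norm_num)
  have hκ1 : κ ≤ η / 4 := min_le_left _ _
  have hκ2 : κ ≤ 1 / 16 := min_le_right _ _
  obtain ⟨A, hA1, hA⟩ := exists_pow_le k hκ0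
  obtain ⟨K, hK⟩ := exists_time_bound hη h ((4 + A) ^ 2)
  have hT : ∀ φ : KCNF k, (1 : ℝ) ≤ 2 ^ (δ * φ.n) := fun φ =>
    Real.one_le_rpow (by norm_num) (by positivity)
  have key : ∀ φ : KCNF k, ∀ m,
      m ≤ 2 * ((2 * 2 ^ ((φ.n + 1) / 2) + φ.clauses.length + 2) * (φ.clauses.length + 2)) →
      2 * 2 ^ ((φ.n + 1) / 2) + φ.clauses.length + 2 ≤ m + 1 →
      T' m (2 * 2 ^ ((φ.n + 1) / 2) + φ.clauses.length + 2) ≤ K * 2 ^ (δ * φ.n) ∧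
      (((2 * 2 ^ ((φ.n + 1) / 2) + φ.clauses.length + 2) * (φ.clauses.length + 2) : ℕ) : ℝ) ≤
        K * 2 ^ (δ * φ.n) := by
    intro φ
    set n := φ.n with hn
    set d := φ.clauses.length with hd
    set N := 2 ^ ((n + 1) / 2) with hN
    have hD : ((d + 2 : ℕ) : ℝ) ≤ A * 2 ^ (κ * n) := by
      refine le_trans ?_ (hA n)
      have := φ.length_clauses_le
      exact_mod_cast Nat.add_le_add_right this 2
    have hN1 : (2 : ℝ) ^ ((n : ℝ) / 2) ≤ N := by
      rw [hN, Nat.cast_pow, Nat.cast_ofNat, ← Real.rpow_natCast]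
      refine Real.rpow_le_rpow_of_exponent_le (by norm_num) ?_
      rw [div_le_iff₀ two_pos]
      exact_mod_cast (by omega : n ≤ (n + 1) / 2 * 2)
    have hN2 : (N : ℝ) ≤ 2 * (2 : ℝ) ^ ((n : ℝ) / 2) := by
      rw [hN, Nat.cast_pow, Nat.cast_ofNat, ← Real.rpow_natCast, mul_comm,
        ← Real.rpow_add_one two_ne_zero]
      refine Real.rpow_le_rpow_of_exponent_le (by norm_num) ?_
      have : (((n + 1) / 2 : ℕ) : ℝ) * 2 ≤ n + 1 := by
        exact_mod_cast Nat.div_mul_le_self _ _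
      linarith
    have hexp : ∀ a b : ℝ, a ≤ b → (2 : ℝ) ^ (a * n) ≤ 2 ^ (b * n) := fun a b hab =>
      Real.rpow_le_rpow_of_exponent_le (by norm_num) (by gcongr)
    have hhalf : (2 : ℝ) ^ ((n : ℝ) / 2) = 2 ^ (1 / 2 * (n : ℝ)) := by congr 1; ring
    have hV : ((2 * N + d + 2 : ℕ) : ℝ) ≤ (4 + A) * 2 ^ (1 / 2 * (n : ℝ)) := by
      have := mul_le_mul_of_nonneg_left (hexp κ (1 / 2) (by linarith)) (by linarith : 0 ≤ A)
      rw [← hhalf] at this ⊢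
      push_cast at hD ⊢
      linarith
    have hV1 : (2 : ℝ) ^ (1 / 2 * (n : ℝ)) ≤ ((2 * N + d + 2 : ℕ) : ℝ) := by
      rw [← hhalf]
      push_cast
      have : (0 : ℝ) ≤ d := by positivity
      have : (0 : ℝ) ≤ N := by positivity
      linarith
    -- Three comparisons of exponents remain: `1 / 2 + κ ≤ δ` for the size of the graph, `q / 2 ≤ δ`
    -- for the running time, and `κ ≤ η / 4` for sparsity, where `2 ^ (n / 2) ≤ V`.
    refine hK (2 * N + d + 2) (d + 2) _ (by omega) (by omega) (hT φ) ?_ ?_ ?_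
    · calc (((2 * N + d + 2) * (d + 2) : ℕ) : ℝ)
          ≤ ((4 + A) * 2 ^ (1 / 2 * (n : ℝ))) * (A * 2 ^ (κ * n)) := by
            rw [Nat.cast_mul]; gcongr
        _ = ((4 + A) * A) * 2 ^ ((1 / 2 + κ) * n) := by
            rw [add_mul (1 / 2) κ, Real.rpow_add two_pos]; ring
        _ ≤ (4 + A) ^ 2 * 2 ^ (δ * n) := by
            gcongr
            · nlinarith
            · exact one_le_two
            · linarith
    · calc ((2 * N + d + 2 : ℕ) : ℝ) ^ q ≤ ((4 + A) * 2 ^ (1 / 2 * (n : ℝ))) ^ q := by gcongr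
        _ = (4 + A) ^ q * 2 ^ (q / 2 * n) := by
            rw [Real.mul_rpow (by positivity) (by positivity), ← Real.rpow_mul two_pos.le]
            congr 2; ring
        _ ≤ (4 + A) ^ (2 : ℝ) * 2 ^ (δ * n) := by
            gcongr
            · linarith
            · exact one_le_two
            · linarith
        _ = _ := by norm_cast
    · calc ((d + 2 : ℕ) : ℝ) ≤ A * 2 ^ (κ * n) := hD
        _ ≤ (4 + A) ^ 2 * 2 ^ (η / 4 * n) :=
            mul_le_mul (by nlinarith) (hexp _ _ hκ1) (by positivity) (by positivity)
        _ = (4 + A) ^ 2 * ((2 : ℝ) ^ (1 / 2 * (n : ℝ))) ^ (η / 2) := by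
            rw [← Real.rpow_mul two_pos.le]
            congr 2; ring
        _ ≤ _ := by gcongr
  have hVD : ∀ φ : KCNF k, (((2 * 2 ^ ((φ.n + 1) / 2) + φ.clauses.length + 2) *
      (φ.clauses.length + 2) : ℕ) : ℝ) ≤ K * 2 ^ (δ * φ.n) := fun φ => by
    have := key φ _ (Nat.le_mul_of_pos_left _ two_pos) (by
      have : 2 * 2 ^ ((φ.n + 1) / 2) + φ.clauses.length + 2 ≤
        (2 * 2 ^ ((φ.n + 1) / 2) + φ.clauses.length + 2) * (φ.clauses.length + 2) :=
        Nat.le_mul_of_pos_right _ (by omega)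
      omega)
    exact this.2
  -- A single constant covers, in this order, the words of the subroutine, the sizes of the tables,
  -- the constants in the subroutine, the running time and the input length.
  obtain ⟨C, h1, h2, h3, h4, h5⟩ : ∃ C : ℕ, (13 * K + 1) * C₀ ≤ C ∧ 6 * K + 10 ≤ C ∧
      P.maxConst + 10 ≤ C ∧ (4 * k + 70) * K + C₀ * K ≤ C ∧ (2 * k + 3) * K ≤ C :=
    ⟨(13 * K + 1) * C₀ + (6 * K + 10) + (P.maxConst + 10) + ((4 * k + 70) * K + C₀ * K) +
      (2 * k + 3) * K, by omega, by omega, by omega, by omega, by omega⟩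
  refine solvableInTime_of_runs (satCmd directed P) C (by omega) hT (fun φ => ?_) fun φ => ?_
  · have e := length_kSAT_encode_le φ
    have e' : ((kSAT k).encode φ).length ≤ (2 * k + 3) *
        ((2 * 2 ^ ((φ.n + 1) / 2) + φ.clauses.length + 2) * (φ.clauses.length + 2)) := by
      nlinarith [Nat.zero_le (2 ^ ((φ.n + 1) / 2) * (φ.clauses.length + 2)), Nat.zero_le
        (k * (2 ^ ((φ.n + 1) / 2) * (φ.clauses.length + 2))), Nat.zero_le (k * φ.clauses.length),
        Nat.zero_le (k * (φ.clauses.length * φ.clauses.length))]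
    calc (((kSAT k).encode φ).length : ℝ) ≤ ((2 * k + 3 : ℕ) : ℝ) * (((2 * 2 ^ ((φ.n + 1) / 2) +
          φ.clauses.length + 2) * (φ.clauses.length + 2) : ℕ) : ℝ) := by exact_mod_cast e'
      _ ≤ ((2 * k + 3 : ℕ) : ℝ) * (K * 2 ^ (δ * φ.n)) := by gcongr; exact hVD φ
      _ = (((2 * k + 3) * K : ℕ) : ℝ) * 2 ^ (δ * φ.n) := by push_cast; ring
      _ ≤ C * 2 ^ (δ * φ.n) := by gcongr
  · set Z := inputSize ((kSAT k).encode φ) + ⌈(2 : ℝ) ^ (δ * φ.n)⌉₊ with hZ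
    have hi := two_le_inputSize ((kSAT k).encode φ)
    have hZ2 : 2 ≤ Z := by omega
    have hZC : ∀ a c, a ≤ c * Z → c + 1 ≤ C → a ≤ Z ^ C := fun a c ha hc =>
      (le_pow_of_le_mul hZ2 ha).trans (Nat.pow_le_pow_right (by omega) hc)
    obtain ⟨W, t, s', hW, hrun, ht, hsol⟩ := exists_exec_ov (weighted := weighted) hP
      (N := 2 ^ ((φ.n + 1) / 2)) (d := φ.clauses.length) (by positivity)
      (unsat φ ((φ.n + 1) / 2)) hZ2 (Nat.le_add_left _ _) (key φ)
    have hVDZ : (2 * 2 ^ ((φ.n + 1) / 2) + φ.clauses.length + 2) * (φ.clauses.length + 2) ≤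
        K * Z := by
      have : (K : ℝ) * 2 ^ (δ * φ.n) ≤ ((K * Z : ℕ) : ℝ) := by
        push_cast
        gcongr
        exact (Nat.le_ceil _).trans (by exact_mod_cast Nat.le_add_left _ _)
      exact_mod_cast (hVD φ).trans this
    refine ⟨_, ?_, (Runs.satCmd (weighted := weighted) rfl rfl rfl ?_ ?_ ?_
      (hW.trans (Nat.pow_le_pow_right (by omega) h1)) ?_ hrun hsol).mono le_rfl ?_⟩
    · push_cast
      have e := hVD φ
      push_cast at e
      have h4' : (((4 * k + 70) * K + C₀ * K : ℕ) : ℝ) ≤ C := Nat.cast_le.mpr h4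
      push_cast at h4'
      have e1 := mul_le_mul_of_nonneg_left e (by positivity : (0 : ℝ) ≤ 4 * k + 70)
      have e2 := mul_le_mul_of_nonneg_right h4' (by linarith [hT φ] : (0 : ℝ) ≤ 2 ^ (δ * φ.n))
      nlinarith
    · exact hZC _ (6 * K + 3) (by nlinarith) (by omega)
    · refine hZC _ 5 ?_ (by omega)
      have : ((kSAT k).encode φ).length ≤ inputSize ((kSAT k).encode φ) := by
        rw [inputSize]; omega
      omega
    · refine hZC _ 5 ?_ (by omega)
      have : φ.n ≤ inputSize ((kSAT k).encode φ) :=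
        loadInput_le (x := (kSAT k).encode φ) le_rfl 1
      omega
    · exact hZC _ P.maxConst (Nat.le_mul_of_pos_right _ (by omega)) (by omega)
    · rintro σ ⟨e1, e2⟩
      refine ⟨?_, e2⟩
      rw [e1]
      have : (1 : ℝ) ≤ C := by exact_mod_cast (by omega : 1 ≤ C)
      have := hT φ
      push_cast
      nlinarith

/-! ### Dominating sets -/

/-- The vertex `u` dominates the vertex `v`. -/
def EdgeList.Dominates {α : Type} (G : EdgeList α) (u v : ℕ) : Prop :=
  ∃ (hu : u < G.n) (hv : v < G.n), u = v ∨ G.toSimpleGraph.Adj ⟨u, hu⟩ ⟨v, hv⟩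

/-- The vertex `v` is dominated by no base `n` digit of `u`. -/
def undominated {α : Type} (G : EdgeList α) (h u v : ℕ) : Prop :=
  ∀ t < h, ¬ G.Dominates (u % G.n ^ h / G.n ^ t % G.n) v

/-- Computes the domination relation in the bank 6; the local variables are `h` and the numbers of
edges and vertices. -/
def domAdjCmd : Cmd :=
  .forV 2 (.store 6 (.v 0 * .v 3 + .v 0) 1) ;;
  .forV 1 (.letE (.a 0 (2 * .v 0 + 3)) <| .letE (.a 0 (2 * .v 1 + 4)) <|
    .store 6 (.v 1 * .v 5 + .v 0) 1 ;; .store 6 (.v 0 * .v 5 + .v 1) 1)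

/-- Computes the powers of the number of vertices in the bank 8. -/
def powCmd : Cmd :=
  .store 8 0 1 ;; .forV 0 (.store 8 (.v 0 + 1) (.a 8 (.v 0) * .v 3))

/-- The matrix of the undominated vertices; the local variables are `2 * N`, `n`, `N`, `h`. -/
def domMatrixCmd : Cmd :=
  .forV 0 (.forV 2 (.store 3 (.v 1 * (.v 3 + 2) + .v 0) 1) ;;
    .forV 4 (.letE (.v 1 % .v 4 / .a 8 (.v 0) % .v 3) <|
      .forV 4 (.ite (.a 6 (.v 1 * .v 5 + .v 0)) (.store 3 (.v 3 * (.v 5 + 2) + .v 0) 0) .skip)))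

/-- Finds a set in the second family that is disjoint from the set `i` in the first family; the
local variables are `i`, `d`, `N`. -/
def searchCmd : Cmd :=
  .forV 2 (.store 9 0 1 ;;
    .forV 2 (.ite (.a 3 (.v 2 * (.v 3 + 2) + .v 0))
      (.ite (.a 3 ((.v 4 + .v 1) * (.v 3 + 2) + .v 0)) (.store 9 0 0) .skip) .skip) ;;
    .ite (.a 9 0) (.store 10 0 (.v 0)) .skip)

/-- Adds a vertex to the output unless it is marked, and marks it. -/
def addCmd : Cmd :=
  .ite (.a 7 (.v 0)) .skip (.store 7 (.v 0) 1 ;; .push 1 (.v 0))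

/-- Adds the digits of the local variable `a` to the output. -/
def digitsCmd (a : ℕ) : Cmd :=
  .forV 4 (.letE (.v (a + 1) / .a 8 (.v 0) % .v 3) addCmd)

/-- Adds vertices to the output until there are `k`. -/
def padCmd (k : ℕ) : Cmd :=
  .forV 2 (.ite (.op .lt (.a 1 0) (.c (k + 1))) addCmd .skip)

def domOutCmd (k : ℕ) : Cmd :=
  .letE (.a 5 0 - 1) (searchCmd ;; .letE (.a 10 0) (.push 1 1 ;; digitsCmd 1 ;; digitsCmd 0 ;;
    padCmd k))

def domCmd (h : ℕ) (directed : Bool) (P : Prog) : Cmd :=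
  .letE (.a 0 1) <| .letE (.a 0 2) <| .letE (.c h) <|
    .ite (.op .lt (.v 2) (.c (2 * h))) (.push 1 0) <|
      domAdjCmd ;; powCmd ;; .letE (.a 8 (.v 0)) (.letE (.v 3) (.letE (2 * .v 1) domMatrixCmd ;;
        ovFindCmd directed P ;; .ite (.a 5 0) (domOutCmd (2 * h)) (.push 1 0)))

/-! ### Correctness of the programs for dominating sets -/

section
variable {B n N h : ℕ} {env : List ℕ} {σ : Banks}

theorem exists_digits (hn : 0 < n) (h : ℕ) (a : ℕ → ℕ) (ha : ∀ t < h, a t < n) :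
    ∃ i < n ^ h, ∀ t < h, i / n ^ t % n = a t := by
  induction h generalizing a with
  | zero => exact ⟨0, by simp⟩
  | succ h ih =>
    obtain ⟨i, hi, hd⟩ := ih (fun t => a (t + 1)) fun t ht => ha _ (by omega)
    have h0 := ha 0 (by omega)
    refine ⟨i * n + a 0, by rw [pow_succ]; exact mul_add_lt hi h0, fun t ht => ?_⟩
    rcases t with _ | t
    · simp [Nat.mod_eq_of_lt h0]
    · rw [pow_succ', ← Nat.div_div_eq_div_mul, mul_comm i, Nat.mul_add_div hn,
        Nat.div_eq_of_lt h0, add_zero]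
      exact hd t (by omega)

theorem EdgeList.dominates_iff {α : Type} {G : EdgeList α} {u v : ℕ} :
    G.Dominates u v ↔ (u = v ∧ u < G.n) ∨ ∃ e ∈ G.edges,
      (e.1.val = u ∧ e.2.1.val = v) ∨ (e.1.val = v ∧ e.2.1.val = u) := by
  constructor
  · rintro ⟨hu, hv, h | h⟩
    · exact Or.inl ⟨h, hu⟩
    · rw [toSimpleGraph, SimpleGraph.fromRel_adj] at h
      rcases h with ⟨-, ⟨w, h⟩ | ⟨w, h⟩⟩
      · exact Or.inr ⟨_, h, Or.inl ⟨rfl, rfl⟩⟩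
      · exact Or.inr ⟨_, h, Or.inr ⟨rfl, rfl⟩⟩
  · rintro (⟨rfl, hu⟩ | ⟨e, he, ⟨rfl, rfl⟩ | ⟨rfl, rfl⟩⟩)
    · exact ⟨hu, hu, Or.inl rfl⟩
    · refine ⟨e.1.2, e.2.1.2, ?_⟩
      rw [or_iff_not_imp_left]
      intro h
      rw [toSimpleGraph, SimpleGraph.fromRel_adj]
      exact ⟨fun h' => h (congrArg Fin.val h'), Or.inl ⟨e.2.2, he⟩⟩
    · refine ⟨e.2.1.2, e.1.2, ?_⟩
      rw [or_iff_not_imp_left]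
      intro h
      rw [toSimpleGraph, SimpleGraph.fromRel_adj]
      exact ⟨fun h' => h (congrArg Fin.val h'), Or.inr ⟨e.2.2, he⟩⟩

theorem loadInput_edge {α : Type} {G : EdgeList α} {g : α → List ℕ} {k : ℕ}
    (hg : ∀ a, (g a).length = k) {e : ℕ} (he : e < G.edges.length) :
    loadInput (G.encode g) ((k + 2) * e + 3) = G.edges[e].1 ∧
      loadInput (G.encode g) ((k + 2) * e + 4) = G.edges[e].2.1 := by
  constructor
  · exact getD_flatMap_const (k := k + 2) (r := 0)
      (fun e : Fin G.n × Fin G.n × α => e.1.val :: e.2.1.val :: g e.2.2) G.edges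
      (fun a => by simp [hg]) he (by omega)
  · exact getD_flatMap_const (k := k + 2) (r := 1)
      (fun e : Fin G.n × Fin G.n × α => e.1.val :: e.2.1.val :: g e.2.2) G.edges
      (fun a => by simp [hg]) he (by omega)

theorem Runs.domAdjCmd {G : EdgeList Unit} {m : ℕ} (hn : n = G.n) (hm : m = G.edges.length)
    (hB : n * n + n ≤ B) (hlen : (G.encode fun _ => []).length + 5 ≤ B)
    (h0 : σ 0 = loadInput (G.encode fun _ => [])) (h6 : σ 6 = fun _ => 0) :
    Runs B domAdjCmd (h :: m :: n :: env) σ ((1 + n * (1 + 1)) + (1 + m * (1 + (1 + 2) + 1)))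
      fun σ' => ∃ M, σ' = Function.update σ 6 M ∧ IsMat n M G.Dominates := by
  subst hn
  have hlen' : 2 * m + 7 ≤ B := by
    rw [length_encode _ _ 0 (fun _ => rfl)] at hlen
    omega
  refine Runs.seq (Runs.forV_const (t := 1) (fun k σ' => ∃ M, σ' = Function.update σ 6 M ∧
    IsMat G.n M fun u v => u = v ∧ u < k) ⟨σ 6, by simp, by simp [IsMat, h6]⟩ ?_ ?_)
  · rintro k hk _ ⟨M, rfl, hM⟩
    have hk' : k < G.n := hk
    have := mul_add_lt hk' hk'
    refine Runs.store (by simp; omega) (by simp; omega)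
      ⟨Function.update M (k * G.n + k) 1, by simp, ?_⟩
    refine (hM.set hk' one_ne_zero).congr fun u v _ => ?_
    omega
  rintro _ ⟨M, rfl, hM⟩
  have hM' : IsMat G.n M fun u v => u = v ∧ u < G.n := hM
  refine Runs.forV_const (t := 1 + (1 + 2)) (fun k σ' => ∃ M, σ' = Function.update σ 6 M ∧
    IsMat G.n M fun u v => (u = v ∧ u < G.n) ∨ ∃ e ∈ G.edges.take k,
      (e.1.val = u ∧ e.2.1.val = v) ∨ (e.1.val = v ∧ e.2.1.val = u))
    ⟨M, rfl, hM'.congr fun u v _ => by simp⟩ ?_ ?_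
  · rintro k hk _ ⟨M, rfl, hM⟩
    have hk' : k < m := hk
    have hkG : k < G.edges.length := hm ▸ hk'
    obtain ⟨r1, r2⟩ := loadInput_edge (G := G) (g := fun _ => []) (k := 0) (fun _ => rfl) hkG
    simp only [zero_add] at r1 r2
    have hx : G.edges[k].1.val < G.n := Fin.isLt _
    have hy : G.edges[k].2.1.val < G.n := Fin.isLt _
    have l1 := mul_add_lt hx hy
    have l2 := mul_add_lt hy hx
    refine Runs.letE (by simp; omega) ?_
    have v1 : (Ex.a 0 (2 * .v 0 + 3)).val (k :: h :: m :: G.n :: env) (Function.update σ 6 M) =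
        G.edges[k].1.val := by simp [h0, r1]
    rw [v1]
    refine Runs.letE (by simp; omega) ?_
    have v2 : (Ex.a 0 (2 * .v 1 + 4)).val (G.edges[k].1.val :: k :: h :: m :: G.n :: env)
        (Function.update σ 6 M) = G.edges[k].2.1.val := by simp [h0, r2]
    rw [v2]
    refine Runs.seq (T₁ := 1) (T₂ := 1) (Runs.store (by simp; omega) (by simp; omega)
      (Runs.store (by simp; omega) (by simp; omega) ⟨Function.update (Function.update M
        (G.edges[k].1.val * G.n + G.edges[k].2.1.val) 1)
        (G.edges[k].2.1.val * G.n + G.edges[k].1.val) 1, by simp, ?_⟩))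
    refine ((hM.set hy one_ne_zero).set hx one_ne_zero).congr fun u v _ => ?_
    rw [List.take_add_one, List.getElem?_eq_getElem hkG]
    simp only [Option.toList_some, List.mem_append, List.mem_singleton, or_and_right, exists_or,
      exists_eq_left]
    constructor
    · rintro (((h1 | h1) | ⟨h1, h2⟩) | ⟨h1, h2⟩)
      · exact Or.inl h1
      · exact Or.inr (Or.inl h1)
      · exact Or.inr (Or.inr (Or.inl ⟨h1.symm, h2.symm⟩))
      · exact Or.inr (Or.inr (Or.inr ⟨h2.symm, h1.symm⟩))
    · rintro (h1 | h1 | ⟨h1, h2⟩ | ⟨h1, h2⟩)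
      · exact Or.inl (Or.inl (Or.inl h1))
      · exact Or.inl (Or.inl (Or.inr h1))
      · exact Or.inl (Or.inr ⟨h1.symm, h2.symm⟩)
      · exact Or.inr ⟨h2.symm, h1.symm⟩
  · rintro _ ⟨M, rfl, hM⟩
    refine ⟨M, rfl, hM.congr fun u v _ => ?_⟩
    rw [EdgeList.dominates_iff]
    simp only [List.getD_cons_succ, List.getD_cons_zero, hm, List.take_length]

theorem Runs.powCmd {m : ℕ} (hn : 0 < n) (hB : n ^ h ≤ B) (hB1 : 1 ≤ B) (hh : h ≤ B) :
    Runs B powCmd (h :: m :: n :: env) σ (1 + (1 + h * (1 + 1)))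
      fun σ' => ∃ p, σ' = Function.update σ 8 p ∧ ∀ t ≤ h, p t = n ^ t := by
  refine Runs.seq (Runs.store (by simp) (by simp; omega) ?_)
  refine Runs.forV_const (t := 1) (fun k σ' => ∃ p, σ' = Function.update σ 8 p ∧
    ∀ t ≤ k, p t = n ^ t) ⟨_, rfl, by simp⟩ ?_ (fun σ' => id)
  rintro k hk _ ⟨p, rfl, hp⟩
  have hk' : k < h := hk
  have hpow : n ^ k * n ≤ B := by
    rw [← pow_succ]
    exact (Nat.pow_le_pow_right hn (by omega)).trans hB
  refine Runs.store (by simp; omega) (by simp [hp k le_rfl]; exact hpow)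
    ⟨_, Function.update_idem .., fun t ht => ?_⟩
  by_cases e : t = k + 1
  · subst e; simp [hp k le_rfl, pow_succ]
  · have : t ≤ k := by omega
    simp [Function.update_of_ne e, hp t this]

/-- Row by row, all entries are set to 1 and those of the vertices dominated by some base `n` digit
are cleared. Reduction modulo `N` makes the rows `j` and `N + j` describe the same tuple. The time
is `O(N * h * n)` up to lower order terms. -/
theorem Runs.domMatrixCmd {G : EdgeList Unit} (hn : n = G.n) (hN : N = n ^ h) (hn0 : 0 < n)
    (hB : (2 * N + n + 2) * (n + 2) ≤ B) (h3 : σ 3 = fun _ => 0)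
    (h6 : IsMat n (σ 6) G.Dominates) (h8 : ∀ t ≤ h, σ 8 t = n ^ t) :
    Runs B domMatrixCmd ((2 * N) :: n :: N :: h :: env) σ
      (1 + 2 * N * ((1 + n * (1 + 1)) + (1 + h * (1 + (1 + n * (1 + 1 + 1)) + 1)) + 1))
      fun σ' => ∃ M, σ' = Function.update σ 3 M ∧
        IsMat (n + 2) M fun u v => u < 2 * N ∧ v < n ∧ undominated G h u v := by
  have hDB : n + 2 ≤ B := (Nat.le_mul_of_pos_left _ (by omega : 0 < 2 * N + n + 2)).trans (by omega)
  refine Runs.forV_const (t := (1 + n * (1 + 1)) + (1 + h * (1 + (1 + n * (1 + 1 + 1)) + 1)))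
    (fun k σ' => ∃ M, σ' = Function.update σ 3 M ∧
      IsMat (n + 2) M fun u v => u < k ∧ v < n ∧ undominated G h u v)
    ⟨σ 3, by simp, by simp [IsMat, h3]⟩ ?_ fun σ' => id
  rintro u hu _ ⟨M, rfl, hM⟩
  have hu' : u < 2 * N := hu
  have hidx : ∀ v < n, u * (n + 2) + v ≤ B := fun v hv =>
    ((mul_add_lt (V := 2 * N + n + 2) (by omega) (by omega)).trans_le hB).le
  refine Runs.seq (Runs.forV_const (t := 1) (fun k σ' => ∃ M, σ' = Function.update σ 3 M ∧
      IsMat (n + 2) M fun u' v => (u' < u ∧ v < n ∧ undominated G h u' v) ∨ (u' = u ∧ v < k))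
    ⟨M, rfl, by simpa using hM⟩ ?_ ?_)
  · rintro v hv _ ⟨M, rfl, hM⟩
    have hv' : v < n := hv
    have := hidx v hv'
    refine Runs.store (by simp; omega) (by simp; omega) ⟨_, Function.update_idem .., ?_⟩
    simp only [Function.update_self, Ex.val_add, Ex.val_mul, Ex.val_v, List.getD_cons_zero,
      List.getD_cons_succ, Ex.val_ofNat]
    refine (hM.set (by omega) one_ne_zero).congr fun u' v' _ => ?_
    rw [or_assoc]
    exact or_congr_right (by omega)
  rintro _ ⟨M, rfl, hM⟩
  have hM' : IsMat (n + 2) M fun u' v =>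
    (u' < u ∧ v < n ∧ undominated G h u' v) ∨ (u' = u ∧ v < n) := hM
  refine Runs.forV_const (t := 1 + (1 + n * (1 + 1 + 1)))
    (fun k σ' => ∃ M, σ' = Function.update σ 3 M ∧
      IsMat (n + 2) M fun u' v => (u' < u ∧ v < n ∧ undominated G h u' v) ∨ (u' = u ∧ v < n ∧
        ∀ t < k, ¬ G.Dominates (u % G.n ^ h / G.n ^ t % G.n) v))
    ⟨M, rfl, by simpa using hM'⟩ ?_ ?_
  · rintro t ht _ ⟨M, rfl, hM⟩
    have ht' : t < h := ht
    refine Runs.letE (by simp) ?_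
    have hv : (Ex.v 1 % .v 4 / .a 8 (.v 0) % .v 3).val (t :: u :: (2 * N) :: n :: N :: h :: env)
        (Function.update σ 3 M) = u % G.n ^ h / G.n ^ t % G.n := by
      simp [h8 t ht'.le, hN, hn]
    rw [hv]
    set x := u % G.n ^ h / G.n ^ t % G.n with hx
    have hxn : x < n := by rw [hx, ← hn]; exact Nat.mod_lt _ hn0
    refine Runs.forV_const (t := 1 + 1) (fun k σ' => ∃ M, σ' = Function.update σ 3 M ∧
      IsMat (n + 2) M fun u' v => (u' < u ∧ v < n ∧ undominated G h u' v) ∨ (u' = u ∧ v < n ∧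
        (∀ t' < t, ¬ G.Dominates (u % G.n ^ h / G.n ^ t' % G.n) v) ∧
          (v < k → ¬ G.Dominates x v)))
      ⟨M, rfl, by simpa using hM⟩ ?_ ?_
    · rintro v hv _ ⟨M, rfl, hM⟩
      have hv' : v < n := hv
      have i1 := hidx v hv'
      have i2 : x * n + v ≤ B := by
        refine (mul_add_lt hxn hv').le.trans (le_trans ?_ hB)
        exact Nat.mul_le_mul (by omega) (by omega)
      have hv2 : (Ex.a 6 (.v 1 * .v 5 + .v 0)).val
          (v :: x :: t :: u :: (2 * N) :: n :: N :: h :: env) (Function.update σ 3 M) =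
          σ 6 (x * n + v) := by simp
      refine Runs.ite (by simp; omega) ?_ ?_
      · intro hc
        rw [hv2, h6 x v hv'] at hc
        refine Runs.store (by simp; omega) (by simp) ⟨_, Function.update_idem .., ?_⟩
        simp only [Function.update_self, Ex.val_add, Ex.val_mul, Ex.val_v, List.getD_cons_zero,
          List.getD_cons_succ, Ex.val_ofNat]
        refine (hM.clear (by omega)).congr fun u' v' _ => ?_
        constructor
        · rintro ⟨h1 | ⟨h1, h2, h3, h4⟩, h5⟩
          · exact Or.inl h1
          · exact Or.inr ⟨h1, h2, h3, fun h6 => h4 (by omega)⟩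
        · rintro (h1 | ⟨h1, h2, h3, h4⟩)
          · exact ⟨Or.inl h1, by omega⟩
          · refine ⟨Or.inr ⟨h1, h2, h3, fun h5 => h4 (by omega)⟩, ?_⟩
            rintro ⟨-, rfl⟩
            exact h4 (by omega) hc
      · intro hc
        rw [hv2, ← not_ne_iff, h6 x v hv'] at hc
        refine Runs.skip ⟨M, rfl, hM.congr fun u' v' _ => ?_⟩
        refine or_congr_right (and_congr_right fun _ => and_congr_right fun _ =>
          and_congr_right fun _ => ?_)
        constructor
        · intro h1 h2
          by_cases e : v' = v
          · rwa [e]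
          · exact h1 (by omega)
        · exact fun h1 h2 => h1 (by omega)
    · rintro _ ⟨M, rfl, hM⟩
      refine ⟨M, rfl, hM.congr fun u' v' _ => ?_⟩
      refine or_congr_right (and_congr_right fun _ => and_congr_right fun hv' => ?_)
      have e : v' < (x :: t :: u :: (2 * N) :: n :: N :: h :: env).getD 4 0 := hv'
      simp only [e, forall_true_left, Nat.lt_succ_iff_lt_or_eq, or_imp, forall_and, forall_eq]
      rfl
  · rintro _ ⟨M, rfl, hM⟩
    refine ⟨M, rfl, hM.congr fun u' v' _ => ?_⟩
    constructor
    · rintro (h1 | ⟨rfl, h2, h3⟩)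
      · exact ⟨by omega, h1.2⟩
      · exact ⟨by omega, h2, h3⟩
    · rintro ⟨h1, h2, h3⟩
      by_cases e : u' = u
      · subst e; exact Or.inr ⟨rfl, h2, h3⟩
      · exact Or.inl ⟨by omega, h2, h3⟩

/-- The flag in the bank 9 survives the inner loop iff the two sets are disjoint, and the bank 10
keeps the last successful `j`. Before any success the bank 10 is arbitrary, so the invariant is
conditional on the existence of a `j`. -/
theorem Runs.searchCmd {d i : ℕ} {f : ℕ → ℕ → Prop} (hi : i < N)
    (hB : (2 * N + d + 2) * (d + 2) ≤ B)
    (hM : IsMat (d + 2) (σ 3) (ovBit N d f))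
    (hex : ∃ j < N, ∀ v < d, ¬ (f i v ∧ f (N + j) v)) :
    Runs B searchCmd (i :: d :: N :: env) σ
      (1 + N * (1 + ((1 + d * (1 + (1 + 1) + 1)) + (1 + 1)) + 1))
      fun σ' => ∃ p r, σ' = Function.update (Function.update σ 9 p) 10 r ∧ r 0 < N ∧
        ∀ v < d, ¬ (f i v ∧ f (N + r 0) v) := by
  have hDB : d + 2 ≤ B := (Nat.le_mul_of_pos_left _ (by omega : 0 < 2 * N + d + 2)).trans (by omega)
  have hVB : 2 * N + d + 2 ≤ B := (Nat.le_mul_of_pos_right _ (by omega : 0 < d + 2)).trans (by omega)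
  have hbit : ∀ u < 2 * N, ∀ v < d, (σ 3 (u * (d + 2) + v) ≠ 0 ↔ f u v) := by
    intro u hu v hv
    rw [hM u v (by omega), ovBit]
    constructor
    · have := Nat.zero_le (u / N)
      rintro (h | h | h | h)
      · exact h.2.2
      all_goals omega
    · exact fun h => Or.inl ⟨hu, hv, h⟩
  have hidx : ∀ u < 2 * N, ∀ v < d, u * (d + 2) + v ≤ B := fun u hu v hv =>
    ((mul_add_lt (V := 2 * N + d + 2) (by omega) (by omega)).trans_le hB).le
  refine Runs.forV_const (t := 1 + ((1 + d * (1 + (1 + 1) + 1)) + (1 + 1)))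
    (fun k σ' => ∃ p r, σ' = Function.update (Function.update σ 9 p) 10 r ∧
      ((∃ j < k, ∀ v < d, ¬ (f i v ∧ f (N + j) v)) → r 0 < N ∧
        ∀ v < d, ¬ (f i v ∧ f (N + r 0) v)))
    ⟨σ 9, σ 10, by simp, by simp⟩ ?_ ?_
  · rintro j hj _ ⟨p, r, rfl, hr⟩
    have hj' : j < N := hj
    refine Runs.seq (Runs.store (by simp) (by simp; omega) (Runs.seq (Runs.forV_const
      (t := 1 + (1 + 1)) (fun k σ' => ∃ p, σ' = Function.update (Function.update σ 9 p) 10 r ∧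
        (p 0 ≠ 0 ↔ ∀ v < k, ¬ (f i v ∧ f (N + j) v)))
      ⟨Function.update p 0 1, by simp [Function.update_comm], by simp⟩ ?_ ?_)))
    · rintro v hv _ ⟨p, rfl, hp⟩
      have hv' : v < d := hv
      have i1 := hidx i (by omega) v hv'
      have i2 := hidx (N + j) (by omega) v hv'
      have b1 := hbit i (by omega) v hv'
      have b2 := hbit (N + j) (by omega) v hv'
      have hstep : (∀ v' < v + 1, ¬ (f i v' ∧ f (N + j) v')) ↔
          (∀ v' < v, ¬ (f i v' ∧ f (N + j) v')) ∧ ¬ (f i v ∧ f (N + j) v) := by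
        simp only [Nat.lt_succ_iff_lt_or_eq, or_imp, forall_and, forall_eq]
      refine Runs.ite (by simp; omega) (fun hc => Runs.ite (by simp; omega) (fun hc' => ?_)
        fun hc' => ?_) fun hc => ?_
      · simp at hc hc'
        refine Runs.store (by simp) (by simp)
          ⟨Function.update p 0 0, by simp [Function.update_comm],
            iff_of_false (by simp) fun hall => (hstep.mp hall).2 ⟨b1.mp hc, b2.mp hc'⟩⟩
      · simp at hc hc'
        refine Runs.skip ⟨p, rfl, ?_⟩
        rw [hp, hstep, iff_self_and]
        exact fun _ h => b2.mpr h.2 hc'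
      · simp at hc
        refine (Runs.skip ⟨p, rfl, ?_⟩).time_le (by omega)
        rw [hp, hstep, iff_self_and]
        exact fun _ h => b1.mpr h.1 hc
    · rintro _ ⟨p, rfl, hp⟩
      refine Runs.ite (by simp) (fun hc => ?_) fun hc => ?_
      · simp at hc
        refine Runs.store (by simp) (by simp)
          ⟨p, Function.update r 0 j, by simp, fun _ => ?_⟩
        rw [Function.update_self]
        exact ⟨hj', hp.mp hc⟩
      · simp at hc
        refine Runs.skip ⟨p, r, rfl, ?_⟩
        rintro ⟨j', hj1, hj2⟩
        by_cases e : j' = j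
        · subst e
          exact absurd hc (hp.mpr hj2)
        · exact hr ⟨j', by omega, hj2⟩
  · rintro _ ⟨p, r, rfl, hr⟩
    exact ⟨p, r, rfl, hr hex⟩

/-- The list `l` is in the output, and its elements are marked. -/
def OutInv (n : ℕ) (σ : Banks) (l : List ℕ) (σ' : Banks) : Prop :=
  ∃ μ, σ' = Function.update (Function.update σ 1 (loadInput (1 :: l))) 7 μ ∧
    (∀ v, μ v ≠ 0 ↔ v ∈ l) ∧ l.Nodup ∧ ∀ v ∈ l, v < n

theorem Runs.addCmd {v : ℕ} {l : List ℕ} {σ' : Banks} (h : OutInv n σ l σ') (hv : v < n)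
    (hB : l.length + 2 ≤ B) :
    Runs B addCmd (v :: env) σ' (1 + (1 + 2)) fun σ'' => ∃ l', OutInv n σ l' σ'' ∧ l ⊆ l' ∧ v ∈ l' ∧
      l'.length ≤ l.length + 1 := by
  obtain ⟨μ, rfl, h1, h2, h3⟩ := h
  refine Runs.ite (by simp) (fun hc => ?_) fun hc => ?_
  · simp only [Ex.val_a, Ex.val_v, List.getD_cons_zero, Function.update_self] at hc
    exact (Runs.skip ⟨l, ⟨μ, rfl, h1, h2, h3⟩, List.Subset.refl _, (h1 v).mp hc,
      by omega⟩).time_le (by omega)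
  · simp only [Ex.val_a, Ex.val_v, List.getD_cons_zero, Function.update_self] at hc
    have hvl : v ∉ l := fun h => (h1 v).mpr h hc
    refine Runs.seq (Runs.store (by simp) (by simp; omega)
      (Runs.push (L := 1 :: l) (by simp) (by simp) (by simp; omega)
      ⟨l ++ [v], ⟨Function.update μ v 1, by simp [Function.update_comm], fun w => ?_, ?_, ?_⟩,
        List.subset_append_left _ _, by simp, by simp⟩))
    · by_cases e : w = v
      · subst e; simp
      · simp only [Function.update_of_ne e, h1, List.mem_append, List.mem_singleton, e, or_false]
    · exact List.nodup_append.mpr ⟨h2, List.nodup_singleton v, by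
        intro a ha b hb
        rw [List.mem_singleton] at hb
        subst hb
        exact fun e => hvl (e ▸ ha)⟩
    · intro w hw
      rw [List.mem_append, List.mem_singleton] at hw
      rcases hw with hw | rfl
      · exact h3 w hw
      · exact hv

theorem Runs.digitsCmd {a x : ℕ} {l : List ℕ} {σ' : Banks} (h : OutInv n σ l σ') (hn : 0 < n)
    (ha : env.getD a 0 = x) (hn2 : env.getD 2 0 = n) (hh : env.getD 4 0 = h')
    (h8 : ∀ t ≤ h', σ 8 t = n ^ t) (hB : l.length + h' + 2 ≤ B) :
    Runs B (digitsCmd a) env σ' (1 + h' * (1 + (1 + (1 + 2)) + 1)) fun σ'' => ∃ l',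
      OutInv n σ l' σ'' ∧ l ⊆ l' ∧ (∀ t < h', x / n ^ t % n ∈ l') ∧
      l'.length ≤ l.length + h' := by
  subst hh
  refine Runs.forV_const (t := 1 + (1 + (1 + 2))) (fun k σ'' => ∃ l',
      OutInv n σ l' σ'' ∧ l ⊆ l' ∧ (∀ t < k, x / n ^ t % n ∈ l') ∧
      l'.length ≤ l.length + k) ⟨l, h, List.Subset.refl _, by simp, by simp⟩ ?_ fun σ' => id
  rintro k hk σ'' ⟨l', hl', h1, h2, h3⟩
  have hv : (Ex.v (a + 1) / .a 8 (.v 0) % .v 3).val (k :: env) σ'' = x / n ^ k % n := by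
    obtain ⟨μ, rfl, -⟩ := hl'
    simp only [Ex.val_mod, Ex.val_div, Ex.val_v, Ex.val_a, List.getD_cons_succ, List.getD_cons_zero,
      ha, hn2]
    simp [h8 k hk.le]
  refine Runs.letE (by simp) ?_
  rw [hv]
  refine (Runs.addCmd hl' (Nat.mod_lt _ hn) (by omega)).mono le_rfl ?_
  rintro σ₃ ⟨l₃, e1, e2, e3, e4⟩
  refine ⟨l₃, e1, List.Subset.trans h1 e2, fun t ht => ?_, by omega⟩
  by_cases e : t = k
  · subst e; exact e3
  · exact e2 (h2 t (by omega))

/-- A dominating set stays dominating when it is enlarged, so the output can be filled up to the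
exact size. All vertices are offered; a list still shorter than `k` at the end would contain all `n
≥ k` of them. -/
theorem Runs.padCmd {k : ℕ} {l : List ℕ} {σ' : Banks} (h : OutInv n σ l σ')
    (hn2 : env.getD 2 0 = n) (hk : l.length ≤ k) (hkn : k ≤ n) (hB : k + 2 ≤ B) :
    Runs B (padCmd k) env σ' (1 + n * (1 + (1 + (1 + 2)) + 1)) fun σ'' => ∃ l',
      OutInv n σ l' σ'' ∧ l ⊆ l' ∧ l'.length = k := by
  subst hn2
  refine Runs.forV_const (t := 1 + (1 + (1 + 2))) (fun i σ'' => ∃ l',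
      OutInv (env.getD 2 0) σ l' σ'' ∧ l ⊆ l' ∧ l'.length ≤ k ∧
      (l'.length < k → ∀ v < i, v ∈ l')) ⟨l, h, List.Subset.refl _, hk, by simp⟩ ?_ ?_
  · rintro i hi σ'' ⟨l', hl', h1, h2, h3⟩
    have hv : σ'' 1 0 = l'.length + 1 := by
      obtain ⟨μ, rfl, -⟩ := hl'
      simp [loadInput]
    refine Runs.ite (by simp; omega) (fun hc => ?_) fun hc => ?_
    · simp [hv] at hc
      refine (Runs.addCmd hl' hi (by omega)).mono le_rfl ?_
      rintro σ₃ ⟨l₃, e1, e2, e3, e4⟩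
      refine ⟨l₃, e1, List.Subset.trans h1 e2, by omega, fun _ v hv => ?_⟩
      by_cases e : v = i
      · subst e; exact e3
      · exact e2 (h3 (by omega) v (by omega))
    · simp [hv] at hc
      exact (Runs.skip ⟨l', hl', h1, h2, fun h => by omega⟩).time_le (by omega)
  · rintro σ'' ⟨l', hl', h1, h2, h3⟩
    refine ⟨l', hl', h1, le_antisymm h2 (not_lt.mp fun hlt => ?_)⟩
    have hsub : List.range (env.getD 2 0) ⊆ l' := fun v hv => h3 hlt v (List.mem_range.mp hv)
    have := (List.nodup_range.subperm hsub).length_le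
    rw [List.length_range] at this
    omega

theorem dominatingSet_sol {k : ℕ} {x : DomInstance} {l : List ℕ} (hl : l.Nodup) (hk : l.length = k)
    (hn : ∀ v ∈ l, v < x.graph.n) (hdom : ∀ v < x.graph.n, ∃ u ∈ l, x.graph.Dominates u v) :
    (dominatingSet k).Sol x (1 :: l) := by
  refine Or.inl ⟨l.pmap Fin.mk hn, ?_, by simpa using hk, fun v => ?_, ?_⟩
  · exact hl.pmap fun a ha b hb e => by simpa using e
  · obtain ⟨u, hu, hun, hvn, h⟩ := hdom v v.2
    have hmem : (⟨u, hun⟩ : Fin x.graph.n) ∈ (l.pmap Fin.mk hn).toFinset := by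
      simp [hu]
    rcases h with h | h
    · left
      convert hmem
      exact h.symm
    · exact Or.inr ⟨_, hmem, h⟩
  · rw [List.map_pmap]
    simp

/-- List the `2 * h` elements of `D` and take the first half as the base `n` digits of `i`, the
second half as those of `j`. -/
theorem exists_of_isDominating {α : Type} {G : EdgeList α} {D : Finset (Fin G.n)} (hn : 0 < G.n)
    (hD : D.card = 2 * h) (hdom : G.IsDominating D) : ∃ i < G.n ^ h, ∃ j < G.n ^ h, ∀ v < G.n,
      ¬ (undominated G h i v ∧ undominated G h (G.n ^ h + j) v) := by
  have hlen : D.toList.length = 2 * h := by rw [Finset.length_toList, hD]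
  obtain ⟨i, hi, hi'⟩ := exists_digits hn h (fun t => (D.toList.map Fin.val).getD t 0) (by
    intro t ht
    rw [List.getD_eq_getElem _ _ (by simp; omega)]
    simp)
  obtain ⟨j, hj, hj'⟩ := exists_digits hn h (fun t => (D.toList.map Fin.val).getD (h + t) 0) (by
    intro t ht
    rw [List.getD_eq_getElem _ _ (by simp; omega)]
    simp)
  refine ⟨i, hi, j, hj, fun v hv => ?_⟩
  rintro ⟨h1, h2⟩
  obtain ⟨u, hu, hd⟩ : ∃ u ∈ D, G.Dominates u v := by
    rcases hdom ⟨v, hv⟩ with h | ⟨u, hu, h⟩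
    · exact ⟨_, h, hv, hv, Or.inl rfl⟩
    · exact ⟨u, hu, u.2, hv, Or.inr h⟩
  rw [← Finset.mem_toList] at hu
  obtain ⟨t, ht, rfl⟩ := List.getElem_of_mem hu
  by_cases e : t < h
  · refine h1 t e ?_
    rw [Nat.mod_eq_of_lt hi, hi' t e, List.getD_eq_getElem _ _ (by simp; omega)]
    simpa using hd
  · refine h2 (t - h) (by omega) ?_
    rw [Nat.add_mod_left, Nat.mod_eq_of_lt hj, hj' _ (by omega), Nat.add_sub_cancel' (by omega),
      List.getD_eq_getElem _ _ (by simp; omega)]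
    simpa using hd

end

/-! ### The complete program for dominating sets -/

section
variable {B n N h : ℕ} {env : List ℕ} {σ : Banks}

theorem Runs.domOutCmd {x : DomInstance} {m i : ℕ} (hn : n = x.graph.n) (hN : N = n ^ h)
    (hB : (2 * N + n + 2) * (n + 2) ≤ B) (hk : 2 * h ≤ n) (hi : i < N) (h5 : σ 5 0 = i + 1)
    (h1 : σ 1 = fun _ => 0) (h7 : σ 7 = fun _ => 0) (h8 : ∀ t ≤ h, σ 8 t = n ^ t)
    (hM : IsMat (n + 2) (σ 3) (ovBit N n (undominated x.graph h)))
    (hex : ∃ j < N, ∀ v < n, ¬ (undominated x.graph h i v ∧ undominated x.graph h (N + j) v)) :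
    Runs B (domOutCmd (2 * h)) (n :: N :: h :: m :: n :: env) σ
      (1 + ((1 + N * (1 + ((1 + n * (1 + (1 + 1) + 1)) + (1 + 1)) + 1)) + (1 + (2 +
        ((1 + h * (1 + (1 + (1 + 2)) + 1)) + ((1 + h * (1 + (1 + (1 + 2)) + 1)) +
        (1 + n * (1 + (1 + (1 + 2)) + 1))))))))
      fun σ => σ 1 0 = 2 * h + 1 ∧ (dominatingSet (2 * h)).Sol x (outWords σ) := by
  have hn0 : 0 < n := hn ▸ x.pos
  have hDB : n + 2 ≤ B := (Nat.le_mul_of_pos_left _ (by omega : 0 < 2 * N + n + 2)).trans (by omega)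
  refine Runs.letE (by simp; omega) ?_
  have hv : (Ex.a 5 0 - 1).val (n :: N :: h :: m :: n :: env) σ = i := by simp [h5]
  rw [hv]
  refine Runs.seq ((Runs.searchCmd hi hB hM hex).mono le_rfl ?_)
  rintro _ ⟨p, r, rfl, hr, hdom⟩
  refine Runs.letE (by simp) ?_
  have hv2 : (Ex.a 10 0).val (i :: n :: N :: h :: m :: n :: env)
      (Function.update (Function.update σ 9 p) 10 r) = r 0 := by simp
  rw [hv2]
  set σ₁ := Function.update (Function.update σ 9 p) 10 r with hσ₁
  have h8' : ∀ t ≤ h, σ₁ 8 t = n ^ t := by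
    intro t ht
    simpa [hσ₁] using h8 t ht
  refine Runs.seq (Runs.push (L := []) (by simp [hσ₁, h1]) (by simp; omega) (by simp; omega)
    (Runs.seq ?_))
  have h0 : OutInv n σ₁ [] (Function.update σ₁ 1 (loadInput ([] ++
      [Ex.val (r 0 :: i :: n :: N :: h :: m :: n :: env) σ₁ 1]))) := by
    refine ⟨fun _ => 0, ?_, by simp, List.nodup_nil, by simp⟩
    have : σ₁ 7 = fun _ => 0 := by simpa [hσ₁] using h7
    rw [← this]
    simp
  refine (Runs.digitsCmd (x := i) (h' := h) h0 hn0 rfl rfl rfl h8' (by simp; omega)).mono le_rfl ?_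
  rintro σ₂ ⟨l₂, a1, -, a3, a4⟩
  refine Runs.seq ((Runs.digitsCmd (x := r 0) (h' := h) a1 hn0 rfl rfl rfl h8' (by
    simp at a4; omega)).mono le_rfl ?_)
  rintro σ₃ ⟨l₃, b1, b2, b3, b4⟩
  simp only [List.length_nil, zero_add] at a4
  refine (Runs.padCmd b1 rfl (by omega) hk (by omega)).mono le_rfl ?_
  rintro _ ⟨l, ⟨μ, rfl, c1, c2, c3⟩, d1, d2⟩
  refine ⟨by simp [loadInput, d2], ?_⟩
  rw [outWords_of_loadInput (L := 1 :: l) (by simp)]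
  refine dominatingSet_sol c2 d2 (hn ▸ c3) fun v hv => ?_
  have hv' := hdom v (hn ▸ hv)
  rw [not_and_or] at hv'
  simp only [undominated, not_forall, not_not] at hv'
  rw [← hn, ← hN] at hv'
  rcases hv' with ⟨t, ht, hd⟩ | ⟨t, ht, hd⟩
  · rw [Nat.mod_eq_of_lt hi] at hd
    exact ⟨_, d1 (b2 (a3 t ht)), hd⟩
  · rw [Nat.add_mod_left, Nat.mod_eq_of_lt hr] at hd
    exact ⟨_, d1 (b3 t ht), hd⟩

theorem Runs.domCmd {x : DomInstance} {m W t : ℕ} {directed weighted : Bool} {P : Prog} {s' : Mem}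
    (hn : n = x.graph.n) (hm : m = x.graph.edges.length) (hN : N = n ^ h) (hh : 1 ≤ h)
    (hB : 6 * ((2 * N + n + 2) * (n + 2)) + 3 ≤ B)
    (hlen : ((dominatingSet (2 * h)).encode x).length + 5 ≤ B) (hB2 : 2 * h + 2 ≤ B)
    (hWB : W ≤ B) (hP : P.maxConst ≤ B) (hmn : m ≤ n * n)
    (hrun : Exec W P
      (loadInput ((ovGraph N n (undominated x.graph h) directed).encode fun w => [w])) t s')
    (hsol : (eccentricities directed weighted).Sol
      (ovInstance N n (undominated x.graph h) directed weighted) (readOutput s')) :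
    Runs B (domCmd h directed P) [] (initBanks ((dominatingSet (2 * h)).encode x))
      ((20 * h + 100) * ((2 * N + n + 2) * (n + 2)) + t)
      fun σ => σ 1 0 ≤ 2 * h + 1 ∧ (dominatingSet (2 * h)).Sol x (outWords σ) := by
  have hn0 : 0 < n := hn ▸ x.pos
  have hN0 : 0 < N := hN ▸ pow_pos hn0 h
  have hDB : n + 2 ≤ B := (Nat.le_mul_of_pos_left _ (by omega : 0 < 2 * N + n + 2)).trans (by omega)
  have hVB : 2 * N + n + 2 ≤ B := (Nat.le_mul_of_pos_right _ (by omega : 0 < n + 2)).trans (by omega)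
  have hnN : n ≤ N := by rw [hN]; exact Nat.le_self_pow (by omega) n
  set E := (dominatingSet (2 * h)).encode x with hE
  have e1 : loadInput E 1 = n := by rw [hn]; rfl
  have e2 : loadInput E 2 = m := by rw [hm]; rfl
  have hno : (¬ ∃ D : Finset (Fin x.graph.n), D.card = 2 * h ∧ x.graph.IsDominating D) → ∀ σ : Banks,
      σ 1 = loadInput [0] →
      σ 1 0 ≤ 2 * h + 1 ∧ (dominatingSet (2 * h)).Sol x (outWords σ) := by
    intro h0 σ hσ
    refine ⟨by simp [hσ, loadInput], ?_⟩
    rw [outWords_of_loadInput (L := [0]) hσ]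
    exact Or.inr ⟨h0, rfl⟩
  refine Runs.time_le (T₁ := 1 + (1 + (1 + (1 + (((1 + n * (1 + 1)) + (1 + m * (1 + (1 + 2) + 1))) +
    ((1 + (1 + h * (1 + 1))) + (1 + (1 + ((1 + (1 + 2 * N * ((1 + n * (1 + 1)) +
    (1 + h * (1 + (1 + n * (1 + 1 + 1)) + 1)) + 1))) +
    ((43 * ((2 * N + n + 2) * (n + 2)) + t) + (1 +
      (1 + ((1 + N * (1 + ((1 + n * (1 + (1 + 1) + 1)) + (1 + 1)) + 1)) + (1 + (2 +
        ((1 + h * (1 + (1 + (1 + 2)) + 1)) + ((1 + h * (1 + (1 + (1 + 2)) + 1)) +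
        (1 + n * (1 + (1 + (1 + 2)) + 1))))))))))))))))))) ?_ (by
      have : (2 * N + n + 2) * (n + 2) = 2 * N * n + 4 * N + n * n + 4 * n + 4 := by ring
      rw [this]
      have hhn := Nat.zero_le (h * (N * n))
      have hhN := Nat.zero_le (h * N)
      have hnn : n * n ≤ N * n := Nat.mul_le_mul_right _ hnN
      nlinarith [Nat.zero_le (h * n), Nat.zero_le (h * (n * n))])
  refine Runs.letE (by simp; omega) (Runs.letE (by simp; omega) (Runs.letE (by simp; omega) ?_))
  simp only [Ex.val_a, Ex.val_c, Ex.val_ofNat, initBanks, Function.update_self, e1, e2]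
  -- With fewer than `2 * h` vertices there is no set of this size; the padding below relies on
  -- having excluded this case.
  refine Runs.ite (by simp; omega) (fun hc => ?_) fun hc => ?_
  · simp at hc
    refine (Runs.push (L := []) (by simp) (by simp) (by simp; omega) (hno ?_ _ (by simp))).time_le
      (by omega)
    rintro ⟨D, hD, -⟩
    have := D.card_le_univ
    rw [Fintype.card_fin] at this
    omega
  simp at hc
  have hnn : n * n + n ≤ B := by nlinarith
  refine Runs.seq ((Runs.domAdjCmd (G := x.graph) hn hm hnn hlen (by simp [hE]; rfl)
    (by simp)).mono le_rfl ?_)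
  rintro _ ⟨A, rfl, hA⟩
  refine Runs.seq ((Runs.powCmd hn0 (by omega) (by omega) (by omega)).mono le_rfl ?_)
  rintro _ ⟨p, rfl, hp⟩
  refine Runs.letE (by simp) (Runs.letE (by simp) ?_)
  have hv : (Ex.a 8 (.v 0)).val [h, m, n] (Function.update (Function.update
      (Function.update (fun _ _ => 0) 0 (loadInput E)) 6 A) 8 p) = N := by simp [hp, hN]
  rw [hv]
  simp only [Ex.val_v, List.getD_cons_succ, List.getD_cons_zero]
  refine Runs.seq (Runs.letE (by simp; omega) ?_)
  simp only [Ex.val_v, List.getD_cons_succ, List.getD_cons_zero, Ex.val_mul, Ex.val_ofNat]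
  refine (Runs.domMatrixCmd (G := x.graph) hn hN hn0 (by omega) (by simp) (by simpa using hA)
    (by simpa using hp)).mono le_rfl ?_
  rintro _ ⟨M, rfl, hM⟩
  refine Runs.seq ((Runs.ovFindCmd (weighted := weighted) hN0 hB hWB hP (by simp) (by simp)
    (by simpa using hM) hrun hsol).mono le_rfl ?_)
  rintro _ ⟨M', g, rfl, hM', hg1, hg2⟩
  refine Runs.ite (by simp) (fun hg => ?_) fun hg => ?_
  · simp only [Ex.val_a, Ex.val_ofNat, Function.update_self] at hg
    obtain ⟨i, hi, hgi, hex⟩ := hg2 hg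
    refine (Runs.domOutCmd hn hN (by omega) hc hi (by simpa using hgi) (by simp) (by simp)
      (by simpa using hp) (by simpa using hM') hex).mono le_rfl ?_
    rintro σ ⟨a1, a2⟩
    exact ⟨a1.le, a2⟩
  · simp only [Ex.val_a, Ex.val_ofNat, Function.update_self] at hg
    refine (Runs.push (L := []) (by simp) (by simp) (by simp; omega) (hno ?_ _ (by simp))).time_le
      (by omega)
    rintro ⟨D, hD, hdom⟩
    obtain ⟨i, hi, j, hj, hv⟩ := exists_of_isDominating (hn ▸ hn0) hD hdom
    rw [← hn, ← hN] at hi hj hv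
    obtain ⟨c, hc1, hc2⟩ := hg1 hg i hi j hj
    exact hv c hc1 hc2

/-! ### The reduction from dominating sets -/

theorem EdgeList.IsSimple.length_le {α : Type} {G : EdgeList α} {directed : Bool}
    (hG : G.IsSimple directed) : G.edges.length ≤ G.n * G.n := by
  have h : (G.edges.map fun e => (e.1, e.2.1)).Nodup := by
    cases directed
    · have h := hG.2
      rw [if_neg Bool.false_ne_true] at h
      have e : (fun e : Fin G.n × Fin G.n × α => s(e.1, e.2.1)) =
        (fun p : Fin G.n × Fin G.n => s(p.1, p.2)) ∘ fun e => (e.1, e.2.1) := rfl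
      rw [e, ← List.map_map] at h
      exact h.of_map _
    · exact hG.2
  simpa using h.length_le_card

/-- The graph has about `n ^ h` vertices and at most about `n ^ (h + 1)` edges, so it is sparse for
large `h`. Its eccentricities take time `V ^ q`, that is `n ^ (h * q)` up to a constant. -/
theorem not_KDSH_of_hasAlgorithm {directed weighted : Bool} {T' : ℕ → ℕ → ℝ} {q η : ℝ} {n₀ : ℕ}
    (hq : 3 / 2 ≤ q) (hq2 : q < 2) (hη : 0 < η)
    (hT' : ∀ m n : ℕ, n₀ ≤ n → n ≤ m + 1 → (m : ℝ) ≤ (n : ℝ) ^ (1 + η) → T' m n ≤ (n : ℝ) ^ q)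
    (halg : HasAlgorithm (eccentricities directed weighted) T') : ¬ KDSH := by
  rintro ⟨k₀, hk₀⟩
  -- `k₀ ≤ h` makes the hypothesis apply to `2 * h`; `2 ≤ h` gives `h + 1 ≤ h * q`, so that building
  -- the graph is cheap; `2 ≤ h * η` gives `n ≤ (n ^ h) ^ (η / 2)`, which is the required sparsity.
  obtain ⟨h, hh1, hh2, hhη⟩ : ∃ h : ℕ, k₀ ≤ h ∧ 2 ≤ h ∧ 2 ≤ h * η := by
    refine ⟨k₀ + 2 + ⌈2 / η⌉₊, by omega, by omega, ?_⟩
    have := Nat.le_ceil (2 / η)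
    rw [div_le_iff₀ hη] at this
    push_cast
    nlinarith [(Nat.cast_nonneg k₀ : (0 : ℝ) ≤ k₀)]
  have hhR : (2 : ℝ) ≤ h := by exact_mod_cast hh2
  -- The saving `ε = h * (2 - q)` turns `2 * h - ε` into `h * q`.
  refine hk₀ (2 * h) (by omega) (h * (2 - q)) (by nlinarith) ?_
  obtain ⟨P, C₀, hP⟩ := halg
  obtain ⟨K, hK⟩ := exists_time_bound hη hT' 25
  have hexp : ∀ n : ℕ, (n : ℝ) ^ (((2 * h : ℕ) : ℝ) - h * (2 - q)) = (n : ℝ) ^ (h * q) := by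
    intro n
    congr 1
    push_cast
    ring
  simp only [hexp]
  have hone : ∀ x : DomInstance, (1 : ℝ) ≤ x.graph.n := fun x => by exact_mod_cast x.pos
  have hT : ∀ x : DomInstance, (1 : ℝ) ≤ (x.graph.n : ℝ) ^ (h * q) := fun x =>
    Real.one_le_rpow (hone x) (by positivity)
  have key : ∀ x : DomInstance, ∀ m,
      m ≤ 2 * ((2 * x.graph.n ^ h + x.graph.n + 2) * (x.graph.n + 2)) →
      2 * x.graph.n ^ h + x.graph.n + 2 ≤ m + 1 →
      T' m (2 * x.graph.n ^ h + x.graph.n + 2) ≤ K * (x.graph.n : ℝ) ^ (h * q) ∧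
      (((2 * x.graph.n ^ h + x.graph.n + 2) * (x.graph.n + 2) : ℕ) : ℝ) ≤
        K * (x.graph.n : ℝ) ^ (h * q) := by
    intro x
    have hx := x.pos
    have h1 := hone x
    have h2 := hT x
    set n := x.graph.n with hn
    have hnN : n ≤ n ^ h := Nat.le_self_pow (by omega) n
    have hN0 : 0 < n ^ h := by positivity
    have hV : ((2 * n ^ h + n + 2 : ℕ) : ℝ) ≤ 5 * (n : ℝ) ^ (h : ℝ) := by
      rw [Real.rpow_natCast]
      exact_mod_cast (by omega : 2 * n ^ h + n + 2 ≤ 5 * n ^ h)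
    have hV1 : (n : ℝ) ^ (h : ℝ) ≤ ((2 * n ^ h + n + 2 : ℕ) : ℝ) := by
      rw [Real.rpow_natCast]
      exact_mod_cast (by omega : n ^ h ≤ 2 * n ^ h + n + 2)
    have hD : ((n + 2 : ℕ) : ℝ) ≤ 3 * n := by
      exact_mod_cast (by omega : n + 2 ≤ 3 * n)
    refine hK _ (n + 2) _ (by omega) (by omega) h2 ?_ ?_ ?_
    · calc (((2 * n ^ h + n + 2) * (n + 2) : ℕ) : ℝ) ≤ (5 * (n : ℝ) ^ (h : ℝ)) * (3 * n) := by
            rw [Nat.cast_mul]; gcongr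
        _ = 15 * (n : ℝ) ^ ((h : ℝ) + 1) := by
            rw [Real.rpow_add_one (by linarith)]; ring
        _ ≤ 25 * (n : ℝ) ^ (h * q) := by
            gcongr
            · norm_num
            · nlinarith
    · calc ((2 * n ^ h + n + 2 : ℕ) : ℝ) ^ q ≤ (5 * (n : ℝ) ^ (h : ℝ)) ^ q := by gcongr
        _ = 5 ^ q * (n : ℝ) ^ (h * q) := by
            rw [Real.mul_rpow (by positivity) (by positivity), ← Real.rpow_mul (by linarith)]
        _ ≤ 5 ^ (2 : ℝ) * (n : ℝ) ^ (h * q) := by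
            gcongr
            norm_num
        _ = _ := by norm_num
    · calc ((n + 2 : ℕ) : ℝ) ≤ 3 * n := hD
        _ ≤ 25 * (n : ℝ) ^ (1 : ℝ) := by rw [Real.rpow_one]; linarith
        _ ≤ 25 * ((n : ℝ) ^ (h : ℝ)) ^ (η / 2) := by
            rw [← Real.rpow_mul (by linarith)]
            gcongr
            linarith
        _ ≤ _ := by gcongr
  have hVD : ∀ x : DomInstance, (((2 * x.graph.n ^ h + x.graph.n + 2) * (x.graph.n + 2) : ℕ) : ℝ) ≤
      K * (x.graph.n : ℝ) ^ (h * q) := fun x => by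
    refine (key x _ (Nat.le_mul_of_pos_left _ two_pos) ?_).2
    have : 2 * x.graph.n ^ h + x.graph.n + 2 ≤
      (2 * x.graph.n ^ h + x.graph.n + 2) * (x.graph.n + 2) := Nat.le_mul_of_pos_right _ (by omega)
    omega
  have hlen : ∀ x : DomInstance, ((dominatingSet (2 * h)).encode x).length =
      2 + 2 * x.graph.edges.length := fun x => length_encode x.graph (fun _ => []) 0 (fun _ => rfl)
  obtain ⟨C, h1, h2, h3, h4, h5⟩ : ∃ C : ℕ, (13 * K + 1) * C₀ ≤ C ∧ 6 * K + 10 ≤ C ∧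
      P.maxConst + 10 ≤ C ∧ (20 * h + 100) * K + C₀ * K ≤ C ∧ 2 * h + 10 ≤ C :=
    ⟨(13 * K + 1) * C₀ + (6 * K + 10) + (P.maxConst + 10) + ((20 * h + 100) * K + C₀ * K) +
      (2 * h + 10), by omega, by omega, by omega, by omega, by omega⟩
  refine solvableInTime_of_runs (domCmd h directed P) C (by omega) hT (fun x => ?_) fun x => ?_
  · have e := hlen x
    have e' : ((dominatingSet (2 * h)).encode x).length ≤ 2 *
        ((2 * x.graph.n ^ h + x.graph.n + 2) * (x.graph.n + 2)) := by
      have := x.simple.length_le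
      nlinarith [Nat.zero_le (x.graph.n ^ h * (x.graph.n + 2))]
    calc (((dominatingSet (2 * h)).encode x).length : ℝ) ≤ ((2 : ℕ) : ℝ) *
          (((2 * x.graph.n ^ h + x.graph.n + 2) * (x.graph.n + 2) : ℕ) : ℝ) := by exact_mod_cast e'
      _ ≤ ((2 : ℕ) : ℝ) * (K * (x.graph.n : ℝ) ^ (h * q)) := by gcongr; exact hVD x
      _ = ((2 * K : ℕ) : ℝ) * (x.graph.n : ℝ) ^ (h * q) := by push_cast; ring
      _ ≤ C * (x.graph.n : ℝ) ^ (h * q) := by gcongr; omega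
  · set Z := inputSize ((dominatingSet (2 * h)).encode x) + ⌈(x.graph.n : ℝ) ^ (h * q)⌉₊ with hZ
    have hi := two_le_inputSize ((dominatingSet (2 * h)).encode x)
    have hZ2 : 2 ≤ Z := by omega
    have hZC : ∀ a c, a ≤ c * Z → c + 1 ≤ C → a ≤ Z ^ C := fun a c ha hc =>
      (le_pow_of_le_mul hZ2 ha).trans (Nat.pow_le_pow_right (by omega) hc)
    obtain ⟨W, t, s', hW, hrun, ht, hsol⟩ := exists_exec_ov (weighted := weighted) hP
      (N := x.graph.n ^ h) (d := x.graph.n) (pow_pos x.pos h)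
      (undominated x.graph h) hZ2 (Nat.le_add_left _ _) (key x)
    have hVDZ : (2 * x.graph.n ^ h + x.graph.n + 2) * (x.graph.n + 2) ≤ K * Z := by
      have : (K : ℝ) * (x.graph.n : ℝ) ^ (h * q) ≤ ((K * Z : ℕ) : ℝ) := by
        push_cast
        gcongr
        exact (Nat.le_ceil _).trans (by exact_mod_cast Nat.le_add_left _ _)
      exact_mod_cast (hVD x).trans this
    refine ⟨_, ?_, (Runs.domCmd (weighted := weighted) rfl rfl rfl (by omega) ?_ ?_ ?_
      (hW.trans (Nat.pow_le_pow_right (by omega) h1)) ?_ x.simple.length_le hrun hsol).mono le_rfl ?_⟩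
    · push_cast
      have e := hVD x
      push_cast at e
      have h4' : (((20 * h + 100) * K + C₀ * K : ℕ) : ℝ) ≤ C := Nat.cast_le.mpr h4
      push_cast at h4'
      have e1 := mul_le_mul_of_nonneg_left e (by positivity : (0 : ℝ) ≤ 20 * h + 100)
      have e2 := mul_le_mul_of_nonneg_right h4'
        (by linarith [hT x] : (0 : ℝ) ≤ (x.graph.n : ℝ) ^ (h * q))
      nlinarith
    · exact hZC _ (6 * K + 3) (by nlinarith) (by omega)
    · refine hZC _ 5 ?_ (by omega)
      have : ((dominatingSet (2 * h)).encode x).length ≤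
          inputSize ((dominatingSet (2 * h)).encode x) := by
        rw [inputSize]; omega
      omega
    · exact hZC _ (2 * h + 2) (Nat.le_mul_of_pos_right _ (by omega)) (by omega)
    · exact hZC _ P.maxConst (Nat.le_mul_of_pos_right _ (by omega)) (by omega)
    · rintro σ ⟨e1, e2⟩
      refine ⟨?_, e2⟩
      have e3 : (σ 1 0 : ℝ) ≤ C := by exact_mod_cast e1.trans (by omega : 2 * h + 1 ≤ C)
      have := hT x
      nlinarith [(Nat.cast_nonneg (σ 1 0) : (0 : ℝ) ≤ σ 1 0)]

end

/-! ### Triangles in lists of edges -/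

section
variable {n : ℕ} {E : List (Fin n × Fin n × ℤ)}

/-- There is an edge of weight `w` between `u` and `v`. -/
def ArcIn (E : List (Fin n × Fin n × ℤ)) (u v : Fin n) (w : ℤ) : Prop :=
  (u, v, w) ∈ E ∨ (v, u, w) ∈ E

/-- The neighbors of a vertex. -/
def nbrs (E : List (Fin n × Fin n × ℤ)) (u : Fin n) : List (Fin n) :=
  E.filterMap fun e => if e.1 = u then some e.2.1 else if e.2.1 = u then some e.1 else none

theorem nbrs_append_singleton (E : List (Fin n × Fin n × ℤ)) (e : Fin n × Fin n × ℤ) (u : Fin n) :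
    nbrs (E ++ [e]) u =
      nbrs E u ++ if e.1 = u then [e.2.1] else if e.2.1 = u then [e.1] else [] := by
  rw [nbrs, List.filterMap_append]
  congr 1
  simp only [List.filterMap_cons, List.filterMap_nil]
  split_ifs <;> rfl

theorem mem_nbrs {u v : Fin n} : v ∈ nbrs E u ↔ ∃ w, ArcIn E u v w := by
  simp only [nbrs, List.mem_filterMap, ArcIn]
  constructor
  · rintro ⟨⟨x, y, w⟩, he, h⟩
    simp only at h
    split_ifs at h with h1 h2
    · simp only [Option.some.injEq] at h
      subst h1 h
      exact ⟨w, Or.inl he⟩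
    · simp only [Option.some.injEq] at h
      subst h2 h
      exact ⟨w, Or.inr he⟩
  · rintro ⟨w, h | h⟩
    · exact ⟨_, h, by simp⟩
    · refine ⟨_, h, ?_⟩
      by_cases e : v = u
      · simp [e]
      · simp [e]

/-- Handshake: an edge enters the lists of at most two vertices. The inequality suffices and does
not need simplicity. -/
theorem sum_length_nbrs_le (E : List (Fin n × Fin n × ℤ)) :
    ∑ u, (nbrs E u).length ≤ 2 * E.length := by
  induction E using List.reverseRecOn with
  | nil => simp [nbrs]
  | append_singleton E e ih =>
    simp only [nbrs_append_singleton, List.length_append, Finset.sum_add_distrib,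
      List.length_singleton]
    have : ∑ u, (if e.1 = u then [e.2.1] else if e.2.1 = u then [e.1] else []).length ≤
        ∑ u : Fin n, ((if e.1 = u then 1 else 0) + if e.2.1 = u then 1 else 0) := by
      refine Finset.sum_le_sum fun u _ => ?_
      split_ifs <;> simp
    simp only [Finset.sum_add_distrib, Finset.sum_ite_eq, Finset.mem_univ, if_true] at this
    omega

/-- The edges form a simple graph. -/
def SimpleEdges (E : List (Fin n × Fin n × ℤ)) : Prop :=
  (∀ e ∈ E, e.1 ≠ e.2.1) ∧ (E.map fun e => s(e.1, e.2.1)).Nodup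

theorem SimpleEdges.sublist {E' : List (Fin n × Fin n × ℤ)} (h : SimpleEdges E)
    (hE : E'.Sublist E) : SimpleEdges E' :=
  ⟨fun e he => h.1 e (hE.subset he), h.2.sublist (hE.map _)⟩

theorem SimpleEdges.eq_of_sym2_eq (h : SimpleEdges E) {e e' : Fin n × Fin n × ℤ} (he : e ∈ E)
    (he' : e' ∈ E) (hs : s(e.1, e.2.1) = s(e'.1, e'.2.1)) : e = e' :=
  List.inj_on_of_nodup_map h.2 he he' hs

theorem SimpleEdges.arcIn_unique (h : SimpleEdges E) {u v : Fin n} {w w' : ℤ}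
    (h1 : ArcIn E u v w) (h2 : ArcIn E u v w') : w = w' := by
  rcases h1 with h1 | h1 <;> rcases h2 with h2 | h2
  all_goals
    have := h.eq_of_sym2_eq h1 h2 (by simp [Sym2.eq_swap])
    simp only [Prod.mk.injEq] at this
    exact this.2.2

theorem SimpleEdges.nodup_nbrs (h : SimpleEdges E) (u : Fin n) : (nbrs E u).Nodup := by
  induction E using List.reverseRecOn with
  | nil => simp [nbrs]
  | append_singleton E e ih =>
    have ih' := ih (h.sublist (List.sublist_append_left _ _))
    have key : ∀ v, s(e.1, e.2.1) = s(u, v) → v ∉ nbrs E u := by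
      intro v hv hmem
      rw [mem_nbrs] at hmem
      have hd := h.2
      rw [List.map_append, List.nodup_append] at hd
      obtain ⟨w, hw | hw⟩ := hmem
      · exact hd.2.2 _ (List.mem_map_of_mem hw) s(e.1, e.2.1) (by simp) hv.symm
      · exact hd.2.2 _ (List.mem_map_of_mem hw) s(e.1, e.2.1) (by simp) (by rw [hv]; exact Sym2.eq_swap)
    rw [nbrs_append_singleton]
    split_ifs with h1 h2
    · exact List.nodup_append.mpr ⟨ih', List.nodup_singleton _, fun a ha b hb hab => by
        rw [List.mem_singleton] at hb
        subst hab hb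
        exact key _ (by rw [h1]) ha⟩
    · exact List.nodup_append.mpr ⟨ih', List.nodup_singleton _, fun a ha b hb hab => by
        rw [List.mem_singleton] at hb
        subst hab hb
        exact key _ (by rw [h2]; exact Sym2.eq_swap) ha⟩
    · simpa using ih'

theorem SimpleEdges.length_nbrs_le (h : SimpleEdges E) (u : Fin n) : (nbrs E u).length ≤ n := by
  simpa using (h.nodup_nbrs u).length_le_card

/-- The endpoint of smaller degree. -/
def pivot (E : List (Fin n × Fin n × ℤ)) (e : Fin n × Fin n × ℤ) : Fin n :=
  if (nbrs E e.1).length < (nbrs E e.2.1).length then e.1 else e.2.1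

/-- The number of steps for enumerating the triangles. -/
def scanCost (E : List (Fin n × Fin n × ℤ)) : ℕ :=
  (E.map fun e => (nbrs E (pivot E e)).length).sum

/-- The square of the smaller degree is at most the product of both. After Cauchy–Schwarz, the sum
over edges is enlarged to all ordered pairs of vertices, where it factors as the square of the
degree sum. Simplicity ensures that each pair is used at most once. -/
theorem SimpleEdges.scanCost_sq_le (h : SimpleEdges E) : scanCost E ^ 2 ≤ 4 * E.length ^ 3 := by
  have hnd : E.Nodup := h.2.of_map _
  have hinj : Set.InjOn (fun e : Fin n × Fin n × ℤ => (e.1, e.2.1)) (E.toFinset : Set _) := by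
    intro e he e' he' hee
    simp only [Prod.mk.injEq] at hee
    exact h.eq_of_sym2_eq (by simpa using he) (by simpa using he') (by rw [hee.1, hee.2])
  have hd : ∀ e, (nbrs E (pivot E e)).length ^ 2 ≤
      (nbrs E e.1).length * (nbrs E e.2.1).length := by
    intro e
    unfold pivot
    rw [sq]
    split_ifs with h1
    · exact Nat.mul_le_mul_left _ h1.le
    · exact Nat.mul_le_mul_right _ (not_lt.mp h1)
  calc scanCost E ^ 2 = (∑ e ∈ E.toFinset, (nbrs E (pivot E e)).length) ^ 2 := by
        rw [scanCost, List.sum_toFinset _ hnd]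
    _ ≤ E.toFinset.card * ∑ e ∈ E.toFinset, (nbrs E (pivot E e)).length ^ 2 :=
        sq_sum_le_card_mul_sum_sq
    _ ≤ E.length * ∑ p : Fin n × Fin n, (nbrs E p.1).length * (nbrs E p.2).length := by
        refine Nat.mul_le_mul (List.toFinset_card_le _) ?_
        refine (Finset.sum_le_sum fun e _ => hd e).trans ?_
        rw [← Finset.sum_image (f := fun p : Fin n × Fin n =>
          (nbrs E p.1).length * (nbrs E p.2).length) hinj]
        exact Finset.sum_le_sum_of_subset (Finset.subset_univ _)
    _ = E.length * ((∑ u, (nbrs E u).length) * ∑ u, (nbrs E u).length) := by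
        rw [Fintype.sum_prod_type, Finset.sum_mul_sum]
    _ ≤ E.length * ((2 * E.length) * (2 * E.length)) := by
        have := sum_length_nbrs_le E
        gcongr
    _ = 4 * E.length ^ 3 := by ring

theorem SimpleEdges.scanCost_le (h : SimpleEdges E) :
    (scanCost E : ℝ) ≤ 2 * (E.length : ℝ) ^ (3 / 2 : ℝ) := by
  have h1 : ((scanCost E : ℝ)) ^ 2 ≤ (2 * (E.length : ℝ) ^ (3 / 2 : ℝ)) ^ 2 := by
    rw [mul_pow, ← Real.rpow_natCast ((E.length : ℝ) ^ (3 / 2 : ℝ)), ← Real.rpow_mul (by positivity)]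
    have := h.scanCost_sq_le
    norm_num
    exact_mod_cast this
  exact (sq_le_sq₀ (by positivity) (by positivity)).mp h1

/-- `A` is the matrix of the edge weights, increased by `S`. -/
def AdjMat (S : ℕ) (E : List (Fin n × Fin n × ℤ)) (A : ℕ → ℕ) : Prop :=
  ∀ u v : Fin n, (A (u * n + v) = 0 → ∀ w, ¬ ArcIn E u v w) ∧
    (A (u * n + v) ≠ 0 → ∃ w, ArcIn E u v w ∧ (A (u * n + v) : ℤ) = S + w)

theorem AdjMat.ne_zero {S : ℕ} {A : ℕ → ℕ} (hA : AdjMat S E A) {u v : Fin n} {w : ℤ}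
    (h : ArcIn E u v w) : A (u * n + v) ≠ 0 := fun h0 => (hA u v).1 h0 w h

theorem AdjMat.val_eq {S : ℕ} {A : ℕ → ℕ} (hA : AdjMat S E A) (hE : SimpleEdges E) {u v : Fin n}
    {w : ℤ} (h : ArcIn E u v w) : (A (u * n + v) : ℤ) = S + w := by
  obtain ⟨w', h1, h2⟩ := (hA u v).2 (hA.ne_zero h)
  rw [h2, hE.arcIn_unique h h1]

/-- The neighbors of `u` are in the row `u` of `J`, and `D u` is their number. -/
def NbrMat (E : List (Fin n × Fin n × ℤ)) (J D : ℕ → ℕ) : Prop :=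
  ∀ u : Fin n, D u = (nbrs E u).length ∧ ∀ i (hi : i < (nbrs E u).length),
    J (u * n + i) = (nbrs E u)[i]

/-- The triangles with a given edge between their two smallest vertices. -/
def edgeTriangle (A : ℕ → ℕ) (e : Fin n × Fin n × ℤ) (w : Fin n) :
    Option ((Fin n × Fin n × Fin n) × ℕ) :=
  if max e.1 e.2.1 < w ∧ A ((min e.1 e.2.1 : Fin n) * n + w) ≠ 0 ∧
      A ((max e.1 e.2.1 : Fin n) * n + w) ≠ 0 then
    some ((min e.1 e.2.1, max e.1 e.2.1, w), A ((min e.1 e.2.1 : Fin n) * n + (max e.1 e.2.1 : Fin n)) +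
      A ((max e.1 e.2.1 : Fin n) * n + w) + A ((min e.1 e.2.1 : Fin n) * n + w))
  else none

def edgeTriangles (A : ℕ → ℕ) (E : List (Fin n × Fin n × ℤ)) (e : Fin n × Fin n × ℤ) :
    List ((Fin n × Fin n × Fin n) × ℕ) :=
  (nbrs E (pivot E e)).filterMap (edgeTriangle A e)

/-- The triangles and their weights, increased by `3 * S`. -/
def triangleList (A : ℕ → ℕ) (E : List (Fin n × Fin n × ℤ)) : List ((Fin n × Fin n × Fin n) × ℕ) :=
  E.flatMap (edgeTriangles A E)

theorem mem_edgeTriangles {A : ℕ → ℕ} {e : Fin n × Fin n × ℤ} {q : Fin n × Fin n × Fin n} {s : ℕ} :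
    (q, s) ∈ edgeTriangles A E e ↔ q.1 = min e.1 e.2.1 ∧ q.2.1 = max e.1 e.2.1 ∧ q.2.1 < q.2.2 ∧
      q.2.2 ∈ nbrs E (pivot E e) ∧ A (q.1 * n + q.2.2) ≠ 0 ∧ A (q.2.1 * n + q.2.2) ≠ 0 ∧
      s = A (q.1 * n + q.2.1) + A (q.2.1 * n + q.2.2) + A (q.1 * n + q.2.2) := by
  obtain ⟨a, b, c⟩ := q
  simp only [edgeTriangles, List.mem_filterMap, edgeTriangle]
  constructor
  · rintro ⟨w, hw, h⟩
    split_ifs at h with h1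
    simp only [Option.some.injEq, Prod.mk.injEq] at h
    obtain ⟨⟨rfl, rfl, rfl⟩, rfl⟩ := h
    exact ⟨rfl, rfl, h1.1, hw, h1.2.1, h1.2.2, rfl⟩
  · rintro ⟨rfl, rfl, h1, h2, h3, h4, rfl⟩
    exact ⟨c, h2, by rw [if_pos ⟨h1, h3, h4⟩]⟩

/-- For one edge, distinct neighbors give distinct third vertices. Across edges, the two smallest
vertices of the triangle recover the edge. -/
theorem nodup_triangleList {A : ℕ → ℕ} (hE : SimpleEdges E) : (triangleList A E).Nodup := by
  rw [triangleList, List.nodup_flatMap]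
  constructor
  · intro e _
    refine (hE.nodup_nbrs _).filterMap ?_
    intro w w' q h1 h2
    simp only [edgeTriangle, Option.mem_def] at h1 h2
    split_ifs at h1 h2
    simp only [Option.some.injEq] at h1 h2
    rw [← h2] at h1
    simp only [Prod.mk.injEq] at h1
    exact h1.1.2.2
  · have := hE.2
    rw [List.Nodup, List.pairwise_map] at this
    refine this.imp fun {e e'} hne => ?_
    rintro ⟨q, s⟩ h1 h2
    rw [mem_edgeTriangles] at h1 h2
    refine hne ?_
    have key : ∀ e : Fin n × Fin n × ℤ, s(e.1, e.2.1) = s(min e.1 e.2.1, max e.1 e.2.1) := by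
      intro e
      rcases le_total e.1 e.2.1 with h | h
      · rw [min_eq_left h, max_eq_right h]
      · rw [min_eq_right h, max_eq_left h]; exact Sym2.eq_swap
    rw [key e, key e', ← h1.1, ← h1.2.1, ← h2.1, ← h2.2.1]

/-- Each matrix entry is the weight plus `S`, so a triangle accumulates `3 * S`. -/
theorem mem_triangleList {S : ℕ} {A : ℕ → ℕ} (hE : SimpleEdges E) (hA : AdjMat S E A)
    {a b c : Fin n} {s : ℕ} : ((a, b, c), s) ∈ triangleList A E ↔
      a < b ∧ b < c ∧ ∃ u v w : ℤ, ArcIn E a b u ∧ ArcIn E b c v ∧ ArcIn E a c w ∧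
        (s : ℤ) = 3 * S + (u + v + w) := by
  rw [triangleList, List.mem_flatMap]
  constructor
  · rintro ⟨e, he, h⟩
    obtain ⟨h1, h2, h3, -, h4, h5, h6⟩ := mem_edgeTriangles.mp h
    simp only at h1 h2 h3 h4 h5 h6
    have hab : a < b := by
      rw [h1, h2, min_lt_max]
      exact hE.1 e he
    have harc : ArcIn E a b e.2.2 := by
      rcases le_total e.1 e.2.1 with h | h
      · rw [h1, h2, min_eq_left h, max_eq_right h]; exact Or.inl he
      · rw [h1, h2, min_eq_right h, max_eq_left h]; exact Or.inr he
    obtain ⟨w, hw, ew⟩ := (hA a c).2 h4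
    obtain ⟨v, hv, ev⟩ := (hA b c).2 h5
    refine ⟨hab, h3, _, v, w, harc, hv, hw, ?_⟩
    have := hA.val_eq hE harc
    rw [h6]
    push_cast
    linarith
  · rintro ⟨hab, hbc, u, v, w, hu, hv, hw, hs⟩
    have hs' : s = A (a * n + b) + A (b * n + c) + A (a * n + c) := by
      have h1 := hA.val_eq hE hu
      have h2 := hA.val_eq hE hv
      have h3 := hA.val_eq hE hw
      omega
    -- The largest vertex is adjacent to both ends, so it is found whichever of them is the pivot.
    have hc : ∀ z, z = a ∨ z = b → c ∈ nbrs E z := by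
      rintro z (rfl | rfl)
      · exact mem_nbrs.mpr ⟨w, hw⟩
      · exact mem_nbrs.mpr ⟨v, hv⟩
    rcases hu with hu | hu
    · refine ⟨_, hu, mem_edgeTriangles.mpr ⟨(min_eq_left hab.le).symm, (max_eq_right hab.le).symm,
        hbc, hc _ ?_, hA.ne_zero hw, hA.ne_zero hv, hs'⟩⟩
      unfold pivot
      split_ifs <;> simp
    · refine ⟨_, hu, mem_edgeTriangles.mpr ⟨(min_eq_right hab.le).symm, (max_eq_left hab.le).symm,
        hbc, hc _ ?_, hA.ne_zero hw, hA.ne_zero hv, hs'⟩⟩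
      unfold pivot
      split_ifs <;> simp

theorem length_triangleList_le (A : ℕ → ℕ) (E : List (Fin n × Fin n × ℤ)) :
    (triangleList A E).length ≤ scanCost E := by
  rw [triangleList, List.length_flatMap, scanCost]
  refine List.sum_le_sum fun e _ => ?_
  exact List.length_filterMap_le _ _

end

/-! ### Enumerating the triangles -/

/-- Computes the sum of the absolute values of the weights, plus one; the local variables are the
numbers of edges and vertices. The words for the graph start at the position `o`. -/
def sumCmd (o : ℕ) : Cmd :=
  .store 9 0 1 ;; .forV 0 (.store 9 0 (.a 9 0 + .a 0 (4 * .v 0 + .c (o + 6))))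

/-- Computes the weight matrix and the lists of neighbors; the local variables are the increment of
the weights and the numbers of edges and vertices. -/
def fillCmd (o : ℕ) : Cmd :=
  .forV 1 <| .letE (.a 0 (4 * .v 0 + .c (o + 3))) <| .letE (.a 0 (4 * .v 1 + .c (o + 4))) <|
    .letE (.v 3 + (1 - .a 0 (4 * .v 2 + .c (o + 5))) * .a 0 (4 * .v 2 + .c (o + 6)) -
      .a 0 (4 * .v 2 + .c (o + 5)) * .a 0 (4 * .v 2 + .c (o + 6))) <|
    .store 3 (.v 2 * .v 6 + .v 1) (.v 0) ;; .store 3 (.v 1 * .v 6 + .v 2) (.v 0) ;;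
    .store 6 (.v 2 * .v 6 + .a 7 (.v 2)) (.v 1) ;; .store 7 (.v 2) (.a 7 (.v 2) + 1) ;;
    .store 6 (.v 1 * .v 6 + .a 7 (.v 1)) (.v 2) ;; .store 7 (.v 1) (.a 7 (.v 1) + 1)

/-- Writes the triangles into the bank 8. -/
def enumCmd (o : ℕ) : Cmd :=
  .forV 1 <| .letE (.a 0 (4 * .v 0 + .c (o + 3))) <| .letE (.a 0 (4 * .v 1 + .c (o + 4))) <|
    .letE (.op .lt (.v 1) (.v 0) * .v 1 + (1 - .op .lt (.v 1) (.v 0)) * .v 0) <|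
    .letE (.v 2 + .v 1 - .v 0) <|
    .letE (.op .lt (.a 7 (.v 3)) (.a 7 (.v 2)) * .v 3 +
      (1 - .op .lt (.a 7 (.v 3)) (.a 7 (.v 2))) * .v 2) <|
    .letE (.a 7 (.v 0)) <|
    .forV 0 <| .letE (.a 6 (.v 2 * .v 10 + .v 0)) <|
      .ite (.op .lt (.v 4) (.v 0)) (.ite (.a 3 (.v 5 * .v 11 + .v 0))
        (.ite (.a 3 (.v 4 * .v 11 + .v 0))
          (.push 8 (.v 5) ;; .push 8 (.v 4) ;; .push 8 (.v 0) ;;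
            .push 8 (.a 3 (.v 5 * .v 11 + .v 4) + .a 3 (.v 4 * .v 11 + .v 0) +
              .a 3 (.v 5 * .v 11 + .v 0)))
          .skip) .skip) .skip

/-- Enumerates the triangles and continues with `post`; the local variables are then the number of
triangles, the increment of the weights and the numbers of edges and vertices. -/
def triangleCmd (o : ℕ) (post : Cmd) : Cmd :=
  .letE (.a 0 (.c (o + 1))) <| .letE (.a 0 (.c (o + 2))) <|
    sumCmd o ;; .letE (.a 9 0) (fillCmd o ;; enumCmd o ;; .letE (.a 8 0 / 4) post)

/-- The words for a triangle and its weight. -/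
def triangleWords {n : ℕ} (q : (Fin n × Fin n × Fin n) × ℕ) : List ℕ :=
  [q.1.1.val, q.1.2.1.val, q.1.2.2.val, q.2]

/-! ### The weight matrix and the neighbor lists -/

section
variable {B o n m S : ℕ} {E : List (Fin n × Fin n × ℤ)} {env : List ℕ} {σ : Banks}

/-- The bank `I` holds the edges, starting after the position `o + 2`. -/
def EdgeInput (o : ℕ) (E : List (Fin n × Fin n × ℤ)) (I : ℕ → ℕ) : Prop :=
  ∀ k (hk : k < E.length), I (4 * k + (o + 3)) = E[k].1 ∧ I (4 * k + (o + 4)) = E[k].2.1 ∧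
    I (4 * k + (o + 5)) = (if E[k].2.2 < 0 then 1 else 0) ∧
    I (4 * k + (o + 6)) = E[k].2.2.natAbs

/-- The sum of the absolute values of the weights, plus one. -/
def weightBound (E : List (Fin n × Fin n × ℤ)) : ℕ := 1 + (E.map fun e => e.2.2.natAbs).sum

theorem natAbs_lt_weightBound {e : Fin n × Fin n × ℤ} (he : e ∈ E) :
    e.2.2.natAbs < weightBound E := by
  have := List.single_le_sum (l := E.map fun e => e.2.2.natAbs) (by simp) _
    (List.mem_map_of_mem he)
  rw [weightBound]
  omega

theorem Runs.sumCmd (hm : m = E.length) (hin : EdgeInput o E (σ 0)) (hB : 4 * m + o + 6 ≤ B)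
    (hS : weightBound E ≤ B) :
    Runs B (sumCmd o) (m :: env) σ (1 + (1 + m * (1 + 1))) fun σ' => ∃ p,
      σ' = Function.update σ 9 p ∧ p 0 = weightBound E := by
  refine Runs.seq (Runs.store (by simp) (by simp; omega) ?_)
  refine Runs.forV_const (t := 1) (fun k σ' => ∃ p, σ' = Function.update σ 9 p ∧
    p 0 = weightBound (E.take k)) ⟨_, rfl, by simp [weightBound]⟩ ?_ ?_
  · rintro k hk _ ⟨p, rfl, hp⟩
    have hk' : k < m := hk
    have hkE : k < E.length := hm ▸ hk'
    have h1 := (hin k hkE).2.2.2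
    have hstep : weightBound (E.take (k + 1)) = weightBound (E.take k) + E[k].2.2.natAbs := by
      rw [weightBound, weightBound, List.take_add_one, List.getElem?_eq_getElem hkE]
      simp only [Option.toList_some, List.map_append, List.sum_append, List.map_cons, List.map_nil,
        List.sum_cons, List.sum_nil]
      omega
    have hle : weightBound (E.take (k + 1)) ≤ weightBound E := by
      unfold weightBound
      gcongr
      exact ((List.take_sublist _ _).map _).sum_le_sum (by simp)
    refine Runs.store (by simp) ?_ ⟨Function.update p 0 (weightBound (E.take (k + 1))), ?_, by simp⟩
    · simp [hp, h1]
      omega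
    · simp [hp, h1, hstep]
  · rintro _ ⟨p, rfl, hp⟩
    refine ⟨p, rfl, ?_⟩
    simpa [hm] using hp

theorem AdjMat.step {k : ℕ} {A : ℕ → ℕ} {w : ℕ} (hA : AdjMat S (E.take k) A) (hk : k < E.length)
    (hw : (w : ℤ) = S + E[k].2.2) (hw0 : w ≠ 0) :
    AdjMat S (E.take (k + 1)) (Function.update (Function.update A (E[k].1 * n + E[k].2.1) w)
      (E[k].2.1 * n + E[k].1) w) := by
  have harc : ∀ u v w, ArcIn (E.take (k + 1)) u v w ↔ ArcIn (E.take k) u v w ∨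
      ((u, v, w) = E[k] ∨ (v, u, w) = E[k]) := by
    intro u v w
    rw [List.take_add_one, List.getElem?_eq_getElem hk]
    simp only [ArcIn, Option.toList_some, List.mem_append, List.mem_singleton]
    tauto
  generalize E[k] = e at *
  obtain ⟨x, y, z⟩ := e
  simp only at hw
  intro u v
  simp only [harc, Prod.mk.injEq]
  by_cases h1 : u = y ∧ v = x
  · obtain ⟨rfl, rfl⟩ := h1
    rw [Function.update_self]
    exact ⟨fun h => absurd h hw0, fun _ => ⟨z, by simp, hw⟩⟩
  by_cases h2 : u = x ∧ v = y
  · obtain ⟨rfl, rfl⟩ := h2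
    rw [Function.update_of_ne, Function.update_self]
    · exact ⟨fun h => absurd h hw0, fun _ => ⟨z, by simp, hw⟩⟩
    · rw [Ne, mul_add_inj v.2 u.2, Fin.val_inj, Fin.val_inj]
      exact h1
  · rw [Function.update_of_ne, Function.update_of_ne]
    · obtain ⟨h3, h4⟩ := hA u v
      constructor
      · rintro h w (h5 | ⟨h5, h6, -⟩ | ⟨h5, h6, -⟩)
        · exact h3 h w h5
        · exact h2 ⟨h5, h6⟩
        · exact h1 ⟨h6, h5⟩
      · intro h
        obtain ⟨w, h5, h6⟩ := h4 h
        exact ⟨w, Or.inl h5, h6⟩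
    · rw [Ne, mul_add_inj v.2 y.2, Fin.val_inj, Fin.val_inj]
      exact h2
    · rw [Ne, mul_add_inj v.2 x.2, Fin.val_inj, Fin.val_inj]
      exact h1

/-- Rows of `J` hold the lists `L u`, whose lengths are in `D`. -/
def RowsHold (L : Fin n → List (Fin n)) (J D : ℕ → ℕ) : Prop :=
  ∀ u : Fin n, D u = (L u).length ∧ ∀ i (hi : i < (L u).length), J (u * n + i) = (L u)[i]

theorem RowsHold.push {L : Fin n → List (Fin n)} {J D : ℕ → ℕ} (h : RowsHold L J D)
    (hL : ∀ u, (L u).length ≤ n) {x : Fin n} (hx : (L x).length < n) (y : Fin n) :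
    RowsHold (fun u => if u = x then L u ++ [y] else L u)
      (Function.update J (x * n + D x) y) (Function.update D x (D x + 1)) := by
  intro u
  by_cases e : u = x
  · subst e
    simp only [if_true, Function.update_self, (h u).1, List.length_append, List.length_singleton,
      true_and]
    intro i hi
    by_cases e : i = (L u).length
    · subst e
      simp
    · have hi' : i < (L u).length := by omega
      rw [Function.update_of_ne (by omega), List.getElem_append_left hi']
      exact (h u).2 i hi'
  · simp only [if_neg e]
    rw [Function.update_of_ne (fun h => e (Fin.ext h))]
    refine ⟨(h u).1, fun i hi => ?_⟩
    rw [Function.update_of_ne]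
    · exact (h u).2 i hi
    · rw [Ne, mul_add_inj (hi.trans_le (hL u)) ((h x).1 ▸ hx)]
      exact fun h' => e (Fin.ext h'.1)

/-- The second endpoint's degree is read after the first one was incremented, which is harmless
because the endpoints differ. In a simple graph no degree reaches `n` before its list is extended,
so a row of `n` cells never overflows into the next. -/
theorem NbrMat.step {k : ℕ} {J D : ℕ → ℕ} (hE : SimpleEdges E) (h : NbrMat (E.take k) J D)
    (hk : k < E.length) :
    D E[k].1 < n ∧ Function.update D E[k].1 (D E[k].1 + 1) E[k].2.1 < n ∧
    NbrMat (E.take (k + 1))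
      (Function.update (Function.update J (E[k].1 * n + D E[k].1) E[k].2.1)
        (E[k].2.1 * n + Function.update D E[k].1 (D E[k].1 + 1) E[k].2.1) E[k].1)
      (Function.update (Function.update D E[k].1 (D E[k].1 + 1)) E[k].2.1
        (Function.update D E[k].1 (D E[k].1 + 1) E[k].2.1 + 1)) := by
  have hsub := hE.sublist (List.take_sublist (k + 1) E)
  have hne : E[k].1 ≠ E[k].2.1 := hE.1 _ (List.getElem_mem hk)
  have hlen := fun u => hsub.length_nbrs_le u
  have hnb : ∀ u, nbrs (E.take (k + 1)) u = nbrs (E.take k) u ++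
      if E[k].1 = u then [E[k].2.1] else if E[k].2.1 = u then [E[k].1] else [] := by
    intro u
    rw [List.take_add_one, List.getElem?_eq_getElem hk]
    exact nbrs_append_singleton _ _ _
  generalize E[k] = e at *
  obtain ⟨x, y, z⟩ := e
  simp only at hne hnb ⊢
  have hlen' : ∀ u, (nbrs (E.take k) u).length ≤ n :=
    fun u => (hE.sublist (List.take_sublist k E)).length_nbrs_le u
  have hx := hlen x
  have hy := hlen y
  rw [hnb, List.length_append, if_pos rfl, List.length_singleton] at hx
  rw [hnb, List.length_append, if_neg hne, if_pos rfl, List.length_singleton] at hy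
  have hyx : Function.update D x (D x + 1) y = D y :=
    Function.update_of_ne (fun h => hne (Fin.ext h.symm)) _ _
  refine ⟨by rw [(h x).1]; omega, by rw [hyx, (h y).1]; omega, ?_⟩
  have h1 := RowsHold.push (L := nbrs (E.take k)) h hlen' (x := x) (by omega) y
  have h2 := h1.push (x := y) (by
    intro u
    split_ifs with e
    · subst e; rw [List.length_append, List.length_singleton]; omega
    · exact hlen' u) (by rw [if_neg hne.symm]; omega) x
  intro u
  have h3 := h2 u
  have e : (if u = y then (if u = x then nbrs (E.take k) u ++ [y] else nbrs (E.take k) u) ++ [x]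
      else if u = x then nbrs (E.take k) u ++ [y] else nbrs (E.take k) u) =
      nbrs (E.take (k + 1)) u := by
    rw [hnb]
    by_cases e1 : u = x
    · subst e1; simp [hne]
    · by_cases e2 : u = y
      · subst e2; simp [hne, e1]
      · simp [e1, e2, Ne.symm e1, Ne.symm e2]
  simp only [e] at h3
  exact h3

theorem Runs.fillCmd (hm : m = E.length) (hE : SimpleEdges E) (hS : S = weightBound E)
    (hin : EdgeInput o E (σ 0)) (hB : 4 * m + o + 6 ≤ B)
    (hSB : 2 * S ≤ B) (hn : n * n + n ≤ B) (h3 : σ 3 = fun _ => 0) (h7 : σ 7 = fun _ => 0) :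
    Runs B (fillCmd o) (S :: m :: n :: env) σ (1 + m * (1 + (1 + (1 + (1 + (1 + (1 + (1 + (1 + 1)))))))
      + 1)) fun σ' => ∃ A J D,
      σ' = Function.update (Function.update (Function.update σ 3 A) 6 J) 7 D ∧
      AdjMat S E A ∧ NbrMat E J D := by
  refine Runs.forV_const (t := 1 + (1 + (1 + (1 + (1 + (1 + (1 + (1 + 1))))))))
    (fun k σ' => ∃ A J D,
      σ' = Function.update (Function.update (Function.update σ 3 A) 6 J) 7 D ∧
      AdjMat S (E.take k) A ∧ NbrMat (E.take k) J D)
    ⟨σ 3, σ 6, σ 7, by simp, by simp [AdjMat, h3, ArcIn], by simp [NbrMat, h7, nbrs]⟩ ?_ ?_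
  · rintro k hk _ ⟨A, J, D, rfl, hA, hJ⟩
    have hk' : k < m := hk
    have hkE : k < E.length := hm ▸ hk'
    obtain ⟨i1, i2, i3, i4⟩ := hin k hkE
    have hw := natAbs_lt_weightBound (List.getElem_mem hkE)
    rw [← hS] at hw
    obtain ⟨d1, d2, hJ'⟩ := hJ.step hE hkE
    have hx : E[k].1.val < n := Fin.isLt _
    have hy : E[k].2.1.val < n := Fin.isLt _
    -- The sign bit selects whether the absolute value is added or subtracted. Since `S` exceeds
    -- every absolute value, the truncated subtraction is exact and the result is nonzero, so 0 can
    -- stand for a missing edge.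
    set W : ℕ := S + (1 - if E[k].2.2 < 0 then 1 else 0) * E[k].2.2.natAbs -
      (if E[k].2.2 < 0 then 1 else 0) * E[k].2.2.natAbs with hW
    have hW1 : (W : ℤ) = S + E[k].2.2 := by
      rw [hW]
      split_ifs <;> omega
    have hW0 : W ≠ 0 := by omega
    have hA' := hA.step hkE hW1 hW0
    have l1 := mul_add_lt hx hy
    have l2 := mul_add_lt hy hx
    have l3 := mul_add_lt hx d1
    have l4 := mul_add_lt hy d2
    refine Runs.letE (by simp; omega) ?_
    have v1 : (Ex.a 0 (4 * .v 0 + .c (o + 3))).val (k :: S :: m :: n :: env)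
        (Function.update (Function.update (Function.update σ 3 A) 6 J) 7 D) = E[k].1 := by
      simp [i1]
    rw [v1]
    refine Runs.letE (by simp; omega) ?_
    have v2 : (Ex.a 0 (4 * .v 1 + .c (o + 4))).val (E[k].1.val :: k :: S :: m :: n :: env)
        (Function.update (Function.update (Function.update σ 3 A) 6 J) 7 D) = E[k].2.1 := by
      simp [i2]
    rw [v2]
    refine Runs.letE ?_ ?_
    · have e1 : (1 - if E[k].2.2 < 0 then 1 else 0) * E[k].2.2.natAbs ≤ E[k].2.2.natAbs := by
        split_ifs <;> omega
      have e2 : (if E[k].2.2 < 0 then E[k].2.2.natAbs else 0) ≤ E[k].2.2.natAbs := by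
        split_ifs <;> omega
      simp [i3, i4]
      omega
    have v3 : (Ex.v 3 + (1 - .a 0 (4 * .v 2 + .c (o + 5))) * .a 0 (4 * .v 2 + .c (o + 6)) -
        .a 0 (4 * .v 2 + .c (o + 5)) * .a 0 (4 * .v 2 + .c (o + 6))).val
        (E[k].2.1.val :: E[k].1.val :: k :: S :: m :: n :: env)
        (Function.update (Function.update (Function.update σ 3 A) 6 J) 7 D) = W := by
      simp [i3, i4, hW]
    rw [v3]
    refine Runs.seq (Runs.store (by simp; omega) (by simp)
      (Runs.seq (Runs.store (by simp; omega) (by simp)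
      (Runs.seq (Runs.store ?_ (by simp)
      (Runs.seq (Runs.store (by simp) ?_
      (Runs.seq (Runs.store ?_ (by simp)
      (Runs.store (by simp) ?_ ⟨_, _, _, ?_, hA', hJ'⟩))))))))))
    · simp; omega
    · simp; omega
    · simp; omega
    · simp; omega
    · simp [Function.update_comm]
  · rintro _ ⟨A, J, D, rfl, hA, hJ⟩
    refine ⟨A, J, D, rfl, ?_⟩
    simpa [hm] using And.intro hA hJ

end

/-! ### Correctness of the enumeration -/

section
variable {B o n m S : ℕ} {E : List (Fin n × Fin n × ℤ)} {env : List ℕ} {σ : Banks}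

theorem AdjMat.le {A : ℕ → ℕ} (hA : AdjMat S E A) (hS : S = weightBound E) (u v : Fin n) :
    A (u * n + v) ≤ 2 * S := by
  by_cases h : A (u * n + v) = 0
  · omega
  · obtain ⟨w, hw, e⟩ := (hA u v).2 h
    have : w.natAbs < S := by
      rw [hS]
      rcases hw with hw | hw
      · exact natAbs_lt_weightBound hw
      · exact natAbs_lt_weightBound hw
    omega

theorem sum_range_getD (l : List ℕ) : ∑ k ∈ Finset.range l.length, l.getD k 0 = l.sum := by
  induction l with
  | nil => simp
  | cons a l ih =>
    rw [List.length_cons, Finset.sum_range_succ']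
    simp only [List.getD_cons_succ, List.getD_cons_zero, ih, List.sum_cons]
    omega

theorem length_triangleWords (l : List ((Fin n × Fin n × Fin n) × ℕ)) :
    (l.flatMap triangleWords).length = 4 * l.length :=
  length_flatMap_const _ _ fun _ => rfl

/-- The scan for a single edge, with a constant number of steps per neighbor of the pivot; the three
nested tests are exactly the condition in `edgeTriangle`. -/
theorem Runs.enumEdge {e : Fin n × Fin n × ℤ} {k d : ℕ} {l : List ((Fin n × Fin n × Fin n) × ℕ)}
    (hA : AdjMat S E (σ 3)) (hJ : NbrMat E (σ 6) (σ 7)) (hS : S = weightBound E)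
    (hd : d = (nbrs E (pivot E e)).length) (hn : n * n + n ≤ B) (hSB : 6 * S ≤ B)
    (hdn : d ≤ n)
    (hB : 4 * (l.length + d) + 4 ≤ B) :
    Runs B (.forV 0 <| .letE (.a 6 (.v 2 * .v 10 + .v 0)) <|
      .ite (.op .lt (.v 4) (.v 0)) (.ite (.a 3 (.v 5 * .v 11 + .v 0))
        (.ite (.a 3 (.v 4 * .v 11 + .v 0))
          (.push 8 (.v 5) ;; .push 8 (.v 4) ;; .push 8 (.v 0) ;;
            .push 8 (.a 3 (.v 5 * .v 11 + .v 4) + .a 3 (.v 4 * .v 11 + .v 0) +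
              .a 3 (.v 5 * .v 11 + .v 0)))
          .skip) .skip) .skip)
      (d :: (pivot E e).val :: (max e.1 e.2.1).val :: (min e.1 e.2.1).val :: e.2.1.val :: e.1.val ::
        k :: S :: m :: n :: env)
      (Function.update σ 8 (loadInput (l.flatMap triangleWords))) (1 + d * 13)
      fun σ' => σ' = Function.update σ 8
        (loadInput ((l ++ edgeTriangles (σ 3) E e).flatMap triangleWords)) := by
  refine Runs.forV_const (t := 1 + (1 + (1 + (1 + (2 + (2 + (2 + 2)))))))
    (fun i σ' => σ' = Function.update σ 8
      (loadInput ((l ++ ((nbrs E (pivot E e)).take i).filterMap (edgeTriangle (σ 3) e)).flatMap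
        triangleWords))) (by simp) ?_ ?_
  · rintro i hi _ rfl
    have hi' : i < d := hi
    have hiN : i < (nbrs E (pivot E e)).length := hd ▸ hi'
    have hw := (hJ (pivot E e)).2 i hiN
    rw [List.take_add_one, List.getElem?_eq_getElem hiN, List.filterMap_append, ← List.append_assoc]
    have hlen : (l ++ ((nbrs E (pivot E e)).take i).filterMap (edgeTriangle (σ 3) e)).length ≤
        l.length + d := by
      rw [List.length_append]
      have := List.length_filterMap_le (edgeTriangle (σ 3) e) ((nbrs E (pivot E e)).take i)
      rw [List.length_take] at this
      omega
    have hz : (pivot E e).val < n := Fin.isLt _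
    have l1 := mul_add_lt hz (c := i) (D := n) (by omega)
    set L := l ++ ((nbrs E (pivot E e)).take i).filterMap (edgeTriangle (σ 3) e)
    generalize (nbrs E (pivot E e))[i] = w at *
    generalize hx : min e.1 e.2.1 = a at *
    generalize hy : max e.1 e.2.1 = b at *
    have htri : edgeTriangle (σ 3) e w = if b < w ∧ σ 3 (a * n + w) ≠ 0 ∧ σ 3 (b * n + w) ≠ 0 then
        some ((a, b, w), σ 3 (a * n + b) + σ 3 (b * n + w) + σ 3 (a * n + w)) else none := by
      subst hx hy
      rfl
    have haw := mul_add_lt a.2 w.2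
    have hbw := mul_add_lt b.2 w.2
    have hab := mul_add_lt a.2 b.2
    have m1 := hA.le hS a w
    have m2 := hA.le hS b w
    have m3 := hA.le hS a b
    have hLlen := length_triangleWords L
    rw [show (some w).toList.filterMap (edgeTriangle (σ 3) e) = (edgeTriangle (σ 3) e w).toList by
      cases h : edgeTriangle (σ 3) e w <;> simp [h]]
    refine Runs.letE (by simp; omega) ?_
    have v1 : (Ex.a 6 (.v 2 * .v 10 + .v 0)).val (i :: d :: (pivot E e).val :: b.val :: a.val ::
        e.2.1.val :: e.1.val :: k :: S :: m :: n :: env)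
        (Function.update σ 8 (loadInput (L.flatMap triangleWords))) = w := by
      simp [hw]
    rw [v1]
    have hskip : ¬ (b < w ∧ σ 3 (a * n + w) ≠ 0 ∧ σ 3 (b * n + w) ≠ 0) →
        Function.update σ 8 (loadInput (L.flatMap triangleWords)) = Function.update σ 8
          (loadInput ((L ++ (edgeTriangle (σ 3) e w).toList).flatMap triangleWords)) := by
      intro h
      rw [htri, if_neg h]
      simp
    refine Runs.ite (by simp) (fun h1 => Runs.ite (by simp; omega) (fun h2 =>
      Runs.ite (by simp; omega) (fun h3 => ?_) fun h3 => ?_) fun h2 => ?_) fun h1 => ?_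
    · simp at h1 h2 h3
      refine Runs.seq (Runs.push (by simp; rfl) (by simp) (by omega)
        (Runs.seq (Runs.push (by simp; rfl) (by simp) (by
          simp only [List.length_append, List.length_cons, List.length_nil]; omega)
        (Runs.seq (Runs.push (by simp; rfl) (by simp) (by
          simp only [List.length_append, List.length_cons, List.length_nil]; omega)
        (Runs.push (by simp; rfl) (by simp; omega) (by
          simp only [List.length_append, List.length_cons, List.length_nil]; omega) ?_))))))
      rw [htri, if_pos ⟨h1, h2, h3⟩]
      simp [triangleWords]
    · simp at h3
      exact Runs.time_le (T₁ := 1) (Runs.skip (hskip fun h => h.2.2 h3)) (by omega)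
    · simp at h2
      exact Runs.time_le (T₁ := 1) (Runs.skip (hskip fun h => h.2.1 h2)) (by omega)
    · simp at h1
      exact Runs.time_le (T₁ := 1) (Runs.skip (hskip fun h => absurd h.1 (not_lt.mpr h1))) (by omega)
  · rintro _ rfl
    simp [hd, edgeTriangles]

/-- The rounds have different lengths, and the sum of the pivot degrees over all edges is
`scanCost`. Minimum, maximum and pivot are computed arithmetically: a 0/1 comparison selects one of
two values, and the maximum is the sum minus the minimum. -/
theorem Runs.enumCmd (hm : m = E.length) (hE : SimpleEdges E) (hS : S = weightBound E)
    (hin : EdgeInput o E (σ 0)) (hA : AdjMat S E (σ 3)) (hJ : NbrMat E (σ 6) (σ 7))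
    (h8 : σ 8 = fun _ => 0) (hB : 4 * m + o + 6 ≤ B) (hn : n * n + 3 * n ≤ B) (hSB : 6 * S ≤ B)
    (hR : 4 * scanCost E + 4 ≤ B) :
    Runs B (enumCmd o) (S :: m :: n :: env) σ (1 + 8 * m + 13 * scanCost E) fun σ' =>
      σ' = Function.update σ 8 (loadInput ((triangleList (σ 3) E).flatMap triangleWords)) := by
  let f := fun e => (nbrs E (pivot E e)).length
  have htime : 1 + ∑ k ∈ Finset.range m,
      ((1 + (1 + (1 + (1 + (1 + (1 + (1 + (E.map f).getD k 0 * 13))))))) + 1) =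
      1 + 8 * m + 13 * scanCost E := by
    have := sum_range_getD (E.map f)
    rw [List.length_map, ← hm] at this
    rw [scanCost, ← this, Finset.sum_congr rfl fun k _ => (by ring :
      _ = 8 + 13 * (E.map f).getD k 0), Finset.sum_add_distrib, ← Finset.mul_sum, Finset.sum_const,
      Finset.card_range, smul_eq_mul]
    ring
  have hlen : ∀ k (hk : k < E.length), ((E.take k).flatMap (edgeTriangles (σ 3) E)).length +
      f E[k] ≤ scanCost E := by
    intro k hk
    have h1 : ((E.take k).flatMap (edgeTriangles (σ 3) E)).length ≤ ((E.take k).map f).sum := by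
      rw [List.length_flatMap]
      exact List.sum_le_sum fun e _ => List.length_filterMap_le _ _
    have h2 : ((E.take k).map f).sum + f E[k] = ((E.take (k + 1)).map f).sum := by
      rw [List.take_add_one, List.getElem?_eq_getElem hk]
      simp only [Option.toList_some, List.map_append, List.sum_append, List.map_cons, List.map_nil,
        List.sum_cons, List.sum_nil, add_zero]
    have h3 : ((E.take (k + 1)).map f).sum ≤ (E.map f).sum :=
      ((List.take_sublist _ _).map _).sum_le_sum (by simp)
    have h4 : scanCost E = (E.map f).sum := rfl
    omega
  rw [← htime]
  refine Runs.forV (fun k σ' => σ' = Function.update σ 8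
    (loadInput (((E.take k).flatMap (edgeTriangles (σ 3) E)).flatMap triangleWords)))
    (by simp [← h8]) ?_ ?_
  · rintro k hk _ rfl
    have hk' : k < m := hk
    have hkE : k < E.length := hm ▸ hk'
    obtain ⟨i1, i2, -⟩ := hin k hkE
    have hlen' := hlen k hkE
    have hfk : (E.map f).getD k 0 = f E[k] := by
      rw [List.getD_eq_getElem _ _ (by simpa using hkE)]
      simp
    rw [hfk]
    have hstep : (E.take (k + 1)).flatMap (edgeTriangles (σ 3) E) =
        (E.take k).flatMap (edgeTriangles (σ 3) E) ++ edgeTriangles (σ 3) E E[k] := by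
      rw [List.take_add_one, List.getElem?_eq_getElem hkE, List.flatMap_append, Option.toList_some,
        List.flatMap_singleton]
    rw [hstep]
    set l := (E.take k).flatMap (edgeTriangles (σ 3) E)
    set σ₁ := Function.update σ 8 (loadInput (l.flatMap triangleWords)) with hσ₁
    set e := E[k] with he
    have hx : e.1.val < n := Fin.isLt _
    have hy : e.2.1.val < n := Fin.isLt _
    have hnn : n ≤ n * n := Nat.le_mul_of_pos_left _ (by omega)
    have hdx := (hJ e.1).1
    have hdy := (hJ e.2.1).1
    have hdp := (hJ (pivot E e)).1
    have h7 : σ₁ 7 = σ 7 := by simp [hσ₁]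
    have h0 : σ₁ 0 = σ 0 := by simp [hσ₁]
    refine Runs.letE (by simp; omega) ?_
    have v1 : (Ex.a 0 (4 * .v 0 + .c (o + 3))).val (k :: S :: m :: n :: env) σ₁ = e.1 := by
      simp [h0, i1, he]
    rw [v1]
    refine Runs.letE (by simp; omega) ?_
    have v2 : (Ex.a 0 (4 * .v 1 + .c (o + 4))).val (e.1.val :: k :: S :: m :: n :: env) σ₁ =
        e.2.1 := by
      simp [h0, i2, he]
    rw [v2]
    refine Runs.letE ?_ ?_
    · by_cases h : e.1.val < e.2.1.val <;> simp [h] <;> omega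
    have v3 : (.op .lt (.v 1) (.v 0) * .v 1 + (1 - .op .lt (.v 1) (.v 0)) * .v 0 : Ex).val
        (e.2.1.val :: e.1.val :: k :: S :: m :: n :: env) σ₁ = (min e.1 e.2.1 : Fin n) := by
      rcases lt_or_ge e.1 e.2.1 with h | h
      · rw [min_eq_left h.le]
        have h' : e.1.val < e.2.1.val := h
        simp [h']
      · rw [min_eq_right h]
        have h' : ¬ e.1.val < e.2.1.val := not_lt.mpr h
        simp [h']
    rw [v3]
    refine Runs.letE (by simp; omega) ?_
    have v4 : (.v 2 + .v 1 - .v 0 : Ex).val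
        ((min e.1 e.2.1 : Fin n).val :: e.2.1.val :: e.1.val :: k :: S :: m :: n :: env) σ₁ =
        (max e.1 e.2.1 : Fin n) := by
      rcases le_total e.1 e.2.1 with h | h
      · rw [min_eq_left h, max_eq_right h]; simp
      · rw [min_eq_right h, max_eq_left h]; simp
    rw [v4]
    refine Runs.letE ?_ ?_
    · by_cases h : (nbrs E e.1).length < (nbrs E e.2.1).length <;>
        simp [h7, hdx, hdy, h] <;> omega
    have v5 : (.op .lt (.a 7 (.v 3)) (.a 7 (.v 2)) * .v 3 +
        (1 - .op .lt (.a 7 (.v 3)) (.a 7 (.v 2))) * .v 2 : Ex).val ((max e.1 e.2.1 : Fin n).val ::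
        (min e.1 e.2.1 : Fin n).val :: e.2.1.val :: e.1.val :: k :: S :: m :: n :: env) σ₁ =
        pivot E e := by
      unfold pivot
      by_cases h : (nbrs E e.1).length < (nbrs E e.2.1).length <;> simp [h7, hdx, hdy, h]
    rw [v5]
    refine Runs.letE (by simp) ?_
    have v6 : (Ex.a 7 (.v 0)).val ((pivot E e).val :: (max e.1 e.2.1 : Fin n).val ::
        (min e.1 e.2.1 : Fin n).val :: e.2.1.val :: e.1.val :: k :: S :: m :: n :: env) σ₁ =
        f e := by
      simp [h7, hdp, f]
    rw [v6]
    exact Runs.enumEdge hA hJ hS rfl (by omega) hSB (hE.length_nbrs_le _) (by omega)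
  · rintro _ rfl
    have e : (S :: m :: n :: env).getD 1 0 = E.length := hm
    rw [e, List.take_length, triangleList]

theorem Runs.triangleCmd {x : List ℕ} {post : Cmd} {t : ℕ} {Q : Banks → Prop} (hm : m = E.length)
    (hE : SimpleEdges E) (hS : S = weightBound E) (h1 : loadInput x (o + 1) = n)
    (h2 : loadInput x (o + 2) = m) (hin : EdgeInput o E (loadInput x))
    (hB : 4 * m + o + 6 ≤ B) (hn : n * n + 3 * n ≤ B) (hSB : 6 * S ≤ B)
    (hR : 4 * scanCost E + 4 ≤ B)
    (hpost : ∀ A σ, AdjMat S E A → σ 0 = loadInput x →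
      σ 8 = loadInput ((triangleList A E).flatMap triangleWords) → (σ 1 = fun _ => 0) →
      (σ 10 = fun _ => 0) → Runs B post [(triangleList A E).length, S, m, n] σ t Q) :
    Runs B (triangleCmd o post) [] (initBanks x) (30 * m + 13 * scanCost E + 10 + t) Q := by
  refine Runs.time_le (T₁ := 1 + (1 + ((1 + (1 + m * (1 + 1))) + (1 + ((1 + m * (1 + (1 + (1 + (1 +
    (1 + (1 + (1 + (1 + 1))))))) + 1)) + ((1 + 8 * m + 13 * scanCost E) + (1 + t))))))) ?_ (by omega)
  refine Runs.letE (by simp; omega) (Runs.letE (by simp; omega) ?_)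
  have v1 : (Ex.a 0 (.c (o + 1))).val [] (initBanks x) = n := by simp [initBanks, h1]
  have v2 : (Ex.a 0 (.c (o + 2))).val [n] (initBanks x) = m := by simp [initBanks, h2]
  rw [v1, v2]
  refine Runs.seq ((Runs.sumCmd (E := E) hm (by simpa [initBanks] using hin) hB
    (by omega)).mono le_rfl ?_)
  rintro _ ⟨p, rfl, hp⟩
  refine Runs.letE (by simp) ?_
  have v3 : (Ex.a 9 0).val [m, n] (Function.update (initBanks x) 9 p) = S := by simp [hp, hS]
  rw [v3]
  refine Runs.seq ((Runs.fillCmd (E := E) hm hE hS (by simpa [initBanks] using hin) hB (by omega)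
    (by omega) (by simp [initBanks]) (by simp [initBanks])).mono le_rfl ?_)
  rintro _ ⟨A, J, D, rfl, hA, hJ⟩
  refine Runs.seq ((Runs.enumCmd (E := E) hm hE hS (by simpa [initBanks] using hin)
    (by simpa using hA) (by simpa using hJ) (by simp [initBanks]) hB hn hSB hR).mono le_rfl ?_)
  rintro _ rfl
  have hA3 : (Function.update (Function.update (Function.update (Function.update (initBanks x) 9 p) 3
    A) 6 J) 7 D) 3 = A := by simp
  rw [hA3]
  refine Runs.letE (by simp; omega) ?_
  set σ' := Function.update (Function.update (Function.update (Function.update (Function.update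
    (initBanks x) 9 p) 3 A) 6 J) 7 D) 8
      (loadInput ((triangleList A E).flatMap triangleWords)) with hσ'
  have v4 : (.a 8 0 / 4 : Ex).val [S, m, n] σ' = (triangleList A E).length := by
    have : loadInput ((triangleList A E).flatMap triangleWords) 0 =
        4 * (triangleList A E).length := length_triangleWords _
    simp [hσ', this]
  rw [v4]
  exact hpost A σ' hA (by simp [hσ', initBanks]) (by simp [hσ']) (by simp [hσ', initBanks])
    (by simp [hσ', initBanks])

end

/-! ### The triangle problems -/

/-- Outputs the first triangles of negative weight; the local variables are the number of triangles
and the increment of the weights. -/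
def listCmd (e : Ex) : Cmd :=
  .forV 0 (.ite (.op .lt (.a 8 (4 * .v 0 + 4)) (3 * .v 2))
    (.ite (.op .lt (.a 1 0) (3 * e))
      (.push 1 (.a 8 (4 * .v 0 + 1)) ;; .push 1 (.a 8 (4 * .v 0 + 2)) ;;
        .push 1 (.a 8 (4 * .v 0 + 3))) .skip) .skip)

/-- Outputs a triangle of minimum weight. -/
def minCmd : Cmd :=
  .forV 0 (.ite (.op .lt (.a 8 (4 * .v 0 + 4)) (.a 8 (4 * .a 10 0 + 4))) (.store 10 0 (.v 0)) .skip) ;;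
  .ite (.v 0) (.letE (.a 10 0) (.push 1 (.a 8 (4 * .v 0 + 1)) ;; .push 1 (.a 8 (4 * .v 0 + 2)) ;;
    .push 1 (.a 8 (4 * .v 0 + 3)))) .skip

section
variable {B n m S : ℕ} {env : List ℕ} {σ : Banks} {l : List ((Fin n × Fin n × Fin n) × ℕ)}

theorem loadInput_triangleWords {i : ℕ} (hi : i < l.length) :
    loadInput (l.flatMap triangleWords) (4 * i + 1) = l[i].1.1 ∧
    loadInput (l.flatMap triangleWords) (4 * i + 2) = l[i].1.2.1 ∧
    loadInput (l.flatMap triangleWords) (4 * i + 3) = l[i].1.2.2 ∧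
    loadInput (l.flatMap triangleWords) (4 * i + 4) = l[i].2 :=
  ⟨getD_flatMap_const (k := 4) (r := 0) triangleWords l (fun _ => rfl) hi (by omega),
    getD_flatMap_const (k := 4) (r := 1) triangleWords l (fun _ => rfl) hi (by omega),
    getD_flatMap_const (k := 4) (r := 2) triangleWords l (fun _ => rfl) hi (by omega),
    getD_flatMap_const (k := 4) (r := 3) triangleWords l (fun _ => rfl) hi (by omega)⟩

/-- The first `L` triangles of negative weight. -/
def negatives (S L : ℕ) (l : List ((Fin n × Fin n × Fin n) × ℕ)) : List (Fin n × Fin n × Fin n) :=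
  ((l.filter fun q => q.2 < 3 * S).map Prod.fst).take L

/-- The recursion that the loop follows: a new triangle is accepted iff it is negative and the list
has not yet reached length `L`. -/
theorem negatives_append (S L : ℕ) (l : List ((Fin n × Fin n × Fin n) × ℕ))
    (q : (Fin n × Fin n × Fin n) × ℕ) : negatives S L (l ++ [q]) = negatives S L l ++
      if q.2 < 3 * S ∧ (negatives S L l).length < L then [q.1] else [] := by
  simp only [negatives, List.filter_append, List.map_append, List.take_append, List.length_take]
  congr 1
  by_cases h : q.2 < 3 * S
  · simp only [h, List.filter_cons, List.filter_nil, decide_true, if_true, List.map_cons,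
      List.map_nil, true_and]
    by_cases h2 : ((l.filter fun q => q.2 < 3 * S).map Prod.fst).length < L
    · rw [if_pos (by omega), List.take_of_length_le (by simp only [List.length_singleton]; omega)]
    · rw [if_neg (by omega), Nat.sub_eq_zero_of_le (by omega), List.take_zero]
  · simp [h]

theorem length_negatives_le (S L : ℕ) (l : List ((Fin n × Fin n × Fin n) × ℕ)) :
    (negatives S L l).length ≤ l.length := by
  rw [negatives, List.length_take, List.length_map]
  have := List.length_filter_le (fun q : (Fin n × Fin n × Fin n) × ℕ => decide (q.2 < 3 * S)) l
  omega

theorem length_tripleWords (l : List (Fin n × Fin n × Fin n)) :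
    (l.flatMap tripleWords).length = 3 * l.length :=
  length_flatMap_const _ _ fun _ => rfl

theorem Runs.pushTriple {i : ℕ} {o : List ℕ} {Q : Banks → Prop} (hi : i < l.length)
    (h8 : σ 8 = loadInput (l.flatMap triangleWords)) (h1 : σ 1 = loadInput o)
    (hB : 4 * l.length + 4 ≤ B) (ho : o.length + 3 ≤ B)
    (hQ : Q (Function.update σ 1 (loadInput (o ++ tripleWords l[i].1)))) :
    Runs B (.push 1 (.a 8 (4 * .v 0 + 1)) ;; .push 1 (.a 8 (4 * .v 0 + 2)) ;;
        .push 1 (.a 8 (4 * .v 0 + 3))) (i :: env) σ (2 + (2 + 2)) Q := by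
  obtain ⟨r1, r2, r3, -⟩ := loadInput_triangleWords hi
  refine Runs.seq (Runs.push h1 (by simp; omega) (by omega)
    (Runs.seq (Runs.push (by simp; rfl) (by simp; omega) (by
      simp only [List.length_append, List.length_cons, List.length_nil]; omega)
    (Runs.push (by simp; rfl) (by simp; omega) (by
      simp only [List.length_append, List.length_cons, List.length_nil]; omega) ?_))))
  simpa [h8, r1, r2, r3, tripleWords] using hQ

theorem Runs.listCmd {e : Ex} {L : ℕ} (h8 : σ 8 = loadInput (l.flatMap triangleWords))
    (h1 : σ 1 = fun _ => 0) (he : ∀ env σ', σ' 0 = σ 0 → e.ok B env σ' ∧ e.val env σ' = L)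
    (hB : 4 * l.length + 4 ≤ B) (hS : 3 * S ≤ B) (hL : 3 * L ≤ B) (hB3 : 3 ≤ B) :
    Runs B (listCmd e) (l.length :: S :: env) σ (1 + l.length * (1 + (1 + (2 + (2 + 2))) + 1))
      fun σ' => σ' 1 = loadInput ((negatives S L l).flatMap tripleWords) := by
  refine Runs.mono (Q := fun σ' => σ' = Function.update σ 1
    (loadInput ((negatives S L (l.take l.length)).flatMap tripleWords))) ?_ le_rfl
    (by rintro _ rfl; simp)
  refine Runs.forV_const (t := 1 + (1 + (2 + (2 + 2)))) (fun k σ' => σ' = Function.update σ 1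
    (loadInput ((negatives S L (l.take k)).flatMap tripleWords))) ?_ ?_ (fun _ => id)
  · have : negatives S L (l.take 0) = [] := by simp [negatives]
    rw [this]
    simp [← h1]
  · rintro k hk _ rfl
    have hk' : k < l.length := hk
    obtain ⟨-, -, -, r4⟩ := loadInput_triangleWords hk'
    have hlen := (length_negatives_le S L (l.take k)).trans (List.length_take_le k l)
    have hlen2 := length_tripleWords (negatives S L (l.take k))
    rw [List.take_add_one, List.getElem?_eq_getElem hk', Option.toList_some, negatives_append]
    obtain ⟨he1, he2⟩ := he (k :: l.length :: S :: env) (Function.update σ 1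
      (loadInput ((negatives S L (l.take k)).flatMap tripleWords))) (by simp)
    have h10 : loadInput ((negatives S L (l.take k)).flatMap tripleWords) 0 =
        3 * (negatives S L (l.take k)).length := hlen2
    set O := negatives S L (l.take k) with hO
    have hle : O.length ≤ k := by
      have := length_negatives_le S L (l.take k)
      rw [List.length_take] at this
      omega
    refine Runs.ite (by simp; omega) (fun c1 => Runs.ite (by simp [he1, he2]; omega)
      (fun c2 => ?_) fun c2 => ?_) fun c1 => ?_
    · simp [h8, r4] at c1
      simp [he2, h10] at c2
      refine Runs.pushTriple hk' (by simp [h8]) (by simp; rfl) hB (by omega) ?_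
      rw [if_pos ⟨c1, c2⟩]
      simp
    · simp [he2, h10] at c2
      refine Runs.time_le (T₁ := 1) (Runs.skip ?_) (by omega)
      rw [if_neg (by omega)]
      simp
    · simp [h8, r4] at c1
      refine Runs.time_le (T₁ := 1) (Runs.skip ?_) (by omega)
      rw [if_neg (by omega)]
      simp

theorem Runs.minCmd (h8 : σ 8 = loadInput (l.flatMap triangleWords))
    (h1 : σ 1 = fun _ => 0) (h10 : σ 10 = fun _ => 0) (hB : 4 * l.length + 4 ≤ B) :
    Runs B minCmd (l.length :: env) σ ((1 + l.length * (1 + 1 + 1)) + (1 + (1 + (2 + (2 + 2)))))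
      fun σ' => (l = [] ∧ σ' 1 = loadInput []) ∨ ∃ i, ∃ hi : i < l.length,
        σ' 1 = loadInput (tripleWords l[i].1) ∧ ∀ j, ∀ hj : j < l.length, l[i].2 ≤ l[j].2 := by
  -- The bank 10 holds the index of the best triangle so far. The alternative `p 0 = 0` covers the
  -- start, when the index 0 is the candidate before anything has been examined.
  refine Runs.seq (Runs.forV_const (t := 1 + 1) (fun k σ' => ∃ p, σ' = Function.update σ 10 p ∧
    (p 0 = 0 ∨ p 0 < k) ∧ ∀ (hp : p 0 < l.length), ∀ j < k, ∀ hj : j < l.length,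
      l[p 0].2 ≤ l[j].2) ⟨σ 10, by simp, by simp [h10], by simp⟩ ?_ ?_)
  · rintro k hk _ ⟨p, rfl, hp, hmin⟩
    have hk' : k < l.length := hk
    have hp' : p 0 < l.length := by omega
    have r1 := (loadInput_triangleWords hk').2.2.2
    have r2 := (loadInput_triangleWords hp').2.2.2
    refine Runs.ite (by simp; omega) (fun c => ?_) fun c => ?_
    · simp [h8, r1, r2] at c
      refine Runs.store (by simp) (by simp) ⟨Function.update p 0 k, by simp, by simp, ?_⟩
      simp only [Function.update_self]
      intro _ j hj hj'
      by_cases e : j = k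
      · subst e; exact le_rfl
      · exact c.le.trans (hmin hp' j (by omega) hj')
    · simp [h8, r1, r2] at c
      refine Runs.skip ⟨p, rfl, by omega, fun hp j hj hj' => ?_⟩
      by_cases e : j = k
      · subst e; exact c
      · exact hmin hp j (by omega) hj'
  rintro _ ⟨p, rfl, hp, hmin⟩
  simp only [List.getD_cons_zero] at hp hmin
  refine Runs.ite (by simp) (fun c => ?_) fun c => ?_
  · simp only [Ex.val_v, List.getD_cons_zero] at c
    have hp' : p 0 < l.length := by omega
    refine Runs.letE (by simp) ?_
    have v1 : (Ex.a 10 0).val (l.length :: env) (Function.update σ 10 p) = p 0 := by simp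
    rw [v1]
    refine Runs.pushTriple (o := []) hp' (by simp [h8]) (by simp [h1]) hB (by simp; omega)
      (Or.inr ⟨p 0, hp', by simp, fun j hj => hmin hp' j hj hj⟩)
  · simp only [Ex.val_v, List.getD_cons_zero, List.length_eq_zero_iff] at c
    exact Runs.time_le (T₁ := 1) (Runs.skip (Or.inl ⟨c, by simp [h1]⟩)) (by omega)

end

/-! ### From the list of triangles to solutions -/

theorem TriInstance.simpleEdges (x : TriInstance) : SimpleEdges x.graph.edges := by
  have := x.simple
  rwa [EdgeList.IsSimple, if_neg Bool.false_ne_true] at this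

/-- A connected graph with two vertices cannot be edgeless. This makes `m ^ (3 / 2)` at least 1, so
that constants can be absorbed. -/
theorem TriInstance.edges_pos (x : TriInstance) : 1 ≤ x.graph.edges.length := by
  by_contra h
  have h0 : x.graph.edges = [] := List.length_eq_zero_iff.mp (by omega)
  have h2 := x.two_le
  have hr := x.connected.preconnected ⟨0, by omega⟩ ⟨1, by omega⟩
  have hbot : x.graph.toSimpleGraph = ⊥ := by
    ext a b
    simp [EdgeList.toSimpleGraph, h0]
  rw [hbot, SimpleGraph.reachable_bot] at hr
  simp at hr

theorem arc_iff {G : EdgeList ℤ} {a b : Fin G.n} {w : ℤ} :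
    G.Arc false a b w ↔ ArcIn G.edges a b w := by
  simp [EdgeList.Arc, ArcIn]

theorem mem_triangleList_iff {x : TriInstance} {A : ℕ → ℕ} {S : ℕ}
    (hA : AdjMat S x.graph.edges A) {a b c : Fin x.graph.n} {s : ℕ} :
    ((a, b, c), s) ∈ triangleList A x.graph.edges ↔
      ∃ t : ℤ, x.graph.IsTriangle a b c t ∧ (s : ℤ) = 3 * S + t := by
  rw [mem_triangleList x.simpleEdges hA]
  constructor
  · rintro ⟨h1, h2, u, v, w, hu, hv, hw, hs⟩
    exact ⟨_, ⟨h1, h2, u, v, w, arc_iff.mpr hu, arc_iff.mpr hv, arc_iff.mpr hw, rfl⟩, hs⟩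
  · rintro ⟨t, ⟨h1, h2, u, v, w, hu, hv, hw, rfl⟩, hs⟩
    exact ⟨h1, h2, u, v, w, arc_iff.mp hu, arc_iff.mp hv, arc_iff.mp hw, hs⟩

/-- Every weight is smaller than `S` in absolute value, so the shifted weight of a triangle is a
natural number. -/
theorem exists_mem_triangleList {x : TriInstance} {A : ℕ → ℕ} {S : ℕ}
    (hS : S = weightBound x.graph.edges) (hA : AdjMat S x.graph.edges A)
    {a b c : Fin x.graph.n} {t : ℤ} (h : x.graph.IsTriangle a b c t) :
    ∃ s : ℕ, ((a, b, c), s) ∈ triangleList A x.graph.edges ∧ (s : ℤ) = 3 * S + t := by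
  obtain ⟨h1, h2, u, v, w, hu, hv, hw, rfl⟩ := h
  have key : ∀ {a b w}, x.graph.Arc false a b w → w.natAbs < S := by
    intro a b w h
    rw [hS]
    rcases arc_iff.mp h with h | h
    · exact natAbs_lt_weightBound h
    · exact natAbs_lt_weightBound h
  have k1 := key hu
  have k2 := key hv
  have k3 := key hw
  refine ⟨(3 * S + (u + v + w)).toNat, (mem_triangleList_iff hA).mpr
    ⟨_, ⟨h1, h2, u, v, w, hu, hv, hw, rfl⟩, ?_⟩, ?_⟩ <;> omega

theorem mem_negTriangles_iff {x : TriInstance} {A : ℕ → ℕ} {S : ℕ}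
    (hS : S = weightBound x.graph.edges) (hA : AdjMat S x.graph.edges A)
    {q : Fin x.graph.n × Fin x.graph.n × Fin x.graph.n} :
    q ∈ ((triangleList A x.graph.edges).filter fun q => q.2 < 3 * S).map Prod.fst ↔
      q ∈ x.graph.negTriangles := by
  obtain ⟨a, b, c⟩ := q
  simp only [List.mem_map, List.mem_filter, decide_eq_true_eq, EdgeList.negTriangles,
    Set.mem_ofPred_eq]
  constructor
  · rintro ⟨⟨q, s⟩, ⟨h1, h2⟩, rfl⟩
    obtain ⟨t, ht, hs⟩ := (mem_triangleList_iff hA).mp h1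
    exact ⟨t, by omega, ht⟩
  · rintro ⟨t, ht, h⟩
    obtain ⟨s, hs, hst⟩ := exists_mem_triangleList hS hA h
    exact ⟨_, ⟨hs, by omega⟩, rfl⟩

/-- In a simple graph the vertices of a triangle determine its weight, so dropping the weights from
the list creates no repetitions. -/
theorem negatives_spec {x : TriInstance} {A : ℕ → ℕ} {S L : ℕ}
    (hS : S = weightBound x.graph.edges) (hA : AdjMat S x.graph.edges A) :
    (negatives S L (triangleList A x.graph.edges)).Nodup ∧
    (∀ q ∈ negatives S L (triangleList A x.graph.edges), q ∈ x.graph.negTriangles) ∧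
    (negatives S L (triangleList A x.graph.edges)).length =
      min L x.graph.negTriangles.ncard := by
  have hnd : (((triangleList A x.graph.edges).filter fun q => q.2 < 3 * S).map Prod.fst).Nodup := by
    refine ((nodup_triangleList x.simpleEdges).filter _).map_on ?_
    rintro ⟨⟨a, b, c⟩, s⟩ h1 ⟨q, s'⟩ h2 hq
    simp only at hq
    subst hq
    obtain ⟨t, ⟨-, -, u, v, w, hu, hv, hw, rfl⟩, hs⟩ :=
      (mem_triangleList_iff hA).mp (List.mem_filter.mp h1).1
    obtain ⟨t', ⟨-, -, u', v', w', hu', hv', hw', rfl⟩, hs'⟩ :=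
      (mem_triangleList_iff hA).mp (List.mem_filter.mp h2).1
    have e1 := x.simpleEdges.arcIn_unique (arc_iff.mp hu) (arc_iff.mp hu')
    have e2 := x.simpleEdges.arcIn_unique (arc_iff.mp hv) (arc_iff.mp hv')
    have e3 := x.simpleEdges.arcIn_unique (arc_iff.mp hw) (arc_iff.mp hw')
    simp only [Prod.mk.injEq, true_and]
    omega
  refine ⟨hnd.sublist (List.take_sublist _ _), fun q hq =>
    (mem_negTriangles_iff hS hA).mp (List.mem_of_mem_take hq), ?_⟩
  have hset : x.graph.negTriangles = (((triangleList A x.graph.edges).filter fun q =>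
      q.2 < 3 * S).map Prod.fst).toFinset := by
    ext q
    rw [Finset.mem_coe, List.mem_toFinset, mem_negTriangles_iff hS hA]
  rw [negatives, List.length_take, hset, Set.ncard_coe_finset, List.toFinset_card_of_nodup hnd]

theorem edgeInput_encode {G : EdgeList ℤ} {o : ℕ} {x : List ℕ}
    (h : ∀ i, loadInput x (i + o + 1) = loadInput (G.encode intWords) (i + 1)) :
    EdgeInput o G.edges (loadInput x) := by
  intro k hk
  have key : ∀ r < 4, loadInput x (4 * k + r + 2 + o + 1) =
      ((G.edges[k]).1.val :: (G.edges[k]).2.1.val :: intWords (G.edges[k]).2.2).getD r 0 := by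
    intro r hr
    rw [h]
    exact getD_flatMap_const (k := 4) (r := r)
      (fun e : Fin G.n × Fin G.n × ℤ => e.1.val :: e.2.1.val :: intWords e.2.2) G.edges
      (fun a => rfl) hk hr
  refine ⟨?_, ?_, ?_, ?_⟩
  · rw [show 4 * k + (o + 3) = 4 * k + 0 + 2 + o + 1 by ring, key 0 (by omega)]; rfl
  · rw [show 4 * k + (o + 4) = 4 * k + 1 + 2 + o + 1 by ring, key 1 (by omega)]; rfl
  · rw [show 4 * k + (o + 5) = 4 * k + 2 + 2 + o + 1 by ring, key 2 (by omega)]; rfl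
  · rw [show 4 * k + (o + 6) = 4 * k + 3 + 2 + o + 1 by ring, key 3 (by omega)]; rfl

/-- A problem on the list of the triangles is solvable in time `O(m ^ (3 / 2))`. -/
theorem solvableInTime_of_triangleList {Q : Problem} {o : ℕ} {post : Cmd} (g : Q.Inst → TriInstance)
    (henc : ∀ x i, loadInput (Q.encode x) (i + o + 1) =
      loadInput ((g x).graph.encode intWords) (i + 1))
    (hlen : ∀ x, (Q.encode x).length = o + ((g x).graph.encode intWords).length)
    (hpost : ∀ (x : Q.Inst) (B S : ℕ) (A : ℕ → ℕ) (σ : Banks), S = weightBound (g x).graph.edges →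
      AdjMat S (g x).graph.edges A →
      4 * (triangleList A (g x).graph.edges).length + 4 ≤ B → 6 * S ≤ B →
      3 * inputSize (Q.encode x) ≤ B → σ 0 = loadInput (Q.encode x) →
      σ 8 = loadInput ((triangleList A (g x).graph.edges).flatMap triangleWords) →
      (σ 1 = fun _ => 0) → (σ 10 = fun _ => 0) →
      Runs B post [(triangleList A (g x).graph.edges).length, S, (g x).graph.edges.length,
        (g x).graph.n] σ (20 * (triangleList A (g x).graph.edges).length + 20) fun σ =>
          σ 1 0 ≤ 3 * (triangleList A (g x).graph.edges).length + 3 ∧ Q.Sol x (outWords σ)) :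
    SolvableInTime Q fun x => ((g x).graph.edges.length : ℝ) ^ (3 / 2 : ℝ) := by
  have hm1 : ∀ x, (1 : ℝ) ≤ (g x).graph.edges.length := fun x => by
    exact_mod_cast (g x).edges_pos
  have hT : ∀ x, (1 : ℝ) ≤ ((g x).graph.edges.length : ℝ) ^ (3 / 2 : ℝ) := fun x =>
    Real.one_le_rpow (hm1 x) (by norm_num)
  have hmT : ∀ x, ((g x).graph.edges.length : ℝ) ≤
      ((g x).graph.edges.length : ℝ) ^ (3 / 2 : ℝ) := fun x => by
    conv_lhs => rw [← Real.rpow_one ((g x).graph.edges.length : ℝ)]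
    exact Real.rpow_le_rpow_of_exponent_le (hm1 x) (by norm_num)
  -- 200 is a generous bound for all constants that occur; `o` accounts for the input words in front
  -- of the graph.
  refine solvableInTime_of_runs (triangleCmd o post) (200 + o) (by omega) hT (fun x => ?_)
    fun x => ?_
  · rw [hlen, length_encode _ _ 2 (fun _ => rfl)]
    have := hT x
    have := hmT x
    push_cast
    nlinarith [(Nat.cast_nonneg o : (0 : ℝ) ≤ o)]
  · set T := ((g x).graph.edges.length : ℝ) ^ (3 / 2 : ℝ) with hTdef
    set Z := inputSize (Q.encode x) + ⌈T⌉₊ with hZ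
    have hi := two_le_inputSize (Q.encode x)
    have hc1 : 1 ≤ ⌈T⌉₊ := Nat.one_le_ceil_iff.mpr (by linarith [hT x])
    have hZ2 : 2 ≤ Z := by omega
    have hpow : ∀ a b, a ≤ Z ^ b → b ≤ 200 → a ≤ Z ^ (200 + o) := fun a b ha hb =>
      ha.trans (Nat.pow_le_pow_right (by omega) (by omega))
    have hmul : ∀ a c, a ≤ c * Z → c + 1 ≤ 200 → a ≤ Z ^ (200 + o) := fun a c ha hc =>
      hpow a (c + 1) (le_pow_of_le_mul hZ2 ha) hc
    have h1 : loadInput (Q.encode x) (o + 1) = (g x).graph.n := by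
      have := henc x 0
      rw [zero_add] at this
      rw [this]; rfl
    have h2 : loadInput (Q.encode x) (o + 2) = (g x).graph.edges.length := by
      have := henc x 1
      rw [show o + 2 = 1 + o + 1 by ring, this]; rfl
    have hnZ : (g x).graph.n ≤ Z := by
      have := loadInput_le (x := Q.encode x) le_rfl (o + 1)
      omega
    have hlenZ : o + 2 + 4 * (g x).graph.edges.length ≤ Z := by
      have h3 := hlen x
      rw [length_encode _ _ 2 (fun _ => rfl)] at h3
      have h4 : (Q.encode x).length ≤ inputSize (Q.encode x) := by rw [inputSize]; omega
      omega
    have hin := edgeInput_encode (henc x)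
    -- Each absolute weight is an input word and hence at most `Z`, so even sums over all edges stay
    -- polynomial in `Z`.
    have hSZ : weightBound (g x).graph.edges ≤ 1 + (g x).graph.edges.length * Z := by
      rw [weightBound]
      have := List.sum_le_card_nsmul ((g x).graph.edges.map fun e => e.2.2.natAbs) Z (by
        simp only [List.mem_map]
        rintro _ ⟨e, he, rfl⟩
        obtain ⟨k, hk, rfl⟩ := List.getElem_of_mem he
        rw [← (hin k hk).2.2.2]
        exact (loadInput_le le_rfl _).trans (Nat.le_add_right _ _))
      rw [List.length_map, smul_eq_mul] at this
      omega
    have hscanR : (scanCost (g x).graph.edges : ℝ) ≤ 2 * T := (g x).simpleEdges.scanCost_le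
    have hscan : scanCost (g x).graph.edges ≤ 2 * Z := by
      have : (scanCost (g x).graph.edges : ℝ) ≤ ((2 * Z : ℕ) : ℝ) := by
        push_cast
        have h4 : T ≤ (Z : ℝ) := (Nat.le_ceil T).trans (by exact_mod_cast Nat.le_add_left _ _)
        linarith
      exact_mod_cast this
    have hZ3 : Z ≤ Z ^ 2 := Nat.le_self_pow two_ne_zero Z
    refine ⟨_, ?_, (Runs.triangleCmd (E := (g x).graph.edges) (t := 20 * scanCost (g x).graph.edges + 20)
      (Q := fun σ => (σ 1 0 : ℝ) ≤ ((200 + o : ℕ) : ℝ) * T ∧ Q.Sol x (outWords σ)) rfl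
      (g x).simpleEdges rfl h1 h2 hin ?_ ?_ ?_ ?_ ?_)⟩
    · push_cast
      have := hmT x
      have := hT x
      nlinarith [(Nat.cast_nonneg o : (0 : ℝ) ≤ o)]
    · exact hmul _ 3 (by omega) (by omega)
    · refine hpow _ 4 ?_ (by omega)
      calc (g x).graph.n * (g x).graph.n + 3 * (g x).graph.n ≤ Z * Z + 3 * Z := by gcongr
        _ ≤ 4 * Z ^ 2 := by nlinarith
        _ ≤ Z ^ 2 * Z ^ 2 := by gcongr; nlinarith
        _ = Z ^ 4 := by ring
    · refine hpow _ 5 ?_ (by omega)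
      have hmZ : (g x).graph.edges.length * Z ≤ Z * Z := Nat.mul_le_mul_right _ (by omega)
      calc 6 * weightBound (g x).graph.edges ≤ 6 * (1 + Z * Z) := by omega
        _ ≤ 8 * Z ^ 2 := by nlinarith
        _ ≤ Z ^ 3 * Z ^ 2 := by gcongr; exact Nat.pow_le_pow_left hZ2 3
        _ = Z ^ 5 := by ring
    · exact hmul _ 10 (by omega) (by omega)
    · intro A σ hA s0 s8 s1 s10
      have hl := length_triangleList_le A (g x).graph.edges
      refine (hpost x _ _ A σ rfl hA ?_ ?_ ?_ s0 s8 s1 s10).mono (by omega) ?_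
      · exact hmul _ 10 (by omega) (by omega)
      · refine hpow _ 5 ?_ (by omega)
        have hmZ : (g x).graph.edges.length * Z ≤ Z * Z := Nat.mul_le_mul_right _ (by omega)
        calc 6 * weightBound (g x).graph.edges ≤ 6 * (1 + Z * Z) := by omega
          _ ≤ 8 * Z ^ 2 := by nlinarith
          _ ≤ Z ^ 3 * Z ^ 2 := by gcongr; exact Nat.pow_le_pow_left hZ2 3
          _ = Z ^ 5 := by ring
      · exact hmul _ 3 (by omega) (by omega)
      · rintro σ ⟨e1, e2⟩
        refine ⟨?_, e2⟩
        have e3 : (σ 1 0 : ℝ) ≤ 3 * scanCost (g x).graph.edges + 3 := by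
          exact_mod_cast e1.trans (by omega : _ ≤ 3 * scanCost (g x).graph.edges + 3)
        have := hT x
        push_cast
        nlinarith [(Nat.cast_nonneg o : (0 : ℝ) ≤ o)]

theorem negatives_output {x : TriInstance} {A : ℕ → ℕ} {S L : ℕ} {σ : Banks}
    (h : σ 1 = loadInput ((negatives S L (triangleList A x.graph.edges)).flatMap tripleWords)) :
    σ 1 0 ≤ 3 * (triangleList A x.graph.edges).length + 3 := by
  have h1 : loadInput ((negatives S L (triangleList A x.graph.edges)).flatMap tripleWords) 0 =
    3 * (negatives S L (triangleList A x.graph.edges)).length := length_tripleWords _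
  have := length_negatives_le S L (triangleList A x.graph.edges)
  rw [h, h1]
  omega

/-- Negative Triangle is treated as listing with `L = 1`. For the listing problem `L` is the first
input word, so the graph is shifted by one; at most all enumerated triangles are output, which makes
the time uniform in `L`. -/
theorem hasAlgorithm_triangleProblem (Q : TriangleProblem) :
    HasAlgorithm Q.problem fun m _ => (m : ℝ) ^ (3 / 2 : ℝ) := by
  cases Q with
  | minWeight =>
    refine solvableInTime_of_triangleList (Q := minWeightTriangle.toProblem) (o := 0)
      (post := minCmd) (fun x => x) (fun x i => rfl) (fun x => (zero_add _).symm) ?_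
    intro x B S A σ hS hA hB1 hB2 hB3 s0 s8 s1 s10
    refine (Runs.minCmd s8 s1 s10 hB1).mono (by omega) ?_
    rintro σ' (⟨h1, h2⟩ | ⟨i, hi, h2, h3⟩)
    · refine ⟨by simp [h2], ?_⟩
      rw [outWords_of_loadInput h2]
      refine Or.inr ⟨fun a b c t ht => ?_, rfl⟩
      obtain ⟨s, hs, -⟩ := exists_mem_triangleList hS hA ht
      rw [h1] at hs
      simp at hs
    · refine ⟨by simp [h2, loadInput, tripleWords], ?_⟩
      rw [outWords_of_loadInput h2]
      obtain ⟨t, ht, hs⟩ := (mem_triangleList_iff hA).mp (List.getElem_mem hi)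
      refine Or.inl ⟨_, _, _, t, ht, fun a b c t' ht' => ?_, rfl⟩
      obtain ⟨s', hs', e'⟩ := exists_mem_triangleList hS hA ht'
      obtain ⟨j, hj, e⟩ := List.getElem_of_mem hs'
      have h4 := h3 j hj
      rw [e] at h4
      have h5 : (triangleList A x.graph.edges)[i].2 ≤ s' := h4
      have h6 : ((triangleList A x.graph.edges)[i].2 : ℤ) = 3 * S + t := hs
      omega
  | negative =>
    refine solvableInTime_of_triangleList (Q := negativeTriangle.toProblem) (o := 0)
      (post := listCmd 1) (fun x => x) (fun x i => rfl) (fun x => (zero_add _).symm) ?_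
    intro x B S A σ hS hA hB1 hB2 hB3 s0 s8 s1 s10
    have h0 := two_le_inputSize (negativeTriangle.encode x)
    refine (Runs.listCmd (L := 1) s8 s1 (fun env σ' _ => ⟨by simp; omega, rfl⟩) hB1 (by omega)
      (by omega) (by omega)).mono (by omega) ?_
    rintro σ' h
    refine ⟨negatives_output h, ?_⟩
    rw [outWords_of_loadInput h]
    obtain ⟨h1, h2, h3⟩ := negatives_spec (L := 1) hS hA
    have hfin : x.graph.negTriangles.Finite := Set.toFinite _
    by_cases hne : x.graph.negTriangles = ∅
    · rw [hne, Set.ncard_empty, Nat.min_zero, List.length_eq_zero_iff] at h3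
      exact Or.inr ⟨hne, by rw [h3]; rfl⟩
    · have hpos := (Set.ncard_pos hfin).mpr (Set.nonempty_iff_ne_empty.mpr hne)
      rw [min_eq_left hpos, List.length_eq_one_iff] at h3
      obtain ⟨q, hq⟩ := h3
      exact Or.inl ⟨q, h2 q (by rw [hq]; simp), by rw [hq]; simp⟩
  | negativeListing =>
    refine solvableInTime_of_triangleList (Q := negativeTriangleListing.toProblem) (o := 1)
      (post := listCmd (.a 0 1)) (fun x => x.1) (fun x i => rfl) (fun x => add_comm _ _) ?_
    intro x B S A σ hS hA hB1 hB2 hB3 s0 s8 s1 s10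
    have h0 := two_le_inputSize (negativeTriangleListing.encode x)
    have hL : x.2 ≤ inputSize (negativeTriangleListing.encode x) :=
      loadInput_le (x := negativeTriangleListing.encode x) le_rfl 1
    refine (Runs.listCmd (L := x.2) s8 s1 (fun env σ' h => ⟨by simp; omega, ?_⟩) hB1 (by omega)
      (by omega) (by omega)).mono (by omega) ?_
    · simp only [Ex.val_a, Ex.val_ofNat, h, s0]
      rfl
    rintro σ' h
    refine ⟨negatives_output h, ?_⟩
    rw [outWords_of_loadInput h]
    obtain ⟨h1, h2, h3⟩ := negatives_spec (L := x.2) hS hA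
    exact ⟨_, h1, h2, h3, rfl⟩

/-! ### The growth exponent of powers, and the theorem -/

/-- `log (m ^ α) / log n` is `α` times `log m / log n`, which tends to 1 along the sparse limit. -/
theorem isTimeBound_rpow (α : ℝ) : IsTimeBound fun m _ => (m : ℝ) ^ α := by
  refine ⟨fun m n hn hmn => Real.rpow_pos_of_pos (by exact_mod_cast (by omega : 0 < m)) _,
    (α : EReal), ?_⟩
  refine (continuous_coe_real_ereal.tendsto α).comp ?_
  have h1 : Tendsto (fun p : ℕ × ℕ => α * (Real.log p.1 / Real.log p.2)) sparseLimit (𝓝 (α * 1)) := by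
    refine Tendsto.const_mul _ (tendsto_comap.mono_left ?_)
    exact inf_le_left.trans inf_le_right
  rw [mul_one] at h1
  refine h1.congr' ?_
  have h2 : ∀ᶠ p in sparseLimit, p ∈ {p : ℕ × ℕ | p.2 ≤ p.1 + 1} :=
    (inf_le_right : sparseLimit ≤ _) (mem_principal_self _)
  have h3 : ∀ᶠ p : ℕ × ℕ in sparseLimit, 2 ≤ p.2 :=
    (tendsto_comap.mono_left (inf_le_left.trans inf_le_left : sparseLimit ≤ _)).eventually_ge_atTop 2
  filter_upwards [h2, h3] with p hp hp2
  have : (0 : ℝ) < p.1 := by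
    have : p.2 ≤ p.1 + 1 := hp
    exact_mod_cast (by omega : 0 < p.1)
  rw [Real.log_rpow this, mul_div_assoc]

end SparseSplit

theorem mainTheorem7 (h : SETH ∨ KDSH) (Q : TriangleProblem) :
    ∃ T : ℕ → ℕ → ℝ, IsTimeBound T ∧ HasAlgorithm Q.problem T ∧
      ∀ (directed weighted : Bool) (T' : ℕ → ℕ → ℝ), IsTimeBound T' →
        HasAlgorithm (eccentricities directed weighted) T' → IsSmallerForSparse T T' := by
  refine ⟨_, isTimeBound_rpow (3 / 2), hasAlgorithm_triangleProblem Q, ?_⟩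
  intro directed weighted T' hT' halg
  -- A growth exponent below 2 contradicts whichever hypothesis is assumed, so only the case of
  -- large growth survives.
  rcases hT'.growth_cases with ⟨q, η, hq, hq2, hη, n₀, hn₀⟩ | hgrowth
  · rcases h with h | h
    · exact absurd h (not_SETH_of_hasAlgorithm hq hq2 hη hn₀ halg)
    · exact absurd h (not_KDSH_of_hasAlgorithm hq hq2 hη hn₀ halg)
  · exact isSmallerForSparse_of_growth hT'.1 hgrowth
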